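/- Let $n\ge 0$ and $[n]=\{1,\dots,n\}$. **Well-labelled positive paths.** A well-labelled positive path of size $n$ is a pair $(p,\pi)$, where $p$ is a lattice path with $n-1$ steps from $\{\nearrow,\rightarrow,\searrow\}=\{(1,1),(1,0),(1,-1)\}$ (no steps if $n=0$) that starts at $(0,0)$ and never goes below the $x$-axis, and $\pi=\pi_1\cdots\pi_n$ is a permutation of $[n]$ with $\pi_i<\pi_{i+1}$ (resp. $\pi_i>\pi_{i+1}$) whenever the $i$th step of $p$ is $\nearrow$ (resp. $\searrow$). Cutting the word $\pi$ between $\pi_i$ and $\pi_{i+1}$ for every $i$ for which the $i$th step is not $\rightarrow$ gives a sequence of nonempty words, the clusters of $(p,\pi)$. Let $\mathcal P_n$ be the set of these pairs. A permutation $\pi$ of $[n]$ is a ballot permutation if every prefix of $\pi$ has at most as many descents as ascents; let $\mathcal B_n$ be the set of ballot permutations. It is regarded as the subset of $\mathcal P_n$ of pairs without $\rightarrow$ steps. **Odd order cluster-permutations.** An odd order cluster-permutation of size $n$ is a set of cycles of odd length (taken up to cyclic shift), the entries of which are nonempty words over $[n]$, called its clusters, such that each element of $[n]$ occurs exactly once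 in exactly one of the clusters. Let $\mathcal{OC}_n$ be the set of them. A permutation of $[n]$ all of whose cycles have odd length is regarded as the element of $\mathcal{OC}_n$ given by its cycles (fixed points included), each letter being a cluster of size one. For a word $c=a_1\cdots a_k$ let $c^r=a_k\cdots a_1$. **The map $\psi$.** A box-permutation on a finite set $A$ of positive integers is a word in which each element of $A$ occurs once and in which boxes $\Box$ may occur, such that it is the increasing word on $A$ if there is no box, and otherwise the integers before the first box and those after the last one form increasing words of length $\ge1$ and the integers between two successive boxes form an increasing word of length $\ge2$. Let $\sigma=\sigma_1\cdots\sigma_N$ be a box-permutation on $A$ and, if $A\ne\emptyset$, $m=\min A$. The set of cycles $\psi(\sigma)$ is defined recursively, with $\psi(\emptyset)=\emptyset$: 1. If $\sigma_1=m$ and $\sigma_2\ne\Box$ (or $N=1$), then $\psi(\sigma)=\{(m)\}\cup\psi(\sigma_2\cdots\sigma_N)$. 2. If $\sigma_{2\ell+1}=m$ with $\ell\ge1$, then $\psi(\sigma)=\{(m\,\sigma_1\cdots\sigma_{2\ell})\}\cup\psi(\sigma_{2\ell+2}\cdots\sigma_N)$. 3. Otherwise let $\sigma'=\phi(\sigma)$,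 in which $m=\sigma'_{2\ell+1}$ for some $\ell\ge1$; then $\psi(\sigma)=\{(m\,\sigma'_{2\ell}\sigma'_{2\ell-1}\cdots\sigma'_1)\}\cup\psi(\sigma'_{2\ell+2}\cdots\sigma'_N)$. Here $\phi$ is as follows. If $\sigma_1=m$ and $\sigma_2=\Box$, interchange $\sigma_1$ and $\sigma_3$. Otherwise $\sigma_j=m$ for an even $j$. Let $\sigma_i=a$ be the left neighbour of the first box, and let $\sigma_k=x$ be the left neighbour of the first box to the right of $m$ (if there is none, $k=N+1$ and $x=\infty$). Let $T=\{\sigma_s: 1\le s<i\text{ or }j<s<k\}$. * If $T\ne\emptyset$ and $t=\min T<\min\{a,x\}$, then $t=\sigma_1$ or $t=\sigma_{j+1}$; if $t=\sigma_1$, delete $t$ and insert it right after $m$; if $t=\sigma_{j+1}$, delete $t$ and insert it at the front. * Otherwise, if $x<a$ (then $k=j+1$), delete the subword $x\,\Box\,\sigma_{k+2}$ and insert $\sigma_{k+2}\,\Box\,x$ at the front. * Otherwise ($a<x$ and $i=1$), delete the subword $a\,\Box\,\sigma_3$ from the front and insert $\sigma_3\,\Box\,a$ right after $m$. **The map $\Psi$.**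 Let $\pi\in\mathcal B_n$. A Dyck factor of $\pi$ is a consecutive subword of length $\ge3$ that has as many ascents as descents and each prefix of which has at most as many descents as ascents. Replace the interior (all but the first and last letters) of each inclusion-maximal Dyck factor of $\pi$ by one box, to get a box-permutation $\sigma$ on a subset of $[n]$. In the cycles of $\psi(\sigma)$, for every maximal Dyck factor $d_1\cdots d_k$, replace the box between $d_1$ and $d_k$ by $d_2\cdots d_{k-1}$ if the cycle has the form $(\dots,d_1,\Box,d_k,\dots)$, and by $d_{k-1}\cdots d_2$ if it has the form $(\dots,d_k,\Box,d_1,\dots)$. The resulting cycles are the cycles of the permutation $\Psi(\pi)$. **Theorem.** There is a bijection $\Phi:\mathcal P_n\to\mathcal{OC}_n$ such that * for every $x\in\mathcal P_n$, the clusters of $x$ and of $\Phi(x)$ coincide up to reversal: for every word $c$, one of $c$, $c^r$ is a cluster of $x$ if and only if one of $c$, $c^r$ is a cluster of $\Phi(x)$; * $\Phi(\pi)=\Psi(\pi)$ for every $\pi\in\mathcal B_n$ (in particular, all cycles of $\Psi(\pi)$ have odd length). -/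

import Mathlib

/-! Letters are the elements of `Fin n` (the alphabet `1 < 2 < ... < n`, shifted by one);
words are lists, and the one-line notation of a permutation `π` is the word `List.ofFn π`. -/

namespace BallotCluster

section Words

variable {α : Type*} [LinearOrder α]

/-- The number of ascents of a word. -/
def asc : List α → ℕ
  | a :: b :: w => (if a < b then 1 else 0) + asc (b :: w)
  | _ => 0

/-- The number of descents of a word. -/
def des : List α → ℕ
  | a :: b :: w => (if b < a then 1 else 0) + des (b :: w)
  | _ => 0

/-- Every prefix has at most as many descents as ascents. -/
def IsBallotWord (w : List α) : Prop := ∀ u ∈ w.inits, des u ≤ asc u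

instance (w : List α) : Decidable (IsBallotWord w) :=
  inferInstanceAs (Decidable (∀ u ∈ w.inits, des u ≤ asc u))

/-- A ballot word whose last letter has height `0`. -/
def IsDyckWord (w : List α) : Prop := IsBallotWord w ∧ asc w = des w

instance (w : List α) : Decidable (IsDyckWord w) :=
  inferInstanceAs (Decidable (_ ∧ _))

end Words

section Paths

/-- The steps `(1,1)`, `(1,0)`, `(1,-1)`. -/
inductive Step
  | up
  | flat
  | down
  deriving DecidableEq

/-- The vertical displacement of a step. -/
def Step.dy : Step → ℤ
  | .up => 1
  | .flat => 0
  | .down => -1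

/-- The height of the endpoint of a path that starts on the `x`-axis. -/
def height (p : List Step) : ℤ := (p.map Step.dy).sum

/-- A well-labelled positive path of size `n`: a path with `n - 1` steps from the origin, all of
whose points have nonnegative height, with a permutation of the letters that ascends along the
up steps and descends along the down steps. -/
@[ext]
structure WellLabelledPath (n : ℕ) where
  path : List Step
  length_path : path.length = n - 1
  nonneg : ∀ k : ℕ, 0 ≤ height (path.take k)
  label : Equiv.Perm (Fin n)
  label_up : ∀ (i : ℕ) (h : i + 1 < n), path[i]? = some Step.up →
    label ⟨i, Nat.lt_of_succ_lt h⟩ < label ⟨i + 1, h⟩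
  label_down : ∀ (i : ℕ) (h : i + 1 < n), path[i]? = some Step.down →
    label ⟨i + 1, h⟩ < label ⟨i, Nat.lt_of_succ_lt h⟩

/-- Cut the word `w` at every step of the path that is not horizontal; the `i`-th step of the path
joins the `i`-th and the `(i+1)`-st letter. -/
def cutWord {α : Type*} : List α → List Step → List (List α)
  | [], _ => []
  | a :: w, [] => [a] :: cutWord w []
  | a :: w, Step.flat :: p =>
    match cutWord w p with
    | [] => [[a]]
    | c :: cs => (a :: c) :: cs
  | a :: w, _ :: p => [a] :: cutWord w p

/-- The clusters of a well-labelled positive path (of the ballot cluster-permutation which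
represents it), from left to right. -/
def WellLabelledPath.clusters {n : ℕ} (x : WellLabelledPath n) : List (List (Fin n)) :=
  cutWord (List.ofFn x.label) x.path

/-- `c` is a cluster in `x`. -/
def WellLabelledPath.HasCluster {n : ℕ} (x : WellLabelledPath n) (c : List (Fin n)) : Prop :=
  c ∈ x.clusters

/-- The path of a word without horizontal steps. -/
def wordPath {α : Type*} [LinearOrder α] : List α → List Step
  | a :: b :: w => (if a < b then Step.up else Step.down) :: wordPath (b :: w)
  | _ => []

/-- A ballot permutation of size `n`. -/
def BallotPerm (n : ℕ) : Type := {π : Equiv.Perm (Fin n) // IsBallotWord (List.ofFn π)}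

theorem length_wordPath {α : Type*} [LinearOrder α] (w : List α) :
    (wordPath w).length = w.length - 1 := by
  induction w with
  | nil => rfl
  | cons a w ih =>
    cases w with
    | nil => rfl
    | cons b w => simp [wordPath, ih]

theorem height_wordPath {α : Type*} [LinearOrder α] (w : List α) (hw : w.Nodup) (k : ℕ) :
    height ((wordPath w).take k) = asc (w.take (k + 1)) - des (w.take (k + 1)) := by
  induction w generalizing k with
  | nil => simp [wordPath, height, asc, des]
  | cons a w ih =>
    cases w with
    | nil => simp [wordPath, height, asc, des]
    | cons b w =>
      cases k with
      | zero => simp [height, asc, des]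
      | succ k =>
        have h := ih hw.of_cons k
        have hab : a ≠ b := by
          intro h
          simp [h] at hw
        rcases lt_or_gt_of_ne hab with hlt | hlt
        · simp [wordPath, height, asc, des, hlt, hlt.not_gt, Step.dy] at h ⊢
          linarith
        · simp [wordPath, height, asc, des, hlt, hlt.not_gt, Step.dy] at h ⊢
          linarith

theorem getElem_wordPath {α : Type*} [LinearOrder α] (w : List α) (i : ℕ)
    (h : i + 1 < w.length) :
    (wordPath w)[i]? = some (if w[i] < w[i + 1] then Step.up else Step.down) := by
  induction w generalizing i with
  | nil => simp at h
  | cons a w ih =>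
    cases w with
    | nil => simp at h
    | cons b w =>
      cases i with
      | zero => simp [wordPath]
      | succ i =>
        have h' := ih i (by simpa using h)
        rw [wordPath, List.getElem?_cons_succ, h']
        rfl

/-- A ballot permutation, as a well-labelled positive path without horizontal steps. -/
def BallotPerm.toPath {n : ℕ} (π : BallotPerm n) : WellLabelledPath n where
  path := wordPath (List.ofFn π.1)
  length_path := by simp [length_wordPath]
  nonneg k := by
    rw [height_wordPath _ (List.nodup_ofFn.2 π.1.injective)]
    have h := π.2 ((List.ofFn π.1).take (k + 1)) ((List.mem_inits _ _).2 (List.take_prefix _ _))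
    omega
  label := π.1
  label_up i h hi := by
    rw [getElem_wordPath _ _ (by simpa using h)] at hi
    by_contra hc
    simp [hc] at hi
  label_down i h hi := by
    rw [getElem_wordPath _ _ (by simpa using h)] at hi
    have hne : π.1 ⟨i, Nat.lt_of_succ_lt h⟩ ≠ π.1 ⟨i + 1, h⟩ := fun e => by
      simpa using π.1.injective e
    rcases lt_or_gt_of_ne hne with hlt | hlt
    · simp [hlt] at hi
    · exact hlt

end Paths

section OddClusterPermutations

/-- An odd order cluster-permutation of size `n`: a set of cycles of odd length, whose entries are
nonempty words (the clusters), in which each letter occurs exactly once altogether. -/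
@[ext]
structure OddClusterPerm (n : ℕ) where
  cycles : Finset (Cycle (List (Fin n)))
  odd_length : ∀ C ∈ cycles, Odd C.length
  ne_nil : ∀ C ∈ cycles, ∀ c ∈ C, c ≠ []
  letters : (cycles.val.bind fun C => C.toMultiset.bind fun c => (c : Multiset (Fin n)))
    = (Finset.univ : Finset (Fin n)).val

/-- `c` is a cluster in `s`. -/
def OddClusterPerm.HasCluster {n : ℕ} (s : OddClusterPerm n) (c : List (Fin n)) : Prop :=
  ∃ C ∈ s.cycles, c ∈ C

end OddClusterPermutations

section BoxPermutations

/-! Words with boxes are lists over `Option α`; the box is `none`. -/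

variable {α : Type*} [LinearOrder α]

/-- The map `φ` on a box-permutation `σ` with smallest letter `m`, for `σ` which either starts with
`m` followed by a box or has `m` in an even position. -/
def boxPhi (m : α) (σ : List (Option α)) : List (Option α) :=
  -- `σ = pre m post`
  let pre := σ.takeWhile (fun c => c ≠ some m)
  let post := σ.drop (pre.length + 1)
  match pre, post with
  -- first kind: `m □ y ⋯ ↦ y □ m ⋯`
  | [], none :: y :: rest => y :: none :: some m :: rest
  | _, _ =>
    -- otherwise, `left` ends in `a`, the left neighbour of the first box; `right` is the increasing
    -- run after `m`, which ends in `x` if a box follows it; otherwise `x = ∞`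
    let left := (pre.takeWhile Option.isSome).reduceOption
    let right := (post.takeWhile Option.isSome).reduceOption
    let boxAfter : Bool := none ∈ post
    let a : WithTop α := left.getLast?.elim ⊤ (fun y => (y : WithTop α))
    let x : WithTop α :=
      if boxAfter then right.getLast?.elim ⊤ (fun y => (y : WithTop α)) else ⊤
    let T := left.dropLast ++ (if boxAfter then right.dropLast else right)
    -- the minimum of the empty list is `⊤`
    let t : WithTop α := T.minimum
    if t < min a x then
      -- move the letter `t` between the front of the word and the place right after `m`
      match left.head?, post with
      | some y, _ =>
        if (y : WithTop α) = t then pre.tail ++ some m :: some y :: post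
        else post.take 1 ++ pre ++ some m :: post.tail
      | none, _ => σ
    else if x < a then
      -- `pre m x □ y ⋯ ↦ y □ x pre m ⋯`
      match post with
      | z :: none :: y :: rest => y :: none :: z :: pre ++ some m :: rest
      | _ => σ
    else
      -- `a □ y rest m post ↦ rest m y □ a post`
      match pre with
      | z :: none :: y :: rest => rest ++ some m :: y :: none :: z :: post
      | _ => σ

/-- The recursion for `ψ`, with a bound on the number of calls; every call splits off one cycle. -/
def boxPsiAux : ℕ → List (Option α) → List (List (Option α))
  | 0, _ => []
  | k + 1, σ =>
    match σ.reduceOption.min? with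
    | none => []
    | some m =>
      -- `i + 1` is the position of the smallest letter `m`
      let i := σ.idxOf (some m)
      if i = 0 ∧ σ[1]? ≠ some none then
        [some m] :: boxPsiAux k σ.tail
      else if i ≠ 0 ∧ Even i then
        (some m :: σ.take i) :: boxPsiAux k (σ.drop (i + 1))
      else
        let τ := boxPhi m σ
        let j := τ.idxOf (some m)
        (some m :: (τ.take j).reverse) :: boxPsiAux k (τ.drop (j + 1))

/-- The map `ψ` from box-permutations to cyclic box-permutations; a cyclic box-permutation is given
by a list of its cycles, and each cycle by one of its representatives. -/
def boxPsi (σ : List (Option α)) : List (List (Option α)) := boxPsiAux σ.length σ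

end BoxPermutations

section Psi

variable {α : Type*} [LinearOrder α]

/-- The consecutive subword of `w` from index `i` to index `j` (both included). -/
def factor (w : List α) (i j : ℕ) : List α := (w.drop i).take (j + 1 - i)

/-- Indices `i`, `j` delimit a consecutive subword of size at least `3` that is a Dyck word. -/
def IsDyckFactor (w : List α) (i j : ℕ) : Prop :=
  i + 2 ≤ j ∧ j < w.length ∧ IsDyckWord (factor w i j)

instance (w : List α) (i j : ℕ) : Decidable (IsDyckFactor w i j) :=
  inferInstanceAs (Decidable (_ ∧ _ ∧ _))

/-- A Dyck factor that is not properly contained in another one. -/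
def IsMaxDyckFactor (w : List α) (i j : ℕ) : Prop :=
  IsDyckFactor w i j ∧
    ∀ i' ≤ i, ∀ j' < w.length, j ≤ j' ∧ IsDyckFactor w i' j' → i' = i ∧ j' = j

instance (w : List α) (i j : ℕ) : Decidable (IsMaxDyckFactor w i j) :=
  inferInstanceAs (Decidable (_ ∧
    ∀ i' ≤ i, ∀ j' < w.length, j ≤ j' ∧ IsDyckFactor w i' j' → i' = i ∧ j' = j))

/-- The list of all (delimiting pairs of) maximal Dyck factors. -/
def maxDyckFactors (w : List α) : List (ℕ × ℕ) :=
  (List.product (List.range w.length) (List.range w.length)).filter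
    (fun f => IsMaxDyckFactor w f.1 f.2)

/-- The maximal Dyck factors themselves. -/
def maxDyckWords (w : List α) : List (List α) :=
  (maxDyckFactors w).map (fun f => factor w f.1 f.2)

/-- Replace the interior of each maximal Dyck factor by a box. -/
def boxWord (w : List α) : List (Option α) :=
  (List.range w.length).flatMap fun k =>
    if ∃ f ∈ maxDyckFactors w, k = f.1 + 1 then [none]
    else if ∃ f ∈ maxDyckFactors w, f.1 < k ∧ k < f.2 then []
    else w[k]?.toList.map some

/-- The word which replaces a box with left neighbour `l` and right neighbour `r`: the interior of
the word of `D` with first and last letters `l`, `r`, or the reversed interior of the word of `D`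
with first and last letters `r`, `l`. -/
def boxContent (D : List (List α)) (l r : Option α) : List α :=
  match D.find? (fun d => d.head? = l ∧ d.getLast? = r) with
  | some d => d.tail.dropLast
  | none =>
    match D.find? (fun d => d.head? = r ∧ d.getLast? = l) with
    | some d => d.tail.dropLast.reverse
    | none => []

/-- Insert the words of `D` into the boxes of a cycle (given by a representative). -/
def fillCycle (D : List (List α)) (C : List (Option α)) : List α :=
  (List.range C.length).flatMap fun k =>
    match C[k]? with
    | some (some a) => [a]
    | some none =>
      boxContent D C[(k + C.length - 1) % C.length]?.join C[(k + 1) % C.length]?.join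
    | none => []

/-- The cycles of the image under `Ψ` of the permutation with one-line notation `w`. -/
def psiCycles (w : List α) : List (List α) :=
  (boxPsi (boxWord w)).map (fillCycle (maxDyckWords w))

/-- The image `Ψ(π)` of a ballot permutation: the set of its cycles, each letter being regarded as
a cluster of size one. -/
def Psi {n : ℕ} (π : BallotPerm n) : Finset (Cycle (List (Fin n))) :=
  ((psiCycles (List.ofFn π.1)).map
    (fun C => ((C.map (fun a => [a]) : List (List (Fin n))) : Cycle (List (Fin n))))).toFinset

end Psi

end BallotCluster

/-!
Fix a set `K` of classes of words up to reversal. The paths whose clusters have these classes are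
the ballot sequences among the arrangements of representatives of `K`: the heights of successive
clusters differ by `±1`, a sign determined by the letters at the junction. Cut an arbitrary
arrangement where its height is minimal for the first time, and reverse the left part together with
its words. This gives a pair of ballot sequences, and interchanging the two components flips the
sign at the junction; so the pairs of ballot sequences that jointly use `K` are twice as many as all
arrangements, which determines the number of ballot sequences recursively. Sets of odd cycles
satisfy the same recursion, since their exponential generating function `F` has
`(1 - X ^ 2) F' = F` and thus `F ^ 2 = (1 + X) / (1 - X)`. Hence there are as many paths as odd
order cluster-permutations with the classes `K`.

It remains to see that `Ψ` is a bijection when all clusters are single letters, and by counting it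
suffices that it is onto. By the cycle lemma, an odd cycle or its inverse is a cyclic sequence of an
odd number of Dyck words, each of which ascends to the next one. Contracting the Dyck words to their
extremal letters, one can run the recursion for `ψ` backwards, adjoining the cycle that contains the
smallest letter last, and obtains a ballot permutation with the given image.
-/

namespace BallotCluster

theorem isRotated_flatMap {β γ : Type*} {l l' : List β} (h : l ~r l') (f : β → List γ) :
    l.flatMap f ~r l'.flatMap f := by
  obtain ⟨k, hk, rfl⟩ := List.isRotated_iff_mod.1 h
  conv_lhs => rw [← List.take_append_drop k l]
  rw [List.rotate_eq_drop_append_take hk, List.flatMap_append, List.flatMap_append]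
  exact List.isRotated_append

section Reversal

variable {X : Type*} (rev : X → X)

/-- The objects of `X` up to the reversal `rev`. -/
def Unoriented : Type _ := Quot fun x y => y = rev x

/-- The class of an object up to reversal. -/
def unorient : X → Unoriented rev := Quot.mk _

theorem unorient_rev (x : X) : unorient rev (rev x) = unorient rev x :=
  (Quot.sound (r := fun x y => y = rev x) rfl).symm

variable {rev}

/-- A function that is invariant under reversal, as a function of unoriented objects. -/
def Unoriented.lift {β : Type*} (g : X → β) (hg : ∀ x, g (rev x) = g x) : Unoriented rev → β :=
  Quot.lift g fun x _ h => h ▸ (hg x).symm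

theorem unorient_eq_iff (hrev : Function.Involutive rev) {x y : X} :
    unorient rev x = unorient rev y ↔ x = y ∨ x = rev y := by
  constructor
  · intro h
    have hset : ({x, rev x} : Set X) = {y, rev y} := congrArg
      (Unoriented.lift (rev := rev) (fun z => ({z, rev z} : Set X))
        fun z => by rw [hrev, Set.pair_comm]) h
    simpa [hset] using Set.mem_insert x {rev x}
  · rintro (rfl | rfl)
    · rfl
    · exact unorient_rev rev y

end Reversal

section Pieces

/-- A nonempty word. The words with boxes that occur in the computation of `Ψ` arise from sequences
of nonempty words (Dyck words and reversed Dyck words, including single letters), whose interiors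
are hidden in boxes. -/
abbrev Piece (α : Type*) : Type _ := {w : List α // w ≠ []}

namespace Piece

variable {α : Type*}

/-- The first letter of a piece. -/
def first (x : Piece α) : α := x.1.head x.2

/-- The last letter of a piece. -/
def last (x : Piece α) : α := x.1.getLast x.2

/-- The reversed piece. -/
def rev (x : Piece α) : Piece α := ⟨x.1.reverse, by simpa using x.2⟩

@[simp] theorem first_rev (x : Piece α) : x.rev.first = x.last := by simp [first, last, rev]

@[simp] theorem last_rev (x : Piece α) : x.rev.last = x.first := by simp [first, last, rev]

theorem rev_involutive : Function.Involutive (rev (α := α)) := fun x =>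
  Subtype.ext x.1.reverse_reverse

end Piece

/-- The sequences of pieces agree up to permutation and reversal of the pieces. -/
def RevPerm {α : Type*} (us ws : List (Piece α)) : Prop :=
  (us.map (unorient Piece.rev)).Perm (ws.map (unorient Piece.rev))

namespace RevPerm

variable {α : Type*} {us vs ws us' ws' : List (Piece α)}

theorem of_perm (h : us.Perm ws) : RevPerm us ws := h.map _

theorem refl (us : List (Piece α)) : RevPerm us us := of_perm (.refl us)

theorem trans (h : RevPerm us vs) (h' : RevPerm vs ws) : RevPerm us ws := List.Perm.trans h h'

theorem symm (h : RevPerm us ws) : RevPerm ws us := List.Perm.symm h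

theorem length_eq (h : RevPerm us ws) : us.length = ws.length := by
  simpa using List.Perm.length_eq h

theorem append (h : RevPerm us ws) (h' : RevPerm us' ws') : RevPerm (us ++ us') (ws ++ ws') := by
  simpa only [RevPerm, List.map_append] using List.Perm.append h h'

theorem rev_cons (x : Piece α) (ws : List (Piece α)) : RevPerm (x.rev :: ws) (x :: ws) := by
  simp only [RevPerm, List.map_cons, unorient_rev, List.Perm.refl]

theorem reverse_map_rev (ws : List (Piece α)) : RevPerm (ws.map Piece.rev).reverse ws := by
  induction ws with
  | nil => exact refl []
  | cons x ws ih =>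
    rw [List.map_cons, List.reverse_cons]
    exact (of_perm (List.perm_append_singleton _ _)).trans
      ((append (refl [x.rev]) ih).trans (rev_cons x ws))

theorem flatMap_perm {β : Type*} {f : Piece α → List β} (h : RevPerm us ws)
    (hf : ∀ x : Piece α, (f x.rev).Perm (f x)) : (us.flatMap f).Perm (ws.flatMap f) := by
  let g : Unoriented (Piece.rev (α := α)) → Multiset β :=
    Unoriented.lift (fun x => (f x : Multiset β)) fun x => Multiset.coe_eq_coe.2 (hf x)
  have hsum : ∀ vs : List (Piece α), ((vs.flatMap f : List β) : Multiset β) =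
      ((vs.map (unorient Piece.rev)).map g).sum := fun vs => by
    rw [← Multiset.coe_bind, Multiset.bind, Multiset.map_coe, Multiset.join, Multiset.sum_coe,
      List.map_map]
    rfl
  rw [← Multiset.coe_eq_coe, hsum, hsum, (h.map g).sum_eq]

theorem mem_or_rev_mem (h : RevPerm us ws) {x : Piece α} (hx : x ∈ us) : x ∈ ws ∨ x.rev ∈ ws := by
  obtain ⟨y, hy, hxy⟩ := List.mem_map.1 (h.subset (List.mem_map_of_mem hx))
  rcases (unorient_eq_iff Piece.rev_involutive).1 hxy with rfl | rfl
  · exact Or.inl hy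
  · exact Or.inr hy

end RevPerm

end Pieces

section BoxWords

variable {α : Type*} [LinearOrder α]

namespace Piece

/-- The box-word of a piece: its first and last letters, with a box between them if they differ. -/
def box (x : Piece α) : List (Option α) :=
  if x.first = x.last then [some x.first] else [some x.first, none, some x.last]

/-- The letters of a piece that are visible in its box-word. -/
def ends (x : Piece α) : List α := x.box.reduceOption

/-- `x` may be followed by `y` after an ascent. -/
def AscTo (x y : Piece α) : Prop := x.last < y.first

/-- `x` may be followed by `y` after a descent. -/
def DescTo (x y : Piece α) : Prop := y.first < x.last

theorem box_of_eq {x : Piece α} (h : x.first = x.last) : x.box = [some x.first] := if_pos h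

theorem box_of_ne {x : Piece α} (h : x.first ≠ x.last) :
    x.box = [some x.first, none, some x.last] := if_neg h

theorem box_rev (x : Piece α) : x.rev.box = x.box.reverse := by
  by_cases h : x.first = x.last
  · rw [box_of_eq h, box_of_eq (by simp [h]), first_rev, h, List.reverse_singleton]
  · rw [box_of_ne h, box_of_ne (by simpa using Ne.symm h)]
    simp

theorem odd_length_box (x : Piece α) : Odd x.box.length := by
  unfold box
  split <;> simp [Nat.odd_iff]

theorem mem_ends {x : Piece α} {a : α} : a ∈ x.ends ↔ a = x.first ∨ a = x.last := by
  unfold ends box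
  split <;> simp_all [List.reduceOption]

theorem first_mem_ends (x : Piece α) : x.first ∈ x.ends := mem_ends.2 (Or.inl rfl)

theorem last_mem_ends (x : Piece α) : x.last ∈ x.ends := mem_ends.2 (Or.inr rfl)

theorem ends_rev_perm (x : Piece α) : x.rev.ends.Perm x.ends := by
  rw [ends, box_rev, List.reduceOption, List.filterMap_reverse]
  exact List.reverse_perm _

end Piece

/-- The box-word of a sequence of pieces. -/
def boxes (ws : List (Piece α)) : List (Option α) := ws.flatMap Piece.box

/-- The letters that are visible in the box-word of a sequence of pieces. -/
def visible (ws : List (Piece α)) : List α := ws.flatMap Piece.ends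

@[simp] theorem boxes_nil : boxes ([] : List (Piece α)) = [] := rfl

@[simp] theorem boxes_cons (x : Piece α) (ws : List (Piece α)) :
    boxes (x :: ws) = x.box ++ boxes ws := rfl

@[simp] theorem boxes_append (us ws : List (Piece α)) :
    boxes (us ++ ws) = boxes us ++ boxes ws := List.flatMap_append

theorem boxes_append_cons (us : List (Piece α)) {x : Piece α} (hx : x.first ≠ x.last)
    (ws : List (Piece α)) :
    boxes (us ++ x :: ws) = (boxes us ++ [some x.first, none]) ++ some x.last :: boxes ws := by
  simp [Piece.box_of_ne hx]

theorem boxes_reverse_map_rev (ws : List (Piece α)) :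
    boxes (ws.map Piece.rev).reverse = (boxes ws).reverse := by
  induction ws with
  | nil => rfl
  | cons x ws ih => simp [ih, x.box_rev]

theorem even_length_boxes {ws : List (Piece α)} : Even (boxes ws).length ↔ Even ws.length := by
  induction ws with
  | nil => simp
  | cons x ws ih =>
    simp [Nat.even_add, ih, Nat.not_even_iff_odd.2 x.odd_length_box]

theorem reduceOption_boxes (ws : List (Piece α)) : (boxes ws).reduceOption = visible ws := by
  induction ws with
  | nil => rfl
  | cons x ws ih => rw [boxes_cons, List.reduceOption_append, ih]; rfl

theorem some_mem_boxes {a : α} {ws : List (Piece α)} : some a ∈ boxes ws ↔ a ∈ visible ws := by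
  rw [← reduceOption_boxes, List.reduceOption_mem_iff]

theorem visible_append (us ws : List (Piece α)) :
    visible (us ++ ws) = visible us ++ visible ws := List.flatMap_append

theorem first_mem_visible {x : Piece α} {ws : List (Piece α)} (hx : x ∈ ws) :
    x.first ∈ visible ws := List.mem_flatMap.2 ⟨x, hx, x.first_mem_ends⟩

theorem last_mem_visible {x : Piece α} {ws : List (Piece α)} (hx : x ∈ ws) :
    x.last ∈ visible ws := List.mem_flatMap.2 ⟨x, hx, x.last_mem_ends⟩

theorem RevPerm.visible_perm {us ws : List (Piece α)} (h : RevPerm us ws) :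
    (visible us).Perm (visible ws) :=
  h.flatMap_perm Piece.ends_rev_perm

end BoxWords

section Phi

variable {α : Type*} [LinearOrder α]

/-- The letters of the longest initial segment of pieces without boxes. -/
def lettersBeforeBox : List (Piece α) → List α
  | [] => []
  | x :: ws => if x.first = x.last then x.first :: lettersBeforeBox ws else []

/-- The left neighbour of the first box; it is `⊤` if there is no box, as in the definition
of `φ`. -/
def leftOfBox : List (Piece α) → WithTop α
  | [] => ⊤
  | x :: ws => if x.first = x.last then leftOfBox ws else x.first

theorem lettersBeforeBox_of_eq {x : Piece α} (h : x.first = x.last) (ws : List (Piece α)) :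
    lettersBeforeBox (x :: ws) = x.first :: lettersBeforeBox ws := if_pos h

theorem lettersBeforeBox_of_ne {x : Piece α} (h : x.first ≠ x.last) (ws : List (Piece α)) :
    lettersBeforeBox (x :: ws) = [] := if_neg h

theorem leftOfBox_of_eq {x : Piece α} (h : x.first = x.last) (ws : List (Piece α)) :
    leftOfBox (x :: ws) = leftOfBox ws := if_pos h

theorem leftOfBox_of_ne {x : Piece α} (h : x.first ≠ x.last) (ws : List (Piece α)) :
    leftOfBox (x :: ws) = x.first := if_neg h

theorem last_lt_of_isChain {x : Piece α} {ws : List (Piece α)}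
    (h : (x :: ws).IsChain Piece.AscTo) :
    (x.last : WithTop α) < (lettersBeforeBox ws).minimum ∧ (x.last : WithTop α) < leftOfBox ws := by
  induction ws generalizing x with
  | nil => simp [lettersBeforeBox, leftOfBox]
  | cons y ws ih =>
    rw [List.isChain_cons_cons] at h
    have hxy : (x.last : WithTop α) < y.first := WithTop.coe_lt_coe.2 h.1
    by_cases hy : y.first = y.last
    · obtain ⟨hmin, hleft⟩ := ih h.2
      rw [← hy] at hmin hleft
      rw [lettersBeforeBox_of_eq hy, leftOfBox_of_eq hy, List.minimum_cons]
      exact ⟨lt_min hxy (hxy.trans hmin), hxy.trans hleft⟩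
    · rw [lettersBeforeBox_of_ne hy, leftOfBox_of_ne hy]
      exact ⟨WithTop.coe_lt_top _, hxy⟩

/-- The word `p` consists of the letters `S` if `x = ⊤`, and otherwise it starts with the letters
`S` and `x`, followed by a box. -/
def StartsWith (S : List α) (x : WithTop α) (p : List (Option α)) : Prop :=
  (p = S.map some ∧ x = ⊤) ∨
    ∃ (y : α) (q : List (Option α)), p = S.map some ++ some y :: none :: q ∧ x = y

omit [LinearOrder α] in
theorem StartsWith.cons {S : List α} {x : WithTop α} {p : List (Option α)}
    (h : StartsWith S x p) (a : α) : StartsWith (a :: S) x (some a :: p) := by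
  rcases h with ⟨rfl, hx⟩ | ⟨y, q, rfl, hx⟩
  · exact Or.inl ⟨rfl, hx⟩
  · exact Or.inr ⟨y, q, rfl, hx⟩

theorem startsWith_boxes (ws : List (Piece α)) :
    StartsWith (lettersBeforeBox ws) (leftOfBox ws) (boxes ws) := by
  induction ws with
  | nil => exact Or.inl ⟨rfl, rfl⟩
  | cons x ws ih =>
    by_cases hx : x.first = x.last
    · rw [lettersBeforeBox_of_eq hx, leftOfBox_of_eq hx, boxes_cons, Piece.box_of_eq hx]
      exact ih.cons _
    · rw [lettersBeforeBox_of_ne hx, leftOfBox_of_ne hx, boxes_cons, Piece.box_of_ne hx]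
      exact Or.inr ⟨_, _, rfl, rfl⟩

theorem boxes_eq_before_box (ws : List (Piece α)) {x : Piece α} (hx : x.first ≠ x.last) :
    ∃ (a : α) (q : List (Option α)),
      boxes ws ++ [some x.first, none] =
        (lettersBeforeBox (ws ++ [x])).map some ++ some a :: none :: q ∧
      leftOfBox (ws ++ [x]) = a := by
  induction ws with
  | nil => exact ⟨x.first, [], by simp [lettersBeforeBox_of_ne hx], leftOfBox_of_ne hx _⟩
  | cons y ws ih =>
    by_cases hy : y.first = y.last
    · obtain ⟨a, q, hq, ha⟩ := ih
      refine ⟨a, q, ?_, by rw [List.cons_append, leftOfBox_of_eq hy, ha]⟩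
      rw [boxes_cons, Piece.box_of_eq hy, List.append_assoc, hq, List.cons_append (a := y),
        lettersBeforeBox_of_eq hy]
      rfl
    · refine ⟨y.first, some y.last :: (boxes ws ++ [some x.first, none]), ?_,
        leftOfBox_of_ne hy _⟩
      simp [Piece.box_of_ne hy, lettersBeforeBox_of_ne hy]

omit [LinearOrder α] in
theorem reduceOption_map_some (S : List α) : (S.map some).reduceOption = S := by
  rw [List.reduceOption, List.filterMap_map]
  exact List.filterMap_some

omit [LinearOrder α] in
theorem reduceOption_takeWhile_isSome (S : List α) (a : α) (q : List (Option α)) :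
    ((S.map some ++ some a :: none :: q).takeWhile Option.isSome).reduceOption = S ++ [a] := by
  rw [List.takeWhile_append_of_pos (by simp), List.reduceOption_append, reduceOption_map_some]
  rfl

theorem StartsWith.boxPhi_right {S : List α} {x : WithTop α} {p : List (Option α)}
    (h : StartsWith S x p) :
    (if decide (none ∈ p) then
        (p.takeWhile Option.isSome).reduceOption.getLast?.elim ⊤ fun y => (y : WithTop α)
      else ⊤) = x ∧
    (if decide (none ∈ p) then (p.takeWhile Option.isSome).reduceOption.dropLast
      else (p.takeWhile Option.isSome).reduceOption) = S := by
  rcases h with ⟨rfl, rfl⟩ | ⟨y, q, rfl, rfl⟩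
  · have hsome : (S.map some).takeWhile Option.isSome = S.map some :=
      List.takeWhile_eq_self_iff.2 (by simp)
    simp [hsome, reduceOption_map_some]
  · rw [reduceOption_takeWhile_isSome]
    simp

/-- The definition of `φ`, with `a`, `x`, `d` and the set `T` of the paper (`T = S ∪ R`, and `d` is
the first letter) read off from the word. -/
theorem boxPhi_eq {m a d : α} {pre post q : List (Option α)} {S R : List α} {x : WithTop α}
    (hm : some m ∉ pre) (hpre : pre = S.map some ++ some a :: none :: q)
    (hpost : StartsWith R x post) (hd : (S ++ [a]).head? = some d) :
    boxPhi m (pre ++ some m :: post) =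
      if min S.minimum R.minimum < min (a : WithTop α) x then
        if (d : WithTop α) = min S.minimum R.minimum then pre.tail ++ some m :: some d :: post
        else post.take 1 ++ pre ++ some m :: post.tail
      else if x < a then
        match (generalizing := false) post with
        | z :: none :: y :: rest => y :: none :: z :: pre ++ some m :: rest
        | _ => pre ++ some m :: post
      else
        match (generalizing := false) pre with
        | z :: none :: y :: rest => rest ++ some m :: y :: none :: z :: post
        | _ => pre ++ some m :: post := by
  have htake : (pre ++ some m :: post).takeWhile (fun c => c ≠ some m) = pre := by
    rw [List.takeWhile_append_of_pos fun c hc => by simpa using ne_of_mem_of_not_mem hc hm]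
    simp
  have hdrop : (pre ++ some m :: post).drop (pre.length + 1) = post := by
    rw [← List.drop_drop, List.drop_left, List.drop_one, List.tail_cons]
  have hleft : (pre.takeWhile Option.isSome).reduceOption = S ++ [a] := by
    rw [hpre, reduceOption_takeWhile_isSome]
  obtain ⟨hx, hR⟩ := hpost.boxPhi_right
  unfold boxPhi
  rw [htake]
  simp only [hdrop]
  split
  · simp at hpre
  · simp only [hleft, hx, hR, hd]
    simp only [List.getLast?_append, List.getLast?_singleton, Option.some_or, Option.elim_some,
      List.dropLast_concat, List.minimum_append]

theorem boxPhi_boxes_swap {w : Piece α} (hw : w.first ≠ w.last) (B : List (Piece α)) :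
    boxPhi w.last (boxes (w.rev :: B)) = boxes (w :: B) := by
  simp [boxPhi, Piece.box_rev, Piece.box_of_ne hw]

/-- The first piece is moved behind the piece that ends in the smallest letter. -/
theorem boxPhi_boxes_front {y w : Piece α} {A B : List (Piece α)} (hw : w.first ≠ w.last)
    (hm : some w.last ∉ boxes (y :: A) ++ [some w.first, none])
    (hA : (y :: (A ++ [w])).IsChain Piece.AscTo) (hB : (y.rev :: B).IsChain Piece.AscTo) :
    boxPhi w.last (boxes (y :: A ++ w :: B)) = boxes (A ++ w :: y.rev :: B) := by
  obtain ⟨a, q, hpre, ha⟩ := boxes_eq_before_box (y :: A) hw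
  obtain ⟨d, hd⟩ : ∃ d, (lettersBeforeBox (y :: (A ++ [w])) ++ [a]).head? = some d :=
    Option.isSome_iff_exists.1 (by simp)
  obtain ⟨hminA, hleftA⟩ := last_lt_of_isChain hA
  obtain ⟨hminB, hleftB⟩ := last_lt_of_isChain hB
  rw [Piece.last_rev] at hminB hleftB
  rw [boxes_append_cons _ hw, boxes_append_cons _ hw,
    boxPhi_eq hm hpre (startsWith_boxes B) hd, ← ha, List.cons_append]
  by_cases hy : y.first = y.last
  · rw [← hy] at hminA hleftA
    rw [lettersBeforeBox_of_eq hy, List.cons_append, List.head?_cons, Option.some_inj] at hd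
    rw [lettersBeforeBox_of_eq hy, leftOfBox_of_eq hy, List.minimum_cons, min_eq_left hminA.le,
      min_eq_left hminB.le, if_pos (lt_min hleftA hleftB), if_pos (congrArg _ hd.symm), ← hd]
    simp [Piece.box_rev, Piece.box_of_eq hy]
  · rw [lettersBeforeBox_of_ne hy, leftOfBox_of_ne hy, List.minimum_nil, min_eq_right le_top,
      min_eq_left hleftB.le, if_neg hminB.not_gt, if_neg hleftB.not_gt]
    simp [Piece.box_rev, Piece.box_of_ne hy]

/-- The piece behind the one that ends in the smallest letter is moved to the front. -/
theorem boxPhi_boxes_back {w y : Piece α} {A B : List (Piece α)} (hw : w.first ≠ w.last)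
    (hm : some w.last ∉ boxes A ++ [some w.first, none])
    (hB : (y :: B).IsChain Piece.AscTo) (hA : (y.rev :: (A ++ [w])).IsChain Piece.AscTo) :
    boxPhi w.last (boxes (A ++ w :: y :: B)) = boxes (y.rev :: A ++ w :: B) := by
  obtain ⟨a, q, hpre, ha⟩ := boxes_eq_before_box A hw
  obtain ⟨d, hd⟩ : ∃ d, (lettersBeforeBox (A ++ [w]) ++ [a]).head? = some d :=
    Option.isSome_iff_exists.1 (by simp)
  obtain ⟨hminA, hleftA⟩ := last_lt_of_isChain hA
  obtain ⟨hminB, hleftB⟩ := last_lt_of_isChain hB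
  rw [Piece.last_rev] at hminA hleftA
  rw [boxes_append_cons _ hw, boxes_append_cons _ hw,
    boxPhi_eq hm hpre (startsWith_boxes (y :: B)) hd, ← ha]
  by_cases hy : y.first = y.last
  · rw [← hy] at hminB hleftB
    have hfirst : (y.first : WithTop α) < d := by
      rcases List.mem_append.1 (List.mem_of_head? hd) with h | h
      · exact hminA.trans_le (List.minimum_le_of_mem' h)
      · rwa [List.mem_singleton.1 h, ← ha]
    rw [lettersBeforeBox_of_eq hy, leftOfBox_of_eq hy, List.minimum_cons, min_eq_left hminB.le,
      min_eq_right hminA.le, if_pos (lt_min hleftA hleftB), if_neg hfirst.ne']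
    simp [Piece.box_rev, Piece.box_of_eq hy]
  · rw [lettersBeforeBox_of_ne hy, leftOfBox_of_ne hy, List.minimum_nil, min_eq_left le_top,
      min_eq_right hleftA.le, if_neg hminA.not_gt, if_pos hleftA]
    simp [Piece.box_rev, Piece.box_of_ne hy]

end Phi

section PsiOnPieces

variable {α : Type*} [LinearOrder α]

theorem boxPsiAux_nil (k : ℕ) : boxPsiAux k ([] : List (Option α)) = [] := by
  cases k <;> simp [boxPsiAux]

theorem boxPsiAux_fixed {m : α} {σ : List (Option α)}
    (hmin : (some m :: σ).reduceOption.min? = some m) (hσ : σ.head? ≠ some none) (k : ℕ) :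
    boxPsiAux (k + 1) (some m :: σ) = [some m] :: boxPsiAux k σ := by
  rw [boxPsiAux, hmin]
  exact if_pos ⟨List.idxOf_cons_self, by rwa [List.getElem?_cons_succ, ← List.head?_eq_getElem?]⟩

theorem idxOf_append_cons {β : Type*} [BEq β] [LawfulBEq β] {c : β} {pre : List β} (h : c ∉ pre)
    (post : List β) : (pre ++ c :: post).idxOf c = pre.length := by
  rw [List.idxOf_append_of_notMem h, List.idxOf_cons_self, add_zero]

theorem boxPsiAux_even {m : α} {pre post : List (Option α)}
    (hmin : (pre ++ some m :: post).reduceOption.min? = some m) (hm : some m ∉ pre)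
    (hpre : pre ≠ []) (heven : Even pre.length) (k : ℕ) :
    boxPsiAux (k + 1) (pre ++ some m :: post) = (some m :: pre) :: boxPsiAux k post := by
  have hlen : pre.length ≠ 0 := by simpa using hpre
  rw [boxPsiAux, hmin]
  simp only [idxOf_append_cons hm]
  rw [if_neg fun h => hlen h.1, if_pos ⟨hlen, heven⟩]
  simp

/-- The third case of the definition of `ψ`: the smallest letter `m` comes first and is followed by
a box, or it is in an even position. -/
def NeedsPhi (m : α) (σ : List (Option α)) : Prop :=
  (σ.idxOf (some m) = 0 ∧ σ[1]? = some none) ∨ Odd (σ.idxOf (some m))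

theorem boxPsiAux_phi {m : α} {σ pre post : List (Option α)}
    (hmin : σ.reduceOption.min? = some m) (hσ : NeedsPhi m σ)
    (hφ : boxPhi m σ = pre ++ some m :: post) (hm : some m ∉ pre) (k : ℕ) :
    boxPsiAux (k + 1) σ = (some m :: pre.reverse) :: boxPsiAux k post := by
  have hfixed : ¬(σ.idxOf (some m) = 0 ∧ σ[1]? ≠ some none) := by
    rintro ⟨h0, h1⟩
    rcases hσ with h | h
    · exact h1 h.2
    · simp [h0] at h
  have heven : ¬(σ.idxOf (some m) ≠ 0 ∧ Even (σ.idxOf (some m))) := by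
    rintro ⟨h0, h1⟩
    rcases hσ with h | h
    · exact h0 h.1
    · exact Nat.not_even_iff_odd.2 h h1
  rw [boxPsiAux, hmin]
  simp only [hφ, idxOf_append_cons hm]
  rw [if_neg hfixed, if_neg heven]
  simp

theorem min?_reduceOption_boxes {m : α} {us vs : List (Piece α)} (h : RevPerm us vs)
    (hmem : m ∈ visible vs) (hmin : ∀ a ∈ visible vs, m ≤ a) :
    (boxes us).reduceOption.min? = some m := by
  rw [reduceOption_boxes, List.min?_eq_some_iff]
  exact ⟨h.visible_perm.symm.subset hmem, fun b hb => hmin b (h.visible_perm.subset hb)⟩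

theorem some_last_notMem {w : Piece α} (hw : w.last < w.first) {A : List (Piece α)}
    (hA : ∀ a ∈ visible A, w.last < a) : some w.last ∉ boxes A ++ [some w.first, none] := by
  intro h
  rcases List.mem_append.1 h with h | h
  · exact (hA _ (some_mem_boxes.1 h)).false
  · simp [hw.ne] at h

theorem idxOf_boxes {w : Piece α} (hw : w.last < w.first) {A : List (Piece α)}
    (hA : ∀ a ∈ visible A, w.last < a) (B : List (Piece α)) :
    (boxes (A ++ w :: B)).idxOf (some w.last) = (boxes A).length + 2 := by
  rw [boxes_append_cons _ hw.ne', idxOf_append_cons (some_last_notMem hw hA), List.length_append]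
  rfl

/-- The box-word of `ws` is an argument to which `ψ` applies `φ`, with the box-word of `vs` as the
result. -/
structure PhiStep (m : α) (ws vs : List (Piece α)) : Prop where
  isChain : ws.IsChain Piece.AscTo
  revPerm : RevPerm ws vs
  needsPhi : NeedsPhi m (boxes ws)
  boxPhi_eq : boxPhi m (boxes ws) = boxes vs

theorem PhiStep.swap {w : Piece α} {B : List (Piece α)} (hw : w.last < w.first)
    (hchain : (w.rev :: B).IsChain Piece.AscTo) : PhiStep w.last (w.rev :: B) (w :: B) where
  isChain := hchain
  revPerm := RevPerm.rev_cons w B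
  needsPhi := Or.inl (by simp [Piece.box_rev, Piece.box_of_ne hw.ne'])
  boxPhi_eq := boxPhi_boxes_swap hw.ne' B

theorem needsPhi_boxes {w : Piece α} (hw : w.last < w.first) {A : List (Piece α)}
    (hA : ∀ a ∈ visible A, w.last < a) (hodd : Odd A.length) (B : List (Piece α)) :
    NeedsPhi w.last (boxes (A ++ w :: B)) := by
  rw [← Nat.not_even_iff_odd, ← even_length_boxes, Nat.not_even_iff_odd] at hodd
  exact Or.inr (by rw [idxOf_boxes hw hA]; exact hodd.add_even even_two)

theorem PhiStep.back {z w : Piece α} {A B : List (Piece α)} (hw : w.last < w.first)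
    (hzA : ∀ a ∈ visible (z :: A), w.last < a) (hodd : Odd A.length)
    (hA : (z :: (A ++ [w])).IsChain Piece.AscTo) (hB : (z.rev :: B).IsChain Piece.AscTo) :
    PhiStep w.last (A ++ w :: z.rev :: B) (z :: A ++ w :: B) where
  isChain := by
    rw [List.isChain_split, List.isChain_cons_cons]
    refine ⟨hA.tail, ?_, hB⟩
    rw [Piece.AscTo, Piece.first_rev]
    exact hzA _ (last_mem_visible List.mem_cons_self)
  revPerm := by
    refine .trans (.of_perm ?_) (.rev_cons z (A ++ w :: B))
    simpa using List.perm_middle (a := z.rev) (l₁ := A ++ [w]) (l₂ := B)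
  needsPhi := needsPhi_boxes hw (fun a ha => hzA a (List.mem_append_right _ ha)) hodd _
  boxPhi_eq := by
    have hA' : ∀ a ∈ visible A, w.last < a := fun a ha => hzA a (List.mem_append_right _ ha)
    have h := boxPhi_boxes_back hw.ne' (some_last_notMem hw hA') hB
    rw [z.rev_involutive] at h
    exact h hA

theorem PhiStep.front {y w : Piece α} {A B : List (Piece α)} (hw : w.last < w.first)
    (hyA : ∀ a ∈ visible (y :: A), w.last < a) (hyB : ∀ a ∈ visible B, w.last < a)
    (heven : Even A.length) (hA : (y.rev :: (A ++ [w])).IsChain Piece.AscTo)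
    (hB : (y :: B).IsChain Piece.AscTo) :
    PhiStep w.last (y.rev :: A ++ w :: B) (A ++ w :: y :: B) where
  isChain := by
    rw [List.isChain_split, List.isChain_cons (x := w)]
    refine ⟨hA, fun z hz => ?_, hB.tail⟩
    exact hyB _ (first_mem_visible (List.mem_of_head? hz))
  revPerm := by
    refine (RevPerm.rev_cons y (A ++ w :: B)).trans (.of_perm ?_)
    simpa using (List.perm_middle (a := y) (l₁ := A ++ [w]) (l₂ := B)).symm
  needsPhi := needsPhi_boxes hw
    (fun a ha => hyA a ((RevPerm.rev_cons y A).visible_perm.subset ha))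
    (by simpa [Nat.odd_add_one] using heven) _
  boxPhi_eq := by
    have hyA' : ∀ a ∈ visible (y.rev :: A), w.last < a := fun a ha =>
      hyA a ((RevPerm.rev_cons y A).visible_perm.subset ha)
    have hB' : (y.rev.rev :: B).IsChain Piece.AscTo := by rwa [y.rev_involutive]
    have h := boxPhi_boxes_front hw.ne' (some_last_notMem hw hyA') hA hB'
    rwa [y.rev_involutive] at h

/-- Whether `φ` has moved a piece to the front or to the back can be read off from its result. -/
theorem exists_phiStep {w : Piece α} {A B : List (Piece α)} (hw : w.last < w.first)
    (hchain : (A ++ w :: B).IsChain Piece.AscTo) (heven : Even A.length)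
    (hA : ∀ a ∈ visible A, w.last < a) (hB : ∀ a ∈ visible B, w.last < a)
    (hne : ∀ y ∈ A ++ [w], ∀ z ∈ B, y.first ≠ z.first) :
    ∃ ws, PhiStep w.last ws (A ++ w :: B) := by
  obtain ⟨hcA, hcB⟩ := List.isChain_split.1 hchain
  by_cases hfront : ∃ y B', B = y :: B' ∧ ∀ z ∈ (A ++ [w]).head?, y.first < z.first
  · obtain ⟨y, B', rfl, hlt⟩ := hfront
    refine ⟨_, PhiStep.front hw (fun a ha => ?_) (fun a ha => hB a (List.mem_append_right _ ha))
      heven (List.isChain_cons.2 ⟨fun z hz => ?_, hcA⟩) hcB.tail⟩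
    · rcases List.mem_append.1 ha with h | h
      · exact hB a (List.mem_append_left _ h)
      · exact hA a h
    · rw [Piece.AscTo, Piece.last_rev]
      exact hlt z hz
  · have hlt : ∀ z ∈ (A ++ [w]).head?, (z.rev :: B).IsChain Piece.AscTo := by
      refine fun z hz => List.isChain_cons.2 ⟨fun y hy => ?_, hcB.tail⟩
      rw [Piece.AscTo, Piece.last_rev]
      refine (lt_or_gt_of_ne (hne z (List.mem_of_head? hz) y (List.mem_of_head? hy))).resolve_right
        fun hlt => hfront ⟨y, B.tail, List.eq_cons_of_mem_head? hy, fun z' hz' => ?_⟩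
      rwa [Option.mem_unique hz' hz]
    cases A with
    | nil => exact ⟨_, PhiStep.swap hw (hlt w rfl)⟩
    | cons z A =>
      exact ⟨_, PhiStep.back hw hA (by simpa [Nat.even_add_one] using heven) hcA (hlt z rfl)⟩

/-- The cyclic sequences of pieces whose box-words are the cycles that `ψ` produces: the three cases
correspond to those of the definition of `ψ`, in the order 2, 3, 1. -/
def IsMonotoneCycle (g : List (Piece α)) : Prop :=
  Odd g.length ∧ (Cycle.Chain Piece.AscTo (g : Cycle (Piece α)) ∨
    Cycle.Chain Piece.DescTo (g : Cycle (Piece α)) ∨ ∃ x, g = [x] ∧ x.first = x.last)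

theorem exists_isRotated_concat_of_chain {g : List (Piece α)} {m : α}
    (hg : Cycle.Chain Piece.AscTo (g : Cycle (Piece α))) (hm : m ∈ visible g)
    (hmin : ∀ a ∈ visible g, m ≤ a) :
    ∃ A w, g ~r A ++ [w] ∧ (A ++ [w]).IsChain Piece.AscTo ∧ w.last = m ∧ m < w.first := by
  obtain ⟨w, hwg, hmw⟩ := List.mem_flatMap.1 hm
  obtain ⟨u, v, rfl⟩ := List.append_of_mem hwg
  have hrot : u ++ w :: v ~r w :: (v ++ u) := List.isRotated_append
  rw [Cycle.coe_eq_coe.2 hrot, Cycle.chain_coe_cons] at hg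
  have hrot' : u ++ w :: v ~r (v ++ u) ++ [w] := 
    hrot.trans (List.isRotated_append (l := [w]))
  obtain ⟨z, hz, hzw⟩ : ∃ z ∈ w :: (v ++ u), z.AscTo w := by
    obtain ⟨A, z, hA⟩ := (w :: (v ++ u)).eq_nil_or_concat.resolve_left (List.cons_ne_nil _ _)
    rw [← List.cons_append, hA] at hg
    refine ⟨z, by simp [hA], ?_⟩
    have hchain : (A ++ z :: [w]).IsChain Piece.AscTo := by simpa using hg
    simpa using (List.isChain_split.1 hchain).2
  have hfirst : m < w.first :=
    (hmin _ (last_mem_visible (hrot.perm.symm.subset hz))).trans_lt hzw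
  exact ⟨v ++ u, w, hrot', hg.tail, ((Piece.mem_ends.1 hmw).resolve_left hfirst.ne).symm, hfirst⟩

omit [LinearOrder α] in
theorem chain_reverse_map {β : Type*} {r : α → α → Prop} {s : β → β → Prop} {f : α → β}
    (hf : ∀ x y, r x y → s (f y) (f x)) {l : List α} (hl : Cycle.Chain r (l : Cycle α)) :
    Cycle.Chain s ((l.map f).reverse : Cycle β) := by
  cases l with
  | nil => exact hl
  | cons x l =>
    rw [Cycle.chain_coe_cons] at hl
    have hrot : ((x :: l).map f).reverse ~r f x :: (l.map f).reverse := by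
      rw [List.map_cons, List.reverse_cons]
      exact List.isRotated_append
    rw [Cycle.coe_eq_coe.2 hrot, Cycle.chain_coe_cons]
    have h : ((x :: (l ++ [x])).map f).reverse.IsChain s := by
      rw [List.isChain_reverse, List.isChain_map]
      exact hl.imp hf
    simpa using h

theorem Piece.DescTo.ascTo_rev (x y : Piece α) (h : x.DescTo y) : y.rev.AscTo x.rev := by
  rw [Piece.AscTo, Piece.last_rev, Piece.first_rev]
  exact h

theorem Piece.AscTo.descTo_rev (x y : Piece α) (h : x.AscTo y) : y.rev.DescTo x.rev := by
  rw [Piece.DescTo, Piece.last_rev, Piece.first_rev]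
  exact h

/-- `ψ` splits off the cycle `g` and continues with the box-word of `ws`, if it is applied to a
suitable sequence that consists of the pieces of `g` and `ws`. -/
def SplitsOff (g ws : List (Piece α)) : Prop :=
  ∃ (us : List (Piece α)) (c : List (Option α)), us.IsChain Piece.AscTo ∧ RevPerm us (g ++ ws) ∧
    c ~r boxes g ∧ ∀ k, boxPsiAux (k + 1) (boxes us) = c :: boxPsiAux k (boxes ws)

theorem splitsOff_singleton {x : Piece α} {ws : List (Piece α)} (hx : x.first = x.last)
    (hws : ws.IsChain Piece.AscTo) (hmin : ∀ a ∈ visible ws, x.first < a) :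
    SplitsOff [x] ws := by
  have hbox : boxes (x :: ws) = some x.first :: boxes ws := by simp [Piece.box_of_eq hx]
  have hhead : (boxes ws).head? ≠ some none := by
    cases ws with
    | nil => simp
    | cons y ws =>
      rw [boxes_cons]
      unfold Piece.box
      split <;> simp
  refine ⟨x :: ws, [some x.first], List.isChain_cons.2 ⟨fun y hy => ?_, hws⟩, .refl _, ?_,
    fun k => ?_⟩
  · rw [Piece.AscTo, ← hx]
    exact hmin _ (first_mem_visible (List.mem_of_head? hy))
  · simp [Piece.box_of_eq hx, List.IsRotated.refl]
  · have hmin? : (boxes (x :: ws)).reduceOption.min? = some x.first := by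
      refine min?_reduceOption_boxes (.refl _) (first_mem_visible List.mem_cons_self) fun a ha => ?_
      rcases List.mem_append.1 ha with h | h
      · rcases Piece.mem_ends.1 h with rfl | rfl
        · exact le_rfl
        · exact hx.le
      · exact (hmin a h).le
    rw [hbox] at hmin? ⊢
    exact boxPsiAux_fixed hmin? hhead k

section Ascending

variable {A ws : List (Piece α)} {w : Piece α} (hAw : (A ++ [w]).IsChain Piece.AscTo)
  (heven : Even A.length) (hw : w.last < w.first) (hws : ws.IsChain Piece.AscTo)
  (hA : ∀ a ∈ visible A, w.last < a) (hmin : ∀ a ∈ visible ws, w.last < a)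

include hAw hws hmin in
theorem isChain_append_cons_of_lt : (A ++ w :: ws).IsChain Piece.AscTo :=
  List.isChain_split.2 ⟨hAw, List.isChain_cons.2
    ⟨fun _ hy => hmin _ (first_mem_visible (List.mem_of_head? hy)), hws⟩⟩

include hw hA hmin in
theorem min?_boxes_append_cons {us : List (Piece α)} (h : RevPerm us (A ++ w :: ws)) :
    (boxes us).reduceOption.min? = some w.last := by
  refine min?_reduceOption_boxes h (last_mem_visible (by simp)) fun a ha => ?_
  rw [visible_append, List.mem_append] at ha
  rcases ha with ha | ha
  · exact (hA a ha).le
  · rcases List.mem_append.1 ha with ha | ha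
    · rcases Piece.mem_ends.1 ha with rfl | rfl
      · exact hw.le
      · exact le_rfl
    · exact (hmin a ha).le

include hAw heven hw hws hA hmin in
theorem splitsOff_of_asc {g : List (Piece α)} (hg : g ~r A ++ [w]) : SplitsOff g ws := by
  have hperm : RevPerm (A ++ w :: ws) (g ++ ws) := by
    rw [List.append_cons]
    exact .of_perm (hg.perm.symm.append_right ws)
  have hbox := boxes_append_cons A hw.ne' ws
  refine ⟨A ++ w :: ws, some w.last :: (boxes A ++ [some w.first, none]),
    isChain_append_cons_of_lt hAw hws hmin, hperm, ?_, fun k => ?_⟩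
  · refine .trans ?_ (isRotated_flatMap hg _).symm
    change _ ~r boxes (A ++ [w])
    rw [boxes_append_cons A hw.ne' []]
    exact List.isRotated_append (l := [some w.last])
  · have hmin? := min?_boxes_append_cons hw hA hmin (.refl _)
    rw [hbox] at hmin? ⊢
    refine boxPsiAux_even hmin? (some_last_notMem hw hA) (by simp) ?_ k
    rw [List.length_append]
    exact (even_length_boxes.2 heven).add even_two

include hAw heven hw hws hA hmin in
theorem splitsOff_of_desc {g : List (Piece α)} (hg : (g.map Piece.rev).reverse ~r A ++ [w])
    (hne : ∀ y ∈ A ++ [w], ∀ z ∈ ws, y.first ≠ z.first) : SplitsOff g ws := by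
  have hperm : RevPerm (A ++ w :: ws) (g ++ ws) := by
    rw [List.append_cons]
    exact .append (.trans (.of_perm hg.perm.symm) (.reverse_map_rev g)) (.refl ws)
  obtain ⟨us, hus⟩ :=
    exists_phiStep hw (isChain_append_cons_of_lt hAw hws hmin) heven hA hmin hne
  refine ⟨us, some w.last :: (boxes A ++ [some w.first, none]).reverse, hus.isChain,
    hus.revPerm.trans hperm, ?_, fun k => ?_⟩
  · have hrot := (isRotated_flatMap hg Piece.box).reverse
    change (boxes (g.map Piece.rev).reverse).reverse ~r (boxes (A ++ [w])).reverse at hrot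
    rw [boxes_reverse_map_rev, List.reverse_reverse, boxes_append_cons A hw.ne' [],
      List.reverse_append] at hrot
    exact hrot.symm
  · exact boxPsiAux_phi (min?_boxes_append_cons hw hA hmin hus.revPerm) hus.needsPhi
      (hus.boxPhi_eq.trans (boxes_append_cons A hw.ne' ws)) (some_last_notMem hw hA) k

end Ascending

theorem visible_lt_of_concat {g A : List (Piece α)} {w : Piece α} (hperm : RevPerm g (A ++ [w]))
    (hg : (visible g).Nodup) (hmin : ∀ a ∈ visible g, w.last ≤ a) :
    ∀ a ∈ visible A, w.last < a := by
  intro a ha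
  have hsub := hperm.visible_perm
  rw [visible_append] at hsub
  refine lt_of_le_of_ne (hmin a (hsub.symm.subset (List.mem_append_left _ ha))) ?_
  rintro rfl
  exact (List.nodup_append.1 (hsub.nodup_iff.1 hg)).2.2 _ ha _
    (last_mem_visible (List.mem_singleton_self w)) rfl

theorem IsMonotoneCycle.splitsOff {g ws : List (Piece α)} {m : α} (hg : IsMonotoneCycle g)
    (hws : ws.IsChain Piece.AscTo) (hnodup : (visible (g ++ ws)).Nodup) (hm : m ∈ visible g)
    (hmin : ∀ a ∈ visible (g ++ ws), m ≤ a) : SplitsOff g ws := by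
  rw [visible_append] at hnodup hmin
  obtain ⟨hng, -, hdisj⟩ := List.nodup_append.1 hnodup
  have hming : ∀ a ∈ visible g, m ≤ a := fun a ha => hmin a (List.mem_append_left _ ha)
  have hminw : ∀ a ∈ visible ws, m < a := fun a ha =>
    lt_of_le_of_ne (hmin a (List.mem_append_right _ ha)) (hdisj m hm a ha)
  obtain ⟨hodd, hasc | hdesc | ⟨x, rfl, hx⟩⟩ := hg
  · obtain ⟨A, w, hrot, hchain, rfl, hlt⟩ := exists_isRotated_concat_of_chain hasc hm hming
    refine splitsOff_of_asc hchain ?_ hlt hws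
      (visible_lt_of_concat (.of_perm hrot.perm) hng hming) hminw hrot
    simpa [hrot.perm.length_eq, Nat.odd_add_one] using hodd
  · have hrev := RevPerm.reverse_map_rev g
    have hmem : ∀ a, a ∈ visible (g.map Piece.rev).reverse ↔ a ∈ visible g := fun a =>
      hrev.visible_perm.mem_iff
    obtain ⟨A, w, hrot, hchain, rfl, hlt⟩ := exists_isRotated_concat_of_chain
      (chain_reverse_map Piece.DescTo.ascTo_rev hdesc) ((hmem m).2 hm)
      fun a ha => hming a ((hmem a).1 ha)
    have hlen := hrot.perm.length_eq
    refine splitsOff_of_desc hchain ?_ hlt hws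
      (visible_lt_of_concat (.of_perm hrot.perm) (hrev.visible_perm.nodup_iff.2 hng)
        fun a ha => hming a ((hmem a).1 ha)) hminw hrot fun y hy z hz => ?_
    · simp only [List.length_reverse, List.length_map, List.length_append,
        List.length_singleton] at hlen
      simpa [hlen, Nat.odd_add_one] using hodd
    · exact hdisj _ ((hmem _).1 (first_mem_visible (hrot.perm.symm.subset hy))) _
        (first_mem_visible hz)
  · obtain rfl : m = x.first := by
      rcases Piece.mem_ends.1 (by simpa [visible] using hm) with h | h
      exacts [h, h.trans hx.symm]
    exact splitsOff_singleton hx hws hminw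

/-- The recursive definition of `ψ` can be run backwards: the cycle that contains the smallest
letter is adjoined last. -/
theorem exists_boxPsiAux_eq (G : List (List (Piece α))) (hG : ∀ g ∈ G, IsMonotoneCycle g)
    (hnodup : (visible G.flatten).Nodup) :
    ∃ (ws : List (Piece α)) (cs : List (List (Option α))) (G' : List (List (Piece α))),
      ws.IsChain Piece.AscTo ∧ RevPerm ws G.flatten ∧ G'.Perm G ∧
      List.Forall₂ (fun c g => c ~r boxes g) cs G' ∧
      ∀ k, G.length ≤ k → boxPsiAux k (boxes ws) = cs := by
  induction hN : G.length generalizing G with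
  | zero =>
    obtain rfl := List.length_eq_zero_iff.1 hN
    exact ⟨[], [], [], .nil, .refl _, .refl _, .nil, fun k _ => boxPsiAux_nil k⟩
  | succ N ih =>
    have hne : visible G.flatten ≠ [] := by
      obtain ⟨g, hg⟩ := List.exists_mem_of_length_pos (l := G) (by omega)
      obtain ⟨x, hx⟩ := List.exists_mem_of_length_pos (hG g hg).1.pos
      exact List.ne_nil_of_mem (first_mem_visible (List.mem_flatten_of_mem hg hx))
    obtain ⟨m, hm⟩ := Option.isSome_iff_exists.1 (List.isSome_min?_of_ne_nil hne)
    obtain ⟨hmem, hmin⟩ := List.min?_eq_some_iff.1 hm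
    obtain ⟨x, hxG, hmx⟩ := List.mem_flatMap.1 hmem
    obtain ⟨g, hgG, hxg⟩ := List.mem_flatten.1 hxG
    obtain ⟨G₁, G₂, rfl⟩ := List.append_of_mem hgG
    have hperm : (g :: (G₁ ++ G₂)).Perm (G₁ ++ g :: G₂) := List.perm_middle.symm
    have hnodup' := ((RevPerm.of_perm hperm.flatten).visible_perm.nodup_iff).2 hnodup
    rw [List.flatten_cons, visible_append] at hnodup'
    obtain ⟨ws, cs, G', hchain, hws, hG', hcs, hψ⟩ := ih (G₁ ++ G₂)
      (fun g' hg' => hG g' (hperm.subset (List.mem_cons_of_mem _ hg')))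
      (List.nodup_append.1 hnodup').2.1 (by simpa [← add_assoc] using hN)
    have hall : RevPerm (g ++ ws) (G₁ ++ g :: G₂).flatten :=
      (RevPerm.append (.refl g) hws).trans (.of_perm hperm.flatten)
    obtain ⟨us, c, hus, husp, hc, hstep⟩ := (hG g hgG).splitsOff hchain
      (hall.visible_perm.nodup_iff.2 hnodup) (List.mem_flatMap.2 ⟨x, hxg, hmx⟩)
      fun a ha => hmin a (hall.visible_perm.subset ha)
    refine ⟨us, c :: cs, g :: G', hus, husp.trans hall, (hG'.cons g).trans hperm, .cons hc hcs,
      fun k hk => ?_⟩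
    obtain ⟨k, rfl⟩ := Nat.exists_eq_add_of_le' ((Nat.le_add_left 1 N).trans hk)
    rw [hstep, hψ k (by omega)]

end PsiOnPieces

section Rises

variable {X : Type*} (r : X → X → ℤ)

/-- The height of the last element of a word, if the first one has height `0` and `r x y` is the
height difference of two successive elements `x`, `y`. -/
def totalRise (w : List X) : ℤ := (List.zipWith r w w.tail).sum

/-- All elements of the word have nonnegative height. -/
def Ballot (w : List X) : Prop := ∀ u, u <+: w → 0 ≤ totalRise r u

@[simp] theorem totalRise_nil : totalRise r [] = 0 := rfl

@[simp] theorem totalRise_singleton (x : X) : totalRise r [x] = 0 := rfl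

theorem totalRise_cons_cons (x y : X) (w : List X) :
    totalRise r (x :: y :: w) = r x y + totalRise r (y :: w) := by
  simp [totalRise]

theorem totalRise_append {u v : List X} (hu : u ≠ []) (hv : v ≠ []) :
    totalRise r (u ++ v) = totalRise r u + r (u.getLast hu) (v.head hv) + totalRise r v := by
  induction u with
  | nil => exact absurd rfl hu
  | cons x u ih =>
    cases u with
    | nil =>
      obtain ⟨y, v, rfl⟩ := List.exists_cons_of_ne_nil hv
      simp [totalRise_cons_cons]
    | cons y u =>
      have ih := ih (List.cons_ne_nil y u)
      rw [List.cons_append] at ih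
      rw [List.cons_append, List.cons_append, totalRise_cons_cons, totalRise_cons_cons, ih,
        List.getLast_cons (List.cons_ne_nil y u)]
      ring

theorem totalRise_cons (x : X) {v : List X} (hv : v ≠ []) :
    totalRise r (x :: v) = r x (v.head hv) + totalRise r v := by
  simpa using totalRise_append r (List.cons_ne_nil x []) hv

theorem totalRise_append_cons (u : List X) (x : X) (v : List X) :
    totalRise r (u ++ x :: v) = totalRise r (u ++ [x]) + totalRise r (x :: v) := by
  by_cases hu : u = []
  · simp [hu]
  · rw [totalRise_append r hu (List.cons_ne_nil x v), totalRise_append r hu (List.cons_ne_nil x [])]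
    simp

variable {r} in
theorem totalRise_reverse_map {f : X → X} {w : List X}
    (h : w.IsChain fun x y => r (f y) (f x) = -r x y) :
    totalRise r (w.map f).reverse = -totalRise r w := by
  induction w with
  | nil => rfl
  | cons x w ih =>
    cases w with
    | nil => rfl
    | cons y w =>
      rw [List.isChain_cons_cons] at h
      rw [List.map_cons, List.reverse_cons, totalRise_append r (by simp) (by simp), ih h.2,
        totalRise_cons_cons]
      simp [h.1]

variable {r} in
theorem Ballot.of_prefix {u w : List X} (h : Ballot r w) (hu : u <+: w) : Ballot r u :=
  fun p hp => h p (hp.trans hu)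

theorem prefix_append_cases {p u v : List X} (h : p <+: u ++ v) :
    p <+: u ∨ ∃ q, q ≠ [] ∧ q <+: v ∧ p = u ++ q := by
  obtain ⟨t, ht⟩ := h
  rcases List.append_eq_append_iff.1 ht with ⟨a, hu, -⟩ | ⟨q, hp, hv⟩
  · exact Or.inl ⟨a, hu.symm⟩
  · by_cases hq : q = []
    · exact Or.inl (by simp [hp, hq])
    · exact Or.inr ⟨q, hq, ⟨t, hv.symm⟩, hp⟩

variable {r} in
theorem Ballot.append {u v : List X} (hu : Ballot r u) (hv : Ballot r v)
    (h : ∀ (hu : u ≠ []) (hv : v ≠ []), 0 ≤ totalRise r u + r (u.getLast hu) (v.head hv)) :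
    Ballot r (u ++ v) := by
  intro p hp
  by_cases hu0 : u = []
  · exact hv p (by simpa [hu0] using hp)
  rcases prefix_append_cases hp with hp | ⟨q, hq0, hq, rfl⟩
  · exact hu p hp
  · rw [totalRise_append r hu0 hq0, hq.head hq0]
    exact add_nonneg (h hu0 _) (hv q hq)

theorem ballot_singleton (x : X) : Ballot r [x] := by
  intro p hp
  rcases List.prefix_cons_iff.1 hp with rfl | ⟨q, rfl, hq⟩
  · rfl
  · rw [List.prefix_nil.1 hq]
    rfl

/-- Split the sequence where the partial sum is minimal for the last time. -/
theorem exists_split_prefix_sum_pos (s : List ℤ) :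
    ∃ u v, s = u ++ v ∧ (∀ p, p <+: v → p ≠ [] → 0 < p.sum) ∧ ∀ p, p <+: u → u.sum ≤ p.sum := by
  induction s with
  | nil => exact ⟨[], [], rfl, fun p hp h => absurd (List.prefix_nil.1 hp) h, fun p hp => by
      rw [List.prefix_nil.1 hp]⟩
  | cons a s ih =>
    obtain ⟨u, v, rfl, hv, hu⟩ := ih
    by_cases h : a + u.sum ≤ 0
    · refine ⟨a :: u, v, rfl, hv, fun p hp => ?_⟩
      rcases List.prefix_cons_iff.1 hp with rfl | ⟨q, rfl, hq⟩
      · simpa using h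
      · simpa using hu q hq
    · refine ⟨[], a :: (u ++ v), rfl, fun p hp hne => ?_, fun p hp => by
        rw [List.prefix_nil.1 hp]⟩
      obtain ⟨p, rfl, hp'⟩ := (List.prefix_cons_iff.1 hp).resolve_left hne
      rw [List.sum_cons]
      rcases prefix_append_cases hp' with hp' | ⟨q, hq0, hq, rfl⟩
      · linarith [hu p hp']
      · rw [List.sum_append]
        linarith [hv q hq hq0]

theorem exists_rotate_prefix_sum_pos {s : List ℤ} (hs : 0 < s.sum) :
    ∃ k, ∀ p, p <+: s.rotate k → p ≠ [] → 0 < p.sum := by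
  obtain ⟨u, v, rfl, hv, hu⟩ := exists_split_prefix_sum_pos s
  refine ⟨u.length, fun p hp hne => ?_⟩
  rw [List.rotate_append_length_eq] at hp
  rcases prefix_append_cases hp with hp | ⟨q, -, hq, rfl⟩
  · exact hv p hp hne
  · rw [List.sum_append] at hs ⊢
    linarith [hu q hq]

theorem zipWith_cons_prefix (x : X) {u v : List X} {y : X} (h : v <+: u ++ [y]) :
    List.zipWith r (x :: v) v <+: List.zipWith r (x :: u) (u ++ [y]) := by
  induction u generalizing x v with
  | nil =>
    rcases List.prefix_cons_iff.1 h with rfl | ⟨q, rfl, hq⟩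
    · simp
    · simp [List.prefix_nil.1 hq]
  | cons z u ih =>
    rcases List.prefix_cons_iff.1 h with rfl | ⟨v, rfl, hv⟩
    · simp
    · simpa using ih z hv

theorem sum_zipWith_cons_concat (x : X) (u : List X) (y : X) :
    (List.zipWith r (x :: u) (u ++ [y])).sum = totalRise r (x :: u ++ [y]) := by
  rw [← (zipWith_cons_prefix r x (List.prefix_refl (u ++ [y]))).eq_of_length (by simp)]
  rfl

variable {r} in
/-- The cycle lemma for closed words. -/
theorem exists_rotation_totalRise_pos {x : X} {u : List X}
    (h : 0 < totalRise r (x :: u ++ [x])) :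
    ∃ y v, x :: u ~r y :: v ∧ ∀ p, p <+: v ++ [y] → p ≠ [] → 0 < totalRise r (y :: p) := by
  obtain ⟨k, hk⟩ := exists_rotate_prefix_sum_pos
    (s := List.zipWith r (x :: u) ((x :: u).rotate 1)) (by
      rw [List.rotate_cons_succ, List.rotate_zero, sum_zipWith_cons_concat]
      exact h)
  rw [List.zipWith_rotate_distrib _ _ _ _ (by simp), List.rotate_rotate, Nat.add_comm,
    ← List.rotate_rotate] at hk
  obtain ⟨y, v, hyv⟩ : ∃ y v, (x :: u).rotate k = y :: v := List.exists_cons_of_ne_nil (by simp)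
  rw [hyv, List.rotate_cons_succ, List.rotate_zero] at hk
  refine ⟨y, v, ⟨k, hyv⟩, fun p hp hne => hk _ (zipWith_cons_prefix r y hp) ?_⟩
  obtain ⟨z, p, rfl⟩ := List.exists_cons_of_ne_nil hne
  simp

end Rises
section Heights

variable {α : Type*} [LinearOrder α]

/-- The height difference of two successive letters. -/
def rise (a b : α) : ℤ := (if a < b then 1 else 0) - (if b < a then 1 else 0)

theorem rise_of_lt {a b : α} (h : a < b) : rise a b = 1 := by simp [rise, h, h.not_gt]

theorem rise_of_gt {a b : α} (h : b < a) : rise a b = -1 := by simp [rise, h, h.not_gt]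

theorem lt_of_rise_pos {a b : α} (h : 0 < rise a b) : a < b := by
  by_contra hab
  rw [rise, if_neg hab] at h
  split at h <;> omega

theorem rise_swap (a b : α) : rise b a = -rise a b := by simp [rise]

theorem totalRise_rise (w : List α) : totalRise rise w = asc w - des w := by
  induction w with
  | nil => rfl
  | cons a w ih =>
    cases w with
    | nil => rfl
    | cons b w =>
      rw [totalRise_cons_cons, ih, asc, des, rise]
      push_cast
      ring

theorem isBallotWord_iff {w : List α} : IsBallotWord w ↔ Ballot rise w := by
  simp only [IsBallotWord, Ballot, totalRise_rise, List.mem_inits, sub_nonneg, Nat.cast_le]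

theorem isDyckWord_iff {w : List α} : IsDyckWord w ↔ Ballot rise w ∧ totalRise rise w = 0 := by
  rw [IsDyckWord, isBallotWord_iff, totalRise_rise, sub_eq_zero, Nat.cast_inj]

theorem even_totalRise_iff {w : List α} (hw : w.IsChain (· ≠ ·)) (hne : w ≠ []) :
    Even (totalRise rise w) ↔ Odd w.length := by
  induction w with
  | nil => exact absurd rfl hne
  | cons a w ih =>
    cases w with
    | nil => simp
    | cons b w =>
      rw [List.isChain_cons_cons] at hw
      have hrise : ¬Even (rise a b) := by
        rcases lt_or_gt_of_ne hw.1 with h | h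
        · rw [rise_of_lt h]
          decide
        · rw [rise_of_gt h]
          decide
      rw [totalRise_cons_cons, Int.even_add, ih hw.2 (List.cons_ne_nil b w),
        List.length_cons (a := a), Nat.odd_add_one]
      tauto

theorem totalRise_rise_reverse (w : List α) : totalRise rise w.reverse = -totalRise rise w := by
  simpa using totalRise_reverse_map (f := id) (w := w) (r := rise)
    (List.pairwise_of_forall fun x y => rise_swap x y).isChain

theorem isDyckWord_singleton (a : α) : IsDyckWord [a] :=
  isDyckWord_iff.2 ⟨ballot_singleton rise a, rfl⟩

theorem IsDyckWord.reverse {w : List α} (hw : IsDyckWord w) : IsDyckWord w.reverse := by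
  obtain ⟨hb, h0⟩ := isDyckWord_iff.1 hw
  refine isDyckWord_iff.2 ⟨fun u hu => ?_, by rw [totalRise_rise_reverse, h0, neg_zero]⟩
  obtain ⟨v, hv⟩ := List.reverse_suffix.2 hu
  rw [List.reverse_reverse] at hv
  subst hv
  rw [← neg_nonpos, ← totalRise_rise_reverse]
  cases hr : u.reverse with
  | nil => rfl
  | cons a u' =>
    rw [hr, totalRise_append_cons] at h0
    rw [hr] at hb
    linarith [hb (v ++ [a]) ⟨u', by simp⟩]

theorem IsDyckWord.append_concat {x y : Piece α} {c : α} (hx : IsDyckWord x.1)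
    (hy : IsDyckWord y.1) (hxy : x.AscTo y) (hc : c < y.last) : IsDyckWord (x.1 ++ y.1 ++ [c]) := by
  obtain ⟨hbx, hx0⟩ := isDyckWord_iff.1 hx
  obtain ⟨hby, hy0⟩ := isDyckWord_iff.1 hy
  have hxy' : rise (x.1.getLast x.2) (y.1.head y.2) = 1 := rise_of_lt hxy
  have hne : x.1 ++ y.1 ≠ [] := List.append_ne_nil_of_left_ne_nil x.2 _
  have hc' : rise ((x.1 ++ y.1).getLast hne) c = -1 := by
    rw [List.getLast_append_of_ne_nil _ y.2]
    exact rise_of_gt hc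
  have hrise : totalRise rise (x.1 ++ y.1) = 1 := by
    rw [totalRise_append rise x.2 y.2, hx0, hy0, hxy']
    rfl
  refine isDyckWord_iff.2 ⟨.append (.append hbx hby fun _ _ => ?_) (ballot_singleton rise c)
    fun _ _ => ?_, ?_⟩
  · rw [hx0, hxy']
    decide
  · rw [hrise, List.head_singleton, hc']
    decide
  · rw [totalRise_append rise hne (List.cons_ne_nil c []), hrise, List.head_singleton, hc']
    rfl

end Heights

section DyckPieces

variable {α : Type*}

/-- The concatenation of a sequence of pieces. -/
def flat (ws : List (Piece α)) : List α := ws.flatMap Subtype.val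

@[simp] theorem flat_nil : flat ([] : List (Piece α)) = [] := rfl

@[simp] theorem flat_cons (w : Piece α) (ws : List (Piece α)) :
    flat (w :: ws) = w.1 ++ flat ws := rfl

@[simp] theorem flat_append (us ws : List (Piece α)) : flat (us ++ ws) = flat us ++ flat ws :=
  List.flatMap_append

theorem head_flat_cons (w : Piece α) (ws : List (Piece α)) (h : flat (w :: ws) ≠ []) :
    (flat (w :: ws)).head h = w.first :=
  List.head_append_of_ne_nil w.2

theorem getLast_flat_concat (ws : List (Piece α)) (w : Piece α) (h : flat (ws ++ [w]) ≠ []) :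
    (flat (ws ++ [w])).getLast h = w.last := by
  simp only [flat_append, flat_cons, flat_nil, List.append_nil]
  exact List.getLast_append_of_ne_nil _ w.2

theorem flat_reverse_map_rev (ws : List (Piece α)) :
    flat (ws.map Piece.rev).reverse = (flat ws).reverse := by
  induction ws with
  | nil => rfl
  | cons w ws ih => simp [ih, Piece.rev]

variable [LinearOrder α]

theorem totalRise_flat {ws : List (Piece α)} (hne : ws ≠ []) (hD : ∀ w ∈ ws, IsDyckWord w.1)
    (hws : ws.IsChain Piece.AscTo) : totalRise rise (flat ws) + 1 = ws.length := by
  induction ws with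
  | nil => exact absurd rfl hne
  | cons w ws ih =>
    obtain ⟨hDw, hDws⟩ := List.forall_mem_cons.1 hD
    rw [flat_cons]
    cases ws with
    | nil => simp [(isDyckWord_iff.1 hDw).2]
    | cons v ws =>
      have hv : flat (v :: ws) ≠ [] := by simp [v.2]
      rw [List.isChain_cons_cons] at hws
      have hrise : rise (w.1.getLast w.2) v.first = 1 := rise_of_lt hws.1
      rw [totalRise_append rise w.2 hv, head_flat_cons, (isDyckWord_iff.1 hDw).2, hrise,
        List.length_cons, Nat.cast_add, ← ih (List.cons_ne_nil v ws) hDws hws.2]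
      ring

theorem isBallotWord_flat {ws : List (Piece α)} (hD : ∀ w ∈ ws, IsDyckWord w.1)
    (hws : ws.IsChain Piece.AscTo) : IsBallotWord (flat ws) := by
  rw [isBallotWord_iff]
  induction ws with
  | nil => exact fun u hu => by simp [List.prefix_nil.1 hu]
  | cons w ws ih =>
    obtain ⟨hDw, hDws⟩ := List.forall_mem_cons.1 hD
    rw [flat_cons]
    refine .append (isDyckWord_iff.1 hDw).1 (ih hDws hws.tail) fun _ hne => ?_
    cases ws with
    | nil => exact absurd rfl hne
    | cons v ws =>
      have hrise : rise (w.1.getLast w.2) v.first = 1 :=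
        rise_of_lt (List.isChain_cons_cons.1 hws).1
      rw [head_flat_cons, (isDyckWord_iff.1 hDw).2, hrise]
      decide

theorem exists_flat_eq_concat_of_last_gt {us : List (Piece α)} {x y : Piece α} {c : α}
    (hD : ∀ w ∈ us ++ [x, y], IsDyckWord w.1) (hws : (us ++ [x, y]).IsChain Piece.AscTo)
    (hyc : c < y.last) :
    ∃ ws : List (Piece α), (∀ w ∈ ws, IsDyckWord w.1) ∧ ws.IsChain Piece.AscTo ∧
      flat ws = flat (us ++ [x, y]) ++ [c] := by
  have hxy := List.isChain_split.1 hws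
  let z : Piece α := ⟨x.1 ++ y.1 ++ [c], by simp⟩
  refine ⟨us ++ [z], ?_, ?_, by simp [z]⟩
  · have hz : IsDyckWord z.1 := (hD x (by simp)).append_concat (hD y (by simp))
      (List.isChain_pair.1 hxy.2) hyc
    simp only [List.mem_append, List.mem_singleton] at hD ⊢
    rintro w (hw | rfl)
    · exact hD w (Or.inl hw)
    · exact hz
  · have hfirst : z.first = x.first := by
      simp [z, Piece.first, List.head_append_of_ne_nil, x.2]
    simp only [List.isChain_append, List.head?_cons, Option.mem_some_iff, Piece.AscTo] at hxy ⊢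
    refine ⟨hxy.1.1, List.isChain_singleton _, fun v hv w hw => ?_⟩
    rw [← hw, hfirst]
    exact hxy.1.2.2 v hv x rfl

theorem exists_flat_eq_of_ballot {t : List α} (ht : t.IsChain (· ≠ ·)) (hb : Ballot rise t) :
    ∃ ws : List (Piece α), (∀ w ∈ ws, IsDyckWord w.1) ∧ ws.IsChain Piece.AscTo ∧ flat ws = t := by
  induction t using List.reverseRecOn with
  | nil => exact ⟨[], by simp⟩
  | append_singleton t c ih =>
    obtain ⟨ws, hD, hws, rfl⟩ :=
      ih (List.isChain_append.1 ht).1 (hb.of_prefix (List.prefix_append _ _))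
    rcases List.eq_nil_or_concat' ws with rfl | ⟨vs, y, rfl⟩
    · exact ⟨[⟨[c], List.cons_ne_nil c []⟩], by simp [isDyckWord_singleton]⟩
    have hne : flat (vs ++ [y]) ≠ [] := by simp [y.2]
    have hyc : y.last ≠ c := by
      rw [← getLast_flat_concat vs y hne]
      exact (List.isChain_append.1 ht).2.2 _ (List.getLast?_eq_some_getLast hne) _ rfl
    rcases lt_or_gt_of_ne hyc with hyc | hyc
    · refine ⟨vs ++ y :: [⟨[c], List.cons_ne_nil c []⟩], ?_, ?_, by simp⟩
      · simpa [or_imp, forall_and, isDyckWord_singleton] using hD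
      · exact List.isChain_split.2 ⟨hws, List.isChain_pair.2 hyc⟩
    rcases List.eq_nil_or_concat' vs with rfl | ⟨us, x, rfl⟩
    · have h := hb _ (List.prefix_refl _)
      have hy := totalRise_flat (List.cons_ne_nil y []) hD hws
      rw [totalRise_append rise hne (List.cons_ne_nil c []), getLast_flat_concat,
        List.head_singleton, rise_of_gt hyc, totalRise_singleton] at h
      simp only [List.nil_append, List.length_singleton] at h hy
      omega
    rw [List.append_assoc, List.singleton_append] at hD hws ⊢
    exact exists_flat_eq_concat_of_last_gt hD hws hyc

theorem exists_chain_ascTo_of_pos {a : α} {r : List α} (hn : (a :: r).Nodup)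
    (hodd : Odd (a :: r).length) (hpos : 0 < totalRise rise (a :: r ++ [a])) :
    ∃ ws : List (Piece α), (∀ w ∈ ws, IsDyckWord w.1) ∧ Odd ws.length ∧
      Cycle.Chain Piece.AscTo (ws : Cycle (Piece α)) ∧ a :: r ~r flat ws := by
  obtain ⟨b, t, hrot, ht⟩ := exists_rotation_totalRise_pos hpos
  have hrot' : b :: t ~r t ++ [b] := List.isRotated_append (l := [b]) (l' := t)
  have hne : t ++ [b] ≠ [] := by simp
  have hlt : b < (t ++ [b]).head hne := lt_of_rise_pos (by
    simpa [totalRise_cons_cons] using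
      ht [(t ++ [b]).head hne] ⟨_, List.cons_head_tail hne⟩ (List.cons_ne_nil _ _))
  have hchain : (t ++ [b]).IsChain (· ≠ ·) :=
    ((hrot.trans hrot').perm.nodup_iff.1 hn).isChain
  have hballot : Ballot rise (t ++ [b]) := fun u hu => by
    by_cases hu0 : u = []
    · simp [hu0]
    have h := ht u hu hu0
    rw [totalRise_cons rise b hu0, hu.head hu0, rise_of_lt hlt] at h
    omega
  obtain ⟨ws, hD, hws, hflat⟩ := exists_flat_eq_of_ballot hchain hballot
  obtain ⟨w, ws, rfl⟩ : ∃ w ws', ws = w :: ws' :=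
    List.exists_cons_of_ne_nil (by rintro rfl; exact hne hflat.symm)
  refine ⟨w :: ws, hD, ?_, ?_, by rw [hflat]; exact hrot.trans hrot'⟩
  · have hlen : Odd (t ++ [b]).length := by rwa [← (hrot.trans hrot').perm.length_eq]
    have h := ((even_totalRise_iff hchain hne).2 hlen).add_one
    rw [← hflat, totalRise_flat (List.cons_ne_nil w ws) hD hws] at h
    exact_mod_cast h
  · rw [Cycle.chain_coe_cons, ← List.cons_append, List.isChain_append]
    refine ⟨hws, List.isChain_singleton w, fun x hx y hy => ?_⟩
    obtain rfl : w = y := by simpa using hy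
    obtain ⟨vs, hvs⟩ := List.getLast?_eq_some_iff.1 hx
    have hfirst : w.first = (t ++ [b]).head hne := by
      rw [← head_flat_cons w ws (by simp [w.2])]
      simp only [hflat]
    have hlast : x.last = b := by
      rw [← getLast_flat_concat vs x (by simp [x.2])]
      simp only [← hvs, hflat, List.getLast_concat]
    rw [Piece.AscTo, hfirst, hlast]
    exact hlt

theorem exists_isMonotoneCycle {t : List α} (hn : t.Nodup) (hodd : Odd t.length) :
    ∃ g, IsMonotoneCycle g ∧ (∀ w ∈ g, IsDyckWord w.1) ∧ t ~r flat g := by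
  rcases t with _ | ⟨a, r⟩
  · simp at hodd
  by_cases hr : r = []
  · subst hr
    exact ⟨[⟨[a], List.cons_ne_nil a []⟩], ⟨odd_one, Or.inr (Or.inr ⟨_, rfl, rfl⟩)⟩,
      by simpa using isDyckWord_singleton a, List.IsRotated.refl _⟩
  have hchain : (a :: r ++ [a]).IsChain (· ≠ ·) := by
    refine List.isChain_append.2 ⟨hn.isChain, List.isChain_singleton a, fun x hx y hy => ?_⟩
    obtain rfl : a = y := by simpa using hy
    rw [List.getLast?_cons_of_ne_nil hr] at hx
    rintro rfl
    exact (List.nodup_cons.1 hn).1 (List.mem_of_getLast? hx)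
  have hne : totalRise rise (a :: r ++ [a]) ≠ 0 := fun h => by
    have heven := (even_totalRise_iff hchain (by simp)).1 (h ▸ Even.zero)
    rw [List.length_append, ← Nat.not_even_iff_odd] at heven
    exact heven (hodd.add_odd odd_one)
  rcases lt_or_gt_of_ne hne with hneg | hpos
  · have hperm : (a :: r.reverse).Perm (a :: r) := (List.reverse_perm r).cons a
    obtain ⟨ws, hD, hws, hchain, hrot⟩ := exists_chain_ascTo_of_pos (hperm.nodup_iff.2 hn)
      (by rwa [hperm.length_eq]) (by
        rw [show a :: r.reverse ++ [a] = (a :: r ++ [a]).reverse by simp, totalRise_rise_reverse]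
        exact neg_pos.2 hneg)
    refine ⟨(ws.map Piece.rev).reverse, ⟨by simpa using hws, Or.inr (Or.inl ?_)⟩, ?_, ?_⟩
    · exact chain_reverse_map Piece.AscTo.descTo_rev hchain
    · simp only [List.mem_reverse, List.mem_map]
      rintro w ⟨v, hv, rfl⟩
      exact (hD v hv).reverse
    · rw [flat_reverse_map_rev]
      have h : a :: r ~r (a :: r.reverse).reverse := by
        simpa using List.isRotated_append (l := [a]) (l' := r)
      exact h.trans hrot.reverse
  · obtain ⟨ws, hD, hws, hchain, hrot⟩ := exists_chain_ascTo_of_pos hn hodd hpos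
    exact ⟨ws, ⟨hws, Or.inl hchain⟩, hD, hrot⟩

end DyckPieces

section BoxWord

variable {α : Type*}

theorem factor_append_left {u : List α} {j : ℕ} (hj : j < u.length) (v : List α) (i : ℕ) :
    factor (u ++ v) i j = factor u i j := by
  rw [factor, factor, List.drop_append, List.take_append_of_le_length]
  · by_cases hi : i ≤ u.length
    · simp
      omega
    · rw [List.length_drop]
      omega

theorem factor_append_right (u v : List α) (i j : ℕ) :
    factor (u ++ v) (i + u.length) (j + u.length) = factor v i j := by
  rw [factor, factor, List.drop_append, List.drop_of_length_le (by omega), List.nil_append]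
  congr 1
  · omega
  · congr 1
    omega

theorem factor_append_of_lt_of_le {u : List α} {i j : ℕ} (hi : i < u.length) (hj : u.length ≤ j)
    (v : List α) : factor (u ++ v) i j = u.drop i ++ v.take (j + 1 - u.length) := by
  rw [factor, List.drop_append, List.take_append, Nat.sub_eq_zero_of_le hi.le, List.drop_zero,
    List.take_of_length_le (by simp; omega), List.length_drop]
  congr 2
  omega

theorem factor_zero_length_sub_one {u : List α} (hu : u ≠ []) :
    factor u 0 (u.length - 1) = u := by
  have := List.length_pos_iff.2 hu
  rw [factor, List.drop_zero, List.take_of_length_le (by omega)]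

theorem Piece.first_ne_last {x : Piece α} (hx : x.1.Nodup) (hlen : x.1.length ≠ 1) :
    x.first ≠ x.last := by
  obtain ⟨_ | ⟨a, _ | ⟨b, w⟩⟩, hne⟩ := x
  · exact absurd rfl hne
  · exact absurd rfl hlen
  · intro h
    have h' : a = (b :: w).getLast (by simp) := h
    exact (List.nodup_cons.1 hx).1 (h' ▸ List.getLast_mem _)

variable [LinearOrder α]

theorem isDyckFactor_append_left {u : List α} {j : ℕ} (hj : j < u.length) (v : List α) (i : ℕ) :
    IsDyckFactor (u ++ v) i j ↔ IsDyckFactor u i j := by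
  rw [IsDyckFactor, IsDyckFactor, factor_append_left hj, List.length_append]
  simp only [hj, Nat.lt_add_right _ hj]

theorem isDyckFactor_append_right (u v : List α) (i j : ℕ) :
    IsDyckFactor (u ++ v) (i + u.length) (j + u.length) ↔ IsDyckFactor v i j := by
  rw [IsDyckFactor, IsDyckFactor, factor_append_right, List.length_append]
  exact and_congr (by omega) (and_congr_left' (by omega))

/-- A Dyck word which is followed in the ballot word `u ++ v` by an ascent, so that it is returned
to the axis for the last time at the end of `u`. -/
structure DyckSplit (u v : List α) : Prop where
  ne_nil : u ≠ []
  dyck : IsDyckWord u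
  ballot : IsBallotWord v
  lt : ∀ h : v ≠ [], u.getLast ne_nil < v.head h

namespace DyckSplit

variable {u v : List α} (h : DyckSplit u v)

include h

theorem not_isDyckFactor {i j : ℕ} (hi : i < u.length) (hj : u.length ≤ j) :
    ¬IsDyckFactor (u ++ v) i j := by
  rintro ⟨-, hlen, hdyck⟩
  have hv : v ≠ [] := by
    rintro rfl
    rw [List.append_nil] at hlen
    omega
  have hne : u.drop i ≠ [] := by simpa using hi
  have hne' : v.take (j + 1 - u.length) ≠ [] := by
    simp only [ne_eq, List.take_eq_nil_iff, hv, or_false]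
    omega
  rw [factor_append_of_lt_of_le hi hj, isDyckWord_iff, totalRise_append rise hne hne',
    rise_of_lt (by rw [List.getLast_drop, List.head_take]; exact h.lt hv)] at hdyck
  have hleft := hdyck.1 (u.drop i) (List.prefix_append _ _)
  have hright := isBallotWord_iff.1 h.ballot _ (List.take_prefix (j + 1 - u.length) v)
  linarith [hdyck.2]

theorem isDyckFactor_append (i j : ℕ) :
    IsDyckFactor (u ++ v) i j ↔ (j < u.length ∧ IsDyckFactor u i j) ∨
      ∃ i' j', i = i' + u.length ∧ j = j' + u.length ∧ IsDyckFactor v i' j' := by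
  constructor
  · intro hf
    rcases lt_or_ge j u.length with hj | hj
    · exact Or.inl ⟨hj, (isDyckFactor_append_left hj v i).1 hf⟩
    rcases lt_or_ge i u.length with hi | hi
    · exact absurd hf (h.not_isDyckFactor hi hj)
    obtain ⟨i, rfl⟩ := Nat.exists_eq_add_of_le' hi
    obtain ⟨j, rfl⟩ := Nat.exists_eq_add_of_le' hj
    exact Or.inr ⟨i, j, rfl, rfl, (isDyckFactor_append_right u v i j).1 hf⟩
  · rintro (⟨hj, hf⟩ | ⟨i, j, rfl, rfl, hf⟩)
    · exact (isDyckFactor_append_left hj v i).2 hf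
    · exact (isDyckFactor_append_right u v i j).2 hf

theorem isDyckFactor_zero (hlen : 3 ≤ u.length) : IsDyckFactor (u ++ v) 0 (u.length - 1) := by
  refine (isDyckFactor_append_left (by omega) v 0).2 ⟨by omega, by omega, ?_⟩
  rw [factor_zero_length_sub_one h.ne_nil]
  exact h.dyck

theorem isMaxDyckFactor_append (i j : ℕ) :
    IsMaxDyckFactor (u ++ v) i j ↔ (i = 0 ∧ j = u.length - 1 ∧ 3 ≤ u.length) ∨
      ∃ i' j', i = i' + u.length ∧ j = j' + u.length ∧ IsMaxDyckFactor v i' j' := by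
  constructor
  · rintro ⟨hf, hmax⟩
    rcases (h.isDyckFactor_append i j).1 hf with ⟨hj, hij, -⟩ | ⟨i, j, rfl, rfl, hvf⟩
    · have hlen : 3 ≤ u.length := by omega
      have := hmax 0 (by omega) (u.length - 1) (by rw [List.length_append]; omega)
        ⟨by omega, h.isDyckFactor_zero hlen⟩
      exact Or.inl ⟨this.1.symm, this.2.symm, hlen⟩
    · refine Or.inr ⟨i, j, rfl, rfl, hvf, fun i' hi' j' hj' hf' => ?_⟩
      have := hmax (i' + u.length) (by omega) (j' + u.length) (by rw [List.length_append]; omega)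
        ⟨by omega, (isDyckFactor_append_right u v i' j').2 hf'.2⟩
      omega
  · rintro (⟨rfl, rfl, hlen⟩ | ⟨i, j, rfl, rfl, hf, hmax⟩)
    · refine ⟨h.isDyckFactor_zero hlen, fun i' hi' j' _ ⟨_, hf⟩ => ?_⟩
      rcases (h.isDyckFactor_append _ _).1 hf with ⟨hj, -⟩ | ⟨i, j, rfl, -⟩ <;> omega
    · refine ⟨(isDyckFactor_append_right u v i j).2 hf, fun i' hi' j' hj' ⟨hjj, hf'⟩ => ?_⟩
      have hij := hf.1
      rcases (h.isDyckFactor_append _ _).1 hf' with ⟨hj, -⟩ | ⟨i', j', rfl, rfl, hvf⟩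
      · omega
      · rw [List.length_append] at hj'
        have := hmax i' (by omega) j' (by omega) ⟨by omega, hvf⟩
        omega

end DyckSplit

theorem mem_maxDyckFactors {w : List α} {f : ℕ × ℕ} :
    f ∈ maxDyckFactors w ↔ IsMaxDyckFactor w f.1 f.2 := by
  simp only [maxDyckFactors, List.product, List.mem_filter, decide_eq_true_eq,
    and_iff_right_iff_imp]
  intro hf
  have hij := hf.1.1
  have hj := hf.1.2.1
  simp only [List.mem_flatMap, List.mem_map, List.mem_range]
  exact ⟨f.1, by omega, f.2, hj, rfl⟩

theorem IsDyckWord.length_ne_two {u : List α} (hu : IsDyckWord u) (hn : u.Nodup) :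
    u.length ≠ 2 := fun hlen => by
  have heven := (even_totalRise_iff hn.isChain (List.ne_nil_of_length_pos (by omega))).1
    (by rw [(isDyckWord_iff.1 hu).2]; exact Even.zero)
  rw [hlen] at heven
  exact absurd heven (by decide)

/-- The contribution of the `k`-th letter of `w` to `boxWord w`. -/
def boxLetter (w : List α) (k : ℕ) : List (Option α) :=
  if ∃ f ∈ maxDyckFactors w, k = f.1 + 1 then [none]
  else if ∃ f ∈ maxDyckFactors w, f.1 < k ∧ k < f.2 then []
  else w[k]?.toList.map some

namespace DyckSplit

variable {u v : List α} (h : DyckSplit u v)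

include h

theorem exists_mem_maxDyckFactors_append (p : ℕ × ℕ → Prop) :
    (∃ f ∈ maxDyckFactors (u ++ v), p f) ↔ (3 ≤ u.length ∧ p (0, u.length - 1)) ∨
      ∃ f ∈ maxDyckFactors v, p (f.1 + u.length, f.2 + u.length) := by
  simp only [mem_maxDyckFactors, h.isMaxDyckFactor_append]
  constructor
  · rintro ⟨⟨i, j⟩, ⟨rfl, rfl, hlen⟩ | ⟨i, j, rfl, rfl, hf⟩, hp⟩
    · exact Or.inl ⟨hlen, hp⟩
    · exact Or.inr ⟨(i, j), hf, hp⟩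
  · rintro (⟨hlen, hp⟩ | ⟨f, hf, hp⟩)
    · exact ⟨_, Or.inl ⟨rfl, rfl, hlen⟩, hp⟩
    · exact ⟨_, Or.inr ⟨_, _, rfl, rfl, hf⟩, hp⟩

theorem boxLetter_append_right (k : ℕ) : boxLetter (u ++ v) (u.length + k) = boxLetter v k := by
  have := List.length_pos_iff.2 h.ne_nil
  have hfirst : (∃ f ∈ maxDyckFactors (u ++ v), u.length + k = f.1 + 1) ↔
      ∃ f ∈ maxDyckFactors v, k = f.1 + 1 := by
    rw [h.exists_mem_maxDyckFactors_append, or_iff_right (by omega)]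
    exact exists_congr fun f => and_congr_right' (by omega)
  have hmid : (∃ f ∈ maxDyckFactors (u ++ v), f.1 < u.length + k ∧ u.length + k < f.2) ↔
      ∃ f ∈ maxDyckFactors v, f.1 < k ∧ k < f.2 := by
    rw [h.exists_mem_maxDyckFactors_append, or_iff_right (by omega)]
    exact exists_congr fun f => and_congr_right' (by omega)
  simp only [boxLetter, hfirst, hmid]
  rw [List.getElem?_append_right (Nat.le_add_right _ _), Nat.add_sub_cancel_left]

theorem boxLetter_append_left {k : ℕ} (hk : k < u.length) :
    boxLetter (u ++ v) k = if 3 ≤ u.length ∧ k = 1 then [none]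
      else if 0 < k ∧ k + 1 < u.length then [] else u[k]?.toList.map some := by
  have hfirst : (∃ f ∈ maxDyckFactors (u ++ v), k = f.1 + 1) ↔ 3 ≤ u.length ∧ k = 1 := by
    rw [h.exists_mem_maxDyckFactors_append, or_iff_left (by rintro ⟨f, -, hf⟩; omega)]
  have hmid : (∃ f ∈ maxDyckFactors (u ++ v), f.1 < k ∧ k < f.2) ↔ 0 < k ∧ k + 1 < u.length := by
    rw [h.exists_mem_maxDyckFactors_append, or_iff_left (by rintro ⟨f, -, hf⟩; omega)]
    omega
  simp only [boxLetter, hfirst, hmid]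
  rw [List.getElem?_append_left hk]

theorem flatMap_boxLetter_append_left (hn : u.Nodup) :
    (List.range u.length).flatMap (boxLetter (u ++ v)) = Piece.box ⟨u, h.ne_nil⟩ := by
  rw [List.flatMap_congr fun k hk => h.boxLetter_append_left (List.mem_range.1 hk)]
  by_cases hone : u.length = 1
  · obtain ⟨a, rfl⟩ := List.length_eq_one_iff.1 hone
    simp [Piece.box, Piece.first, Piece.last]
  rw [Piece.box_of_ne (Piece.first_ne_last hn hone)]
  have hpos := List.length_pos_iff.2 h.ne_nil
  have htwo := h.dyck.length_ne_two hn
  obtain ⟨n, hlen⟩ : ∃ n, u.length = 2 + n + 1 := ⟨u.length - 3, by omega⟩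
  have hmid : (List.range n).flatMap (fun k => if 3 ≤ 2 + n + 1 ∧ 2 + k = 1 then [none]
      else if 0 < 2 + k ∧ 2 + k + 1 < 2 + n + 1 then []
      else u[2 + k]?.toList.map some) = [] := by
    refine List.flatMap_eq_nil_iff.2 fun k hk => ?_
    rw [List.mem_range] at hk
    rw [if_neg (by omega), if_pos (by omega)]
  have hfirst : u[0]? = some (Piece.first ⟨u, h.ne_nil⟩) := by
    rw [← List.head?_eq_getElem?, List.head?_eq_some_head h.ne_nil, Piece.first]
  have hlast : u[2 + n]? = some (Piece.last ⟨u, h.ne_nil⟩) := by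
    rw [Piece.last, ← List.getLast?_eq_some_getLast, List.getLast?_eq_getElem?, hlen,
      Nat.add_sub_cancel]
  rw [hlen, List.range_succ, List.range_add]
  simp only [List.flatMap_append, List.flatMap_map, hmid]
  simp [hfirst, hlast, show List.range 2 = [0, 1] from rfl, show 2 + n ≠ 1 by omega]

theorem boxWord_append (hn : u.Nodup) :
    boxWord (u ++ v) = Piece.box ⟨u, h.ne_nil⟩ ++ boxWord v := by
  change (List.range (u ++ v).length).flatMap (boxLetter (u ++ v)) = _
  rw [List.length_append, List.range_add, List.flatMap_append, h.flatMap_boxLetter_append_left hn,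
    List.flatMap_map]
  simp only [h.boxLetter_append_right]
  rfl

theorem mem_maxDyckWords_append (d : List α) :
    d ∈ maxDyckWords (u ++ v) ↔ (3 ≤ u.length ∧ u = d) ∨ d ∈ maxDyckWords v := by
  have hpos := List.length_pos_iff.2 h.ne_nil
  rw [maxDyckWords, List.mem_map, h.exists_mem_maxDyckFactors_append,
    factor_append_left (by omega), factor_zero_length_sub_one h.ne_nil]
  simp only [factor_append_right, maxDyckWords, List.mem_map]

end DyckSplit

theorem dyckSplit_flat {w : Piece α} {ws : List (Piece α)} (hD : ∀ v ∈ w :: ws, IsDyckWord v.1)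
    (hws : (w :: ws).IsChain Piece.AscTo) : DyckSplit w.1 (flat ws) where
  ne_nil := w.2
  dyck := hD w List.mem_cons_self
  ballot := isBallotWord_flat (List.forall_mem_cons.1 hD).2 hws.tail
  lt hne := by
    cases ws with
    | nil => exact absurd rfl hne
    | cons v ws =>
      rw [head_flat_cons]
      exact (List.isChain_cons_cons.1 hws).1

theorem boxWord_flat {ws : List (Piece α)} (hD : ∀ w ∈ ws, IsDyckWord w.1)
    (hws : ws.IsChain Piece.AscTo) (hn : (flat ws).Nodup) : boxWord (flat ws) = boxes ws := by
  induction ws with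
  | nil => rfl
  | cons w ws ih =>
    rw [flat_cons, List.nodup_append] at hn
    rw [flat_cons, (dyckSplit_flat hD hws).boxWord_append hn.1,
      ih (List.forall_mem_cons.1 hD).2 hws.tail hn.2.1, boxes_cons]

theorem mem_maxDyckWords_flat {ws : List (Piece α)} (hD : ∀ w ∈ ws, IsDyckWord w.1)
    (hws : ws.IsChain Piece.AscTo) {d : List α} :
    d ∈ maxDyckWords (flat ws) ↔ ∃ w ∈ ws, 3 ≤ w.1.length ∧ w.1 = d := by
  induction ws with
  | nil => simp [maxDyckWords, maxDyckFactors]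
  | cons w ws ih =>
    rw [flat_cons, (dyckSplit_flat hD hws).mem_maxDyckWords_append,
      ih (List.forall_mem_cons.1 hD).2 hws.tail]
    simp

end BoxWord

section Fill

variable {α : Type*}

theorem Piece.eq_cons_interior_concat {x : Piece α} (hx : x.first ≠ x.last) :
    x.1 = x.first :: (x.1.tail.dropLast ++ [x.last]) := by
  obtain ⟨_ | ⟨a, w⟩, hne⟩ := x
  · exact absurd rfl hne
  rcases List.eq_nil_or_concat' w with rfl | ⟨w, b, rfl⟩
  · exact absurd rfl hx
  · simp [Piece.first, Piece.last]

variable [LinearOrder α]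

/-- The contribution of the `k`-th entry of `C` to `fillCycle D C`. -/
def fillLetter (D : List (List α)) (C : List (Option α)) (k : ℕ) : List α :=
  match C[k]? with
  | some (some a) => [a]
  | some none =>
    boxContent D C[(k + C.length - 1) % C.length]?.join C[(k + 1) % C.length]?.join
  | none => []

theorem fillLetter_rotate (D : List (List α)) {C : List (Option α)} (n : ℕ) {k : ℕ}
    (hk : k < C.length) : fillLetter D (C.rotate n) k = fillLetter D C ((k + n) % C.length) := by
  have hpos : 0 < C.length := by omega
  have hpred : ((k + C.length - 1) % C.length + n) % C.length =
      ((k + n) % C.length + C.length - 1) % C.length := by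
    rw [Nat.mod_add_mod, Nat.add_sub_assoc hpos, Nat.add_sub_assoc hpos, Nat.mod_add_mod,
      Nat.add_right_comm]
  have hsucc : ((k + 1) % C.length + n) % C.length = ((k + n) % C.length + 1) % C.length := by
    rw [Nat.mod_add_mod, Nat.mod_add_mod, Nat.add_right_comm]
  rw [fillLetter, fillLetter, List.getElem?_rotate hk, List.length_rotate,
    List.getElem?_rotate (Nat.mod_lt _ hpos), List.getElem?_rotate (Nat.mod_lt _ hpos), hpred,
    hsucc]

theorem fillCycle_isRotated (D : List (List α)) {C C' : List (Option α)} (h : C ~r C') :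
    fillCycle D C ~r fillCycle D C' := by
  obtain ⟨n, rfl⟩ := h
  have hrot : (List.range C.length).map (fun k => (k + n) % C.length) =
      (List.range C.length).rotate n :=
    List.ext_getElem (by simp) fun i _ _ => by simp [List.getElem_rotate]
  have hfill : fillCycle D (C.rotate n) =
      ((List.range C.length).rotate n).flatMap (fillLetter D C) := by
    change (List.range (C.rotate n).length).flatMap (fillLetter D (C.rotate n)) = _
    rw [List.length_rotate, ← hrot, List.flatMap_map]
    exact List.flatMap_congr fun k hk => fillLetter_rotate D n (List.mem_range.1 hk)
  rw [hfill]
  exact isRotated_flatMap ⟨n, rfl⟩ _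

/-- Each word of `D` is determined by each of its two extremal letters, also up to reversal. -/
def SepEnds (D : List (List α)) : Prop :=
  ∀ d ∈ D, ∀ d' ∈ D, (d.head? = d'.head? ∨ d.head? = d'.getLast? ∨ d.getLast? = d'.getLast?) →
    d = d'

namespace SepEnds

variable {D : List (List α)} (hD : SepEnds D) {d : List α} (hd : d ∈ D)

include hD hd

theorem find?_eq : D.find? (fun e => e.head? = d.head? ∧ e.getLast? = d.getLast?) = some d := by
  cases hf : D.find? (fun e => decide (e.head? = d.head? ∧ e.getLast? = d.getLast?)) with
  | none => simpa using List.find?_eq_none.1 hf d hd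
  | some e =>
    have he := List.find?_some hf
    rw [decide_eq_true_eq] at he
    rw [hD e (List.mem_of_find?_eq_some hf) d hd (Or.inl he.1)]

theorem boxContent_eq : boxContent D d.head? d.getLast? = d.tail.dropLast := by
  rw [boxContent, hD.find?_eq hd]

theorem boxContent_reverse_eq (hne : d.head? ≠ d.getLast?) :
    boxContent D d.getLast? d.head? = d.tail.dropLast.reverse := by
  have hnone : D.find? (fun e => decide (e.head? = d.getLast? ∧ e.getLast? = d.head?)) = none := by
    refine List.find?_eq_none.2 fun e he h => ?_
    rw [decide_eq_true_eq] at h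
    obtain rfl := hD e he d hd (Or.inr (Or.inl h.1))
    exact hne h.1
  rw [boxContent, hnone, hD.find?_eq hd]

end SepEnds

/-- The boxed form of the piece `x` can be filled with the help of `D`: the piece is a letter, or
it occurs in `D` up to reversal. -/
def Fillable (D : List (List α)) (x : Piece α) : Prop :=
  x.1.length = 1 ∨ (x.first ≠ x.last ∧ (x.1 ∈ D ∨ x.1.reverse ∈ D))

variable {D : List (List α)} (hD : SepEnds D)

include hD

theorem boxContent_first_last {x : Piece α} (hne : x.first ≠ x.last)
    (hx : x.1 ∈ D ∨ x.1.reverse ∈ D) :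
    boxContent D (some x.first) (some x.last) = x.1.tail.dropLast := by
  have hfirst : some x.first = x.1.head? := (List.head?_eq_some_head x.2).symm
  have hlast : some x.last = x.1.getLast? := (List.getLast?_eq_some_getLast x.2).symm
  rw [hfirst, hlast]
  rcases hx with hx | hx
  · exact hD.boxContent_eq hx
  · have h := hD.boxContent_reverse_eq hx (by
      rw [List.head?_reverse, List.getLast?_reverse, ← hfirst, ← hlast]
      exact fun h => hne (Option.some_injective _ h).symm)
    rw [List.head?_reverse, List.getLast?_reverse] at h
    rw [h, List.tail_reverse, List.dropLast_reverse, List.reverse_reverse, List.tail_dropLast]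

theorem flatMap_fillLetter_box {x : Piece α} (hx : Fillable D x) (p q : List (Option α)) :
    (List.range x.box.length).flatMap (fun k => fillLetter D (p ++ (x.box ++ q)) (p.length + k)) =
      x.1 := by
  rcases hx with hlen | ⟨hne, hmem⟩
  · obtain ⟨w, hw⟩ := x
    obtain ⟨a, rfl⟩ := List.length_eq_one_iff.1 hlen
    simp [Piece.box, Piece.first, Piece.last, fillLetter]
  rw [Piece.box_of_ne hne]
  obtain ⟨C, hC⟩ : ∃ C, C = p ++ ([some x.first, none, some x.last] ++ q) := ⟨_, rfl⟩
  have hlen : C.length = p.length + 3 + q.length := by simp [hC, Nat.add_assoc, Nat.add_comm 3]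
  have hget₀ : C[p.length]? = some (some x.first) := by simp [hC]
  have hget₁ : C[p.length + 1]? = some none := by simp [hC]
  have hget₂ : C[p.length + 2]? = some (some x.last) := by simp [hC]
  have hpred : (p.length + 1 + C.length - 1) % C.length = p.length := by
    rw [show p.length + 1 + C.length - 1 = p.length + C.length by omega, Nat.add_mod_right,
      Nat.mod_eq_of_lt (by omega)]
  have hsucc : (p.length + 1 + 1) % C.length = p.length + 2 := Nat.mod_eq_of_lt (by omega)
  have hfill₁ : fillLetter D C (p.length + 1) = x.1.tail.dropLast := by
    simp only [fillLetter, hget₁, hpred, hsucc, hget₀, hget₂, Option.join_some]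
    exact boxContent_first_last hD hne hmem
  rw [← hC, show List.range [some x.first, none, some x.last].length = [0, 1, 2] from rfl]
  conv_rhs => rw [Piece.eq_cons_interior_concat hne, ← hfill₁]
  simp [fillLetter, hget₀, hget₂]

theorem flatMap_fillLetter_boxes (us : List (Piece α)) {ws : List (Piece α)}
    (hws : ∀ x ∈ ws, Fillable D x) :
    (List.range (boxes ws).length).flatMap
      (fun k => fillLetter D (boxes (us ++ ws)) ((boxes us).length + k)) = flat ws := by
  induction ws generalizing us with
  | nil => rfl
  | cons x ws ih =>
    obtain ⟨hx, hws⟩ := List.forall_mem_cons.1 hws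
    have ih := ih (us ++ [x]) hws
    rw [← List.append_cons] at ih
    rw [flat_cons, ← ih, boxes_cons, List.length_append, List.range_add, List.flatMap_append,
      List.flatMap_map]
    congr 1
    · rw [boxes_append, boxes_cons]
      exact flatMap_fillLetter_box hD hx _ _
    · simp [Nat.add_assoc]

theorem fillCycle_boxes {ws : List (Piece α)} (hws : ∀ x ∈ ws, Fillable D x) :
    fillCycle D (boxes ws) = flat ws := by
  change (List.range (boxes ws).length).flatMap (fillLetter D (boxes ws)) = flat ws
  simpa using flatMap_fillLetter_boxes hD [] hws

end Fill

section Surjective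

variable {α : Type*}

theorem flat_flatten (G : List (List (Piece α))) : flat G.flatten = G.flatMap flat := by
  induction G with
  | nil => rfl
  | cons g G ih => rw [List.flatten_cons, flat_append, ih, List.flatMap_cons]

theorem RevPerm.flat_perm {us ws : List (Piece α)} (h : RevPerm us ws) :
    (flat us).Perm (flat ws) :=
  h.flatMap_perm fun x => x.1.reverse_perm

theorem length_le_length_flatten {G : List (List α)} (hG : ∀ g ∈ G, g ≠ []) :
    G.length ≤ G.flatten.length := by
  rw [List.length_flatten]
  simpa using List.length_le_sum_of_one_le (G.map List.length)
    (List.forall_mem_map.2 fun g hg => List.length_pos_iff.2 (hG g hg))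

theorem eq_of_mem_of_nodup_flat {ws : List (Piece α)} (hn : (flat ws).Nodup) {x y : Piece α}
    (hx : x ∈ ws) (hy : y ∈ ws) {a : α} (hax : a ∈ x.1) (hay : a ∈ y.1) : x = y := by
  by_contra hne
  have : Std.Symm fun u v : Piece α => u.1.Disjoint v.1 := ⟨fun _ _ h => h.symm⟩
  have hdisj : ws.Pairwise fun u v => u.1.Disjoint v.1 := (List.nodup_flatMap.1 hn).2
  exact hdisj.forall hx hy hne hax hay

theorem sepEnds_of_nodup {ws : List (Piece α)} (hn : (flat ws).Nodup) {D : List (List α)}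
    (hD : ∀ d ∈ D, ∃ w ∈ ws, w.1 = d) : SepEnds D := by
  intro d hd d' hd' h
  obtain ⟨x, hx, rfl⟩ := hD d hd
  obtain ⟨y, hy, rfl⟩ := hD d' hd'
  simp only [List.head?_eq_some_head x.2, List.head?_eq_some_head y.2,
    List.getLast?_eq_some_getLast x.2, List.getLast?_eq_some_getLast y.2,
    Option.some.injEq] at h
  have hxh := List.head_mem x.2
  have hxl := List.getLast_mem x.2
  have hyh := List.head_mem y.2
  have hyl := List.getLast_mem y.2
  refine congrArg Subtype.val ?_
  rcases h with h | h | h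
  · exact eq_of_mem_of_nodup_flat hn hx hy hxh (h ▸ hyh)
  · exact eq_of_mem_of_nodup_flat hn hx hy hxh (h ▸ hyl)
  · exact eq_of_mem_of_nodup_flat hn hx hy hxl (h ▸ hyl)

variable [LinearOrder α]

theorem Piece.ends_subset (x : Piece α) : x.ends ⊆ x.1 := by
  intro a ha
  rcases Piece.mem_ends.1 ha with rfl | rfl
  · exact List.head_mem x.2
  · exact List.getLast_mem x.2

theorem Piece.nodup_ends (x : Piece α) : x.ends.Nodup := by
  unfold ends box
  split <;> simp_all [List.reduceOption]

theorem visible_nodup {ws : List (Piece α)} (hn : (flat ws).Nodup) : (visible ws).Nodup :=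
  List.nodup_flatMap.2 ⟨fun x _ => x.nodup_ends, (List.nodup_flatMap.1 hn).2.imp
    fun hxy _ hx hy => hxy (Piece.ends_subset _ hx) (Piece.ends_subset _ hy)⟩

theorem length_le_length_boxes (ws : List (Piece α)) : ws.length ≤ (boxes ws).length := by
  simpa [boxes, List.flatMap] using length_le_length_flatten (G := ws.map Piece.box)
    (List.forall_mem_map.2 fun x _ => List.length_pos_iff.1 x.odd_length_box.pos)

theorem RevPerm.forall_isDyckWord {us ws : List (Piece α)} (h : RevPerm ws us)
    (hus : ∀ w ∈ us, IsDyckWord w.1) : ∀ w ∈ ws, IsDyckWord w.1 := by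
  intro w hw
  rcases h.mem_or_rev_mem hw with hw | hw
  · exact hus w hw
  · exact w.1.reverse_reverse ▸ (hus w.rev hw).reverse

theorem fillable_of_revPerm {us ws : List (Piece α)} (h : RevPerm us ws) (hn : (flat us).Nodup)
    (hus : ∀ x ∈ us, IsDyckWord x.1) {D : List (List α)}
    (hD : ∀ w ∈ ws, 3 ≤ w.1.length → w.1 ∈ D) : ∀ x ∈ us, Fillable D x := by
  intro x hx
  have hnx : x.1.Nodup := (List.nodup_flatMap.1 hn).1 x hx
  by_cases hlen : x.1.length = 1
  · exact Or.inl hlen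
  have hlen₃ : 3 ≤ x.1.length := by
    have := List.length_pos_iff.2 x.2
    have := (hus x hx).length_ne_two hnx
    omega
  exact Or.inr ⟨Piece.first_ne_last hnx hlen, (h.mem_or_rev_mem hx).imp (hD x · hlen₃)
    (hD x.rev · (by simpa [Piece.rev] using hlen₃))⟩

theorem map_fillCycle_eq {D : List (List α)} (hD : SepEnds D) {cs : List (List (Option α))}
    {G : List (List (Piece α))} (h : List.Forall₂ (fun c g => c ~r boxes g) cs G)
    (hG : ∀ g ∈ G, ∀ x ∈ g, Fillable D x) :
    (cs.map (fillCycle D)).map (fun t : List α => (t : Cycle α)) =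
      G.map fun g => (flat g : Cycle α) := by
  induction h with
  | nil => rfl
  | @cons c g cs G hcg _ ih =>
    obtain ⟨hg, hG⟩ := List.forall_mem_cons.1 hG
    have hfill : (fillCycle D c : Cycle α) = (flat g : Cycle α) :=
      Cycle.coe_eq_coe.2 (fillCycle_boxes hD hg ▸ fillCycle_isRotated D hcg)
    simp only [List.map_cons, hfill, ih hG]

theorem exists_psiCycles_of_isMonotoneCycle {G : List (List (Piece α))}
    (hG : ∀ g ∈ G, IsMonotoneCycle g) (hdyck : ∀ w ∈ G.flatten, IsDyckWord w.1)
    (hn : (flat G.flatten).Nodup) :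
    ∃ w : List α, IsBallotWord w ∧ w.Perm (flat G.flatten) ∧
      ((psiCycles w).map (fun t : List α => (t : Cycle α))).Perm
        (G.map fun g => (flat g : Cycle α)) := by
  obtain ⟨ws, cs, G', hchain, hrev, hperm, hcs, hpsi⟩ :=
    exists_boxPsiAux_eq G hG (visible_nodup hn)
  have hdyck' := hrev.forall_isDyckWord hdyck
  have hn' : (flat ws).Nodup := hrev.flat_perm.nodup_iff.2 hn
  have hlen : G.length ≤ (boxes ws).length :=
    (length_le_length_flatten fun g hg => List.length_pos_iff.1 (hG g hg).1.pos).trans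
      (hrev.length_eq ▸ length_le_length_boxes ws)
  have hmem := fun d => mem_maxDyckWords_flat (d := d) hdyck' hchain
  have hsep : SepEnds (maxDyckWords (flat ws)) := sepEnds_of_nodup hn' fun d hd =>
    let ⟨w, hw, _, hwd⟩ := (hmem d).1 hd
    ⟨w, hw, hwd⟩
  have hfill := fillable_of_revPerm hrev.symm hn hdyck fun w hw hlen =>
    (hmem w.1).2 ⟨w, hw, hlen, rfl⟩
  have hpsiCycles : psiCycles (flat ws) = cs.map (fillCycle (maxDyckWords (flat ws))) := by
    rw [psiCycles, boxWord_flat hdyck' hchain hn', boxPsi, hpsi _ hlen]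
  refine ⟨flat ws, isBallotWord_flat hdyck' hchain, hrev.flat_perm, ?_⟩
  rw [hpsiCycles, map_fillCycle_eq hsep hcs fun g hg x hx =>
    hfill x (List.mem_flatten.2 ⟨g, hperm.subset hg, hx⟩)]
  exact hperm.map _

theorem exists_psiCycles {T : List (List α)} (hodd : ∀ t ∈ T, Odd t.length)
    (hn : T.flatten.Nodup) :
    ∃ w : List α, IsBallotWord w ∧ w.Perm T.flatten ∧
      ((psiCycles w).map (fun t : List α => (t : Cycle α))).Perm
        (T.map fun t : List α => (t : Cycle α)) := by
  choose! f hmono hdyck hrot using fun t (ht : t ∈ T) =>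
    exists_isMonotoneCycle ((List.nodup_flatten.1 hn).1 t ht) (hodd t ht)
  have hperm : (flat (T.map f).flatten).Perm T.flatten := by
    rw [flat_flatten, List.flatMap_map, ← List.flatMap_id]
    exact List.Perm.flatMap_left _ fun t ht => (hrot t ht).perm.symm
  obtain ⟨w, hw, hwT, hpsi⟩ := exists_psiCycles_of_isMonotoneCycle (G := T.map f)
    (List.forall_mem_map.2 hmono) (by simpa using fun a t ht => hdyck t ht a)
    (hperm.nodup_iff.2 hn)
  refine ⟨w, hw, hwT.trans hperm, ?_⟩
  rw [List.map_map] at hpsi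
  rwa [List.map_congr_left fun t ht => Cycle.coe_eq_coe.2 (hrot t ht)]

end Surjective

section Psi

/-- The cycle of one-letter words that stands for a cycle of letters. -/
def letterCycle {α : Type*} : Cycle α → Cycle (List α) := Cycle.map fun a => [a]

theorem exists_letterCycle_eq {α : Type*} {C : Cycle (List α)} (h : ∀ c ∈ C, c.length = 1) :
    ∃ t : List α, letterCycle (t : Cycle α) = C := by
  induction C using Quotient.inductionOn' with | h l =>
  have hl : l ∈ Set.range (List.map fun a : α => [a]) := by
    rw [Set.range_list_map]
    exact fun c hc => (List.length_eq_one_iff.1 (h c hc)).imp fun _ => Eq.symm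
  exact hl.imp fun t ht => congrArg _ ht

theorem bind_letterCycle {α : Type*} (t : List α) :
    ((letterCycle (t : Cycle α)).toMultiset.bind fun c => (c : Multiset α)) = t := by
  change (((t.map fun a => [a] : List (List α)) : Multiset (List α)).bind
    fun c => (c : Multiset α)) = _
  rw [Multiset.coe_bind, List.flatMap_map, List.flatMap_singleton']

theorem exists_perm_ofFn_eq {n : ℕ} {w : List (Fin n)} (hw : w.Perm (List.finRange n)) :
    ∃ π : Equiv.Perm (Fin n), List.ofFn π = w := by
  have hlen : w.length = n := by simpa using hw.length_eq
  have hnodup : w.Nodup := hw.nodup_iff.2 (List.nodup_finRange n)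
  refine ⟨(finCongr hlen.symm).trans (hnodup.getEquivOfForallMemList w fun i =>
    hw.mem_iff.2 (List.mem_finRange i)), ?_⟩
  exact List.ext_getElem (by simp [hlen]) fun i _ _ => by simp

theorem exists_Psi_eq {n : ℕ} (y : OddClusterPerm n)
    (hy : ∀ C ∈ y.cycles, ∀ c ∈ C, c.length = 1) : ∃ π : BallotPerm n, Psi π = y.cycles := by
  choose! f hf using fun C hC => exists_letterCycle_eq (hy C hC)
  obtain ⟨T, hT⟩ : ∃ T : List (List (Fin n)), T = y.cycles.toList.map f := ⟨_, rfl⟩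
  have hcycles : T.map (fun t : List (Fin n) => letterCycle (t : Cycle (Fin n))) =
      y.cycles.toList := by
    rw [hT, List.map_map]
    exact (List.map_congr_left fun C hC => hf C (Finset.mem_toList.1 hC)).trans (List.map_id _)
  have hodd : ∀ t ∈ T, Odd t.length := by
    rw [hT]
    refine List.forall_mem_map.2 fun C hC => ?_
    have hC := Finset.mem_toList.1 hC
    have hlen : C.length = (f C).length :=
      (congrArg Cycle.length (hf C hC)).symm.trans (List.length_map _)
    exact hlen ▸ y.odd_length C hC
  have hperm : T.flatten.Perm (List.finRange n) := by
    have hflatten : T.flatten = y.cycles.toList.flatMap f := by rw [hT]; rfl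
    rw [← Multiset.coe_eq_coe, hflatten, ← Multiset.coe_bind, Finset.coe_toList]
    refine Eq.trans (Multiset.bind_congr fun C hC => ?_) y.letters
    rw [← bind_letterCycle, hf C hC]
  obtain ⟨w, hw, hwT, hpsi⟩ := exists_psiCycles hodd (hperm.nodup_iff.2 (List.nodup_finRange n))
  obtain ⟨π, rfl⟩ := exists_perm_ofFn_eq (hwT.trans hperm)
  refine ⟨⟨π, hw⟩, ?_⟩
  have hletters := hpsi.map letterCycle
  rw [List.map_map, List.map_map] at hletters
  exact (List.toFinset_eq_of_perm _ _ hletters).trans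
    ((congrArg List.toFinset hcycles).trans y.cycles.toList_toFinset)

end Psi

section Numbers

open scoped Nat

/-- The number of permutations of `n` letters all of whose cycles are odd: the cycle of the last
letter is trivial, or two of the other letters can be contracted in it. -/
def oddCount : ℕ → ℕ
  | 0 => 1
  | 1 => 1
  | n + 2 => oddCount (n + 1) + (n + 1) * n * oddCount n

theorem sum_even_choose_oddCount (n : ℕ) :
    ∑ j ∈ Finset.range (n + 1), (if Even j then n.choose j * j ! * oddCount (n - j) else 0) =
      oddCount (n + 1) := by
  induction n using Nat.twoStepInduction with
  | zero => simp [oddCount]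
  | one => simp [Finset.sum_range_succ, oddCount]
  | more n ih _ =>
    have hterm : ∀ j, (if Even (j + 1 + 1) then
        (n + 2).choose (j + 1 + 1) * (j + 1 + 1)! * oddCount (n + 2 - (j + 1 + 1)) else 0) =
        (n + 2) * (n + 1) * (if Even j then n.choose j * j ! * oddCount (n - j) else 0) := by
      intro j
      have hdesc := Nat.descFactorial_eq_factorial_mul_choose (n + 2) (j + 1 + 1)
      rw [Nat.succ_descFactorial_succ, Nat.succ_descFactorial_succ,
        Nat.descFactorial_eq_factorial_mul_choose n j] at hdesc
      have heven : Even (j + 1 + 1) ↔ Even j := by simp [Nat.even_add_one]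
      simp only [heven, mul_ite, mul_zero, Nat.reduceSubDiff]
      rw [mul_comm ((n + 2).choose _), ← hdesc]
      ring_nf
    rw [Finset.sum_range_succ', Finset.sum_range_succ', Finset.sum_congr rfl fun j _ => hterm j,
      ← Finset.mul_sum, ih]
    simp only [zero_add, Nat.not_even_one, ↓reduceIte, add_zero, Even.zero, Nat.choose_zero_right,
      Nat.factorial_zero, mul_one, one_mul, tsub_zero, oddCount]
    ring

open PowerSeries

/-- The exponential generating function of `oddCount`. -/
noncomputable def oddSeries : ℚ⟦X⟧ := mk fun n => (oddCount n : ℚ) / n !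

theorem coeff_oddSeries (n : ℕ) : coeff n oddSeries = (oddCount n : ℚ) / n ! := coeff_mk _ _

theorem constantCoeff_oddSeries : constantCoeff oddSeries = 1 := by
  simpa [oddCount] using coeff_oddSeries 0

theorem coeff_derivative_oddSeries (n : ℕ) :
    coeff n (d⁄dX ℚ oddSeries) = (oddCount (n + 1) : ℚ) / n ! := by
  rw [coeff_derivative, coeff_oddSeries, Nat.factorial_succ]
  push_cast
  field_simp

theorem one_sub_sq_mul_derivative_oddSeries :
    (1 - X ^ 2) * d⁄dX ℚ oddSeries = oddSeries := by
  ext n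
  rw [sub_mul, one_mul, map_sub, coeff_X_pow_mul', coeff_derivative_oddSeries, coeff_oddSeries]
  rcases n with _ | _ | n
  · simp [oddCount]
  · simp [oddCount]
  · rw [if_pos (Nat.le_add_left 2 n), show n + 1 + 1 - 2 = n by rfl, coeff_derivative_oddSeries,
      oddCount, Nat.factorial_succ, Nat.factorial_succ]
    push_cast
    field_simp
    ring

theorem eq_one_add_X_of_derivative {F : ℚ⟦X⟧} (h : (1 + X) * d⁄dX ℚ F = F)
    (h₀ : constantCoeff F = 1) : F = 1 + X := by
  have hrec : ∀ n : ℕ, coeff (n + 2) F * (n + 2) = -(n * coeff (n + 1) F) := by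
    intro n
    have := congrArg (coeff (n + 1)) h
    rw [add_mul, one_mul, map_add, coeff_succ_X_mul, coeff_derivative, coeff_derivative] at this
    push_cast at this
    linear_combination this
  have h₁ : coeff 1 F = 1 := by
    have := congrArg constantCoeff h
    rw [map_mul, h₀, map_add, constantCoeff_X, map_one, add_zero, one_mul] at this
    simpa [this] using (coeff_derivative F 0).symm
  have h₂ : ∀ n, coeff (n + 2) F = 0 := by
    have hne : ∀ n : ℕ, (n : ℚ) + 2 ≠ 0 := fun n => by positivity
    intro n
    induction n with
    | zero => simpa using hrec 0
    | succ n ih =>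
      refine (mul_eq_zero.1 ((hrec (n + 1)).trans ?_)).resolve_right (hne _)
      rw [ih, mul_zero, neg_zero]
  ext n
  rcases n with _ | _ | n
  · simpa using h₀
  · simpa using h₁
  · simp [h₂, coeff_X, coeff_one]

theorem one_sub_X_mul_oddSeries_sq : (1 - X) * oddSeries ^ 2 = 1 + X := by
  refine eq_one_add_X_of_derivative ?_ ?_
  · have hX : d⁄dX ℚ (1 - X : ℚ⟦X⟧) = -1 := by
      rw [map_sub, Derivation.map_one_eq_zero, derivative_X, zero_sub]
    rw [Derivation.leibniz, hX, Derivation.leibniz_pow]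
    simp only [smul_eq_mul, Nat.add_one_sub_one, pow_one, nsmul_eq_mul, Nat.cast_ofNat]
    linear_combination (2 * oddSeries) * one_sub_sq_mul_derivative_oddSeries
  · simp [constantCoeff_oddSeries]

theorem coeff_oddSeries_sq (n : ℕ) : coeff (n + 1) (oddSeries ^ 2) = 2 := by
  have hstep : ∀ m, coeff (m + 1) (oddSeries ^ 2) - coeff m (oddSeries ^ 2) =
      coeff (m + 1) (1 + X : ℚ⟦X⟧) := fun m => by
    rw [← one_sub_X_mul_oddSeries_sq, sub_mul, one_mul, map_sub, coeff_succ_X_mul]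
  induction n with
  | zero =>
    have h₀ : coeff 0 (oddSeries ^ 2) = 1 := by simp [constantCoeff_oddSeries]
    have := hstep 0
    rw [h₀] at this
    simp only [zero_add, map_add, coeff_one, one_ne_zero, ↓reduceIte, coeff_one_X] at this
    linarith
  | succ n ih =>
    have := hstep (n + 1)
    simp only [map_add, coeff_one, coeff_X] at this
    simpa [ih, sub_eq_zero] using this

theorem sum_choose_oddCount {k : ℕ} (hk : k ≠ 0) :
    ∑ j ∈ Finset.range (k + 1), k.choose j * (oddCount j * oddCount (k - j)) = 2 * k ! := by
  obtain ⟨k, rfl⟩ := Nat.exists_eq_succ_of_ne_zero hk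
  have hterm : ∀ j ∈ Finset.range (k + 1 + 1),
      (((k + 1).choose j * (oddCount j * oddCount (k + 1 - j)) : ℕ) : ℚ) =
        coeff j oddSeries * coeff (k + 1 - j) oddSeries * (k + 1)! := by
    intro j hj
    rw [← Nat.choose_mul_factorial_mul_factorial (Finset.mem_range_succ_iff.1 hj),
      coeff_oddSeries, coeff_oddSeries]
    push_cast
    field_simp
  have hsum := coeff_oddSeries_sq k
  rw [sq, coeff_mul, Finset.Nat.sum_antidiagonal_eq_sum_range_succ_mk] at hsum
  rw [← @Nat.cast_inj ℚ, Nat.cast_sum, Finset.sum_congr rfl hterm, ← Finset.sum_mul, hsum]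
  push_cast
  rfl

end Numbers

section Structures

variable {A B Q : Type*}

/-- The elements `a` of `A` with `f a = K`, where the multiset `f a` consists of the classes of the
parts of `a`: each class in `K` is that of one part, and there are no other parts. -/
abbrev StructuresOn (f : A → Multiset Q) (K : Finset Q) : Type _ := {a // f a = K.val}

variable [DecidableEq Q]

/-- A pair uses some of the classes in its first component, the remaining ones in the second. -/
def StructuresOn.prodEquiv (f : A → Multiset Q) (g : B → Multiset Q) (K : Finset Q) :
    StructuresOn (fun p : A × B => f p.1 + g p.2) K ≃
      Σ J : K.powerset, StructuresOn f J.1 × StructuresOn g (K \ J.1) where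
  toFun p :=
    have hle : f p.1.1 ≤ K.val := (Multiset.le_add_right _ _).trans_eq p.2
    ⟨⟨⟨f p.1.1, Multiset.nodup_of_le hle K.nodup⟩, Finset.mem_powerset.2 (Finset.val_le_iff.1 hle)⟩,
      ⟨p.1.1, rfl⟩, p.1.2, by
        rw [Finset.sdiff_val]
        exact eq_tsub_of_add_eq ((add_comm _ _).trans p.2)⟩
  invFun q := ⟨(q.2.1.1, q.2.2.1), by
    change f q.2.1.1 + g q.2.2.1 = K.val
    rw [q.2.1.2, q.2.2.2, Finset.sdiff_val,
      add_tsub_cancel_of_le (Finset.val_le_iff.2 (Finset.mem_powerset.1 q.1.2))]⟩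
  left_inv _ := rfl
  right_inv := by
    rintro ⟨⟨⟨J, hJ⟩, hJK⟩, ⟨a, ha⟩, b, hb⟩
    obtain rfl : J = f a := ha.symm
    rfl

theorem card_structuresOn_prod (f : A → Multiset Q) (g : B → Multiset Q) (K : Finset Q)
    (hf : ∀ J ⊆ K, Finite (StructuresOn f J)) (hg : ∀ J ⊆ K, Finite (StructuresOn g J)) :
    Finite (StructuresOn (fun p : A × B => f p.1 + g p.2) K) ∧
      Nat.card (StructuresOn (fun p : A × B => f p.1 + g p.2) K) =
        ∑ J ∈ K.powerset, Nat.card (StructuresOn f J) * Nat.card (StructuresOn g (K \ J)) := by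
  have (J : K.powerset) : Finite (StructuresOn f J.1 × StructuresOn g (K \ J.1)) := by
    have := hf J.1 (Finset.mem_powerset.1 J.2)
    have := hg (K \ J.1) Finset.sdiff_subset
    infer_instance
  refine ⟨Finite.of_equiv _ (StructuresOn.prodEquiv f g K).symm, ?_⟩
  rw [Nat.card_congr (StructuresOn.prodEquiv f g K), Nat.card_sigma,
    Finset.sum_congr rfl fun J _ => Nat.card_prod _ _]
  exact Finset.sum_coe_sort K.powerset
    fun J => Nat.card (StructuresOn f J) * Nat.card (StructuresOn g (K \ J))

end Structures

section Arrangements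

open scoped Nat

variable {X Q : Type*} (cls : X → Q)

/-- The classes of the members of a sequence, with multiplicities. -/
def classesOf (ws : List X) : Multiset Q := (ws.map cls : List Q)

/-- The number of ways to choose one object of each class in `K`. -/
noncomputable def numTransversals (K : Finset Q) : ℕ := ∏ q ∈ K, Nat.card {x // cls x = q}

variable {cls}

theorem classesOf_cons (x : X) (ws : List X) :
    classesOf cls (x :: ws) = cls x ::ₘ classesOf cls ws := rfl

theorem card_classesOf (ws : List X) : (classesOf cls ws).card = ws.length := by
  simp [classesOf]

theorem structuresOn_classesOf_empty_eq (ws : StructuresOn (classesOf cls) ∅) : ws.1 = [] := by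
  rw [← List.length_eq_zero_iff, ← card_classesOf (cls := cls), ws.2]
  rfl

variable [DecidableEq Q]

theorem numTransversals_mul_sdiff {J K : Finset Q} (h : J ⊆ K) :
    numTransversals cls J * numTransversals cls (K \ J) = numTransversals cls K := by
  rw [mul_comm]
  exact Finset.prod_sdiff h

theorem card_mul_numTransversals_erase {K : Finset Q} {q : Q} (hq : q ∈ K) :
    Nat.card {x // cls x = q} * numTransversals cls (K.erase q) = numTransversals cls K :=
  Finset.mul_prod_erase K (fun q => Nat.card {x // cls x = q}) hq

theorem bijective_cons_arrangement {K : Finset Q} (hK : K.Nonempty) :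
    Function.Bijective fun p : Σ q : K, {x // cls x = q} ×
        StructuresOn (classesOf cls) (K.erase q) =>
      (⟨p.2.1.1 :: p.2.2.1, by
        rw [classesOf_cons, p.2.2.2, p.2.1.2, Finset.erase_val, Multiset.cons_erase p.1.2]⟩ :
        StructuresOn (classesOf cls) K) := by
  constructor
  · rintro ⟨⟨q, hq⟩, ⟨x, hx⟩, t, ht⟩ ⟨⟨q', hq'⟩, ⟨x', hx'⟩, t', ht'⟩ h
    obtain ⟨rfl, rfl⟩ := List.cons.inj (Subtype.ext_iff.1 h)
    obtain rfl : cls x = q := hx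
    obtain rfl : cls x = q' := hx'
    rfl
  · rintro ⟨_ | ⟨x, t⟩, h⟩
    · exact absurd (Finset.val_eq_zero.1 h.symm) hK.ne_empty
    · rw [classesOf_cons] at h
      have hx : cls x ∈ K.val := h ▸ Multiset.mem_cons_self _ _
      refine ⟨⟨⟨cls x, hx⟩, ⟨x, rfl⟩, t, ?_⟩, rfl⟩
      rw [Finset.erase_val, ← h, Multiset.erase_cons_head]

omit [DecidableEq Q] in
theorem card_arrangements [∀ q, Finite {x // cls x = q}] (K : Finset Q) :
    Finite (StructuresOn (classesOf cls) K) ∧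
      Nat.card (StructuresOn (classesOf cls) K) = K.card ! * numTransversals cls K := by
  classical
  induction hn : K.card generalizing K with
  | zero =>
    obtain rfl := Finset.card_eq_zero.1 hn
    have : Unique (StructuresOn (classesOf cls) (∅ : Finset Q)) :=
      ⟨⟨⟨[], rfl⟩⟩, fun ws => Subtype.ext (structuresOn_classesOf_empty_eq ws)⟩
    exact ⟨inferInstance, by simp [numTransversals]⟩
  | succ n ih =>
    have hcard (q : K) : (K.erase q.1).card = n := by
      rw [Finset.card_erase_of_mem q.2, hn, Nat.add_sub_cancel]
    have (q : K) : Finite (StructuresOn (classesOf cls) (K.erase q.1)) := (ih _ (hcard q)).1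
    have e := Equiv.ofBijective _
      (bijective_cons_arrangement (cls := cls) (Finset.card_pos.1 (n.succ_pos.trans_eq hn.symm)))
    refine ⟨Finite.of_equiv _ e, ?_⟩
    have hterm (q : K) : Nat.card ({x // cls x = q.1} ×
        StructuresOn (classesOf cls) (K.erase q.1)) = n ! * numTransversals cls K := by
      rw [Nat.card_prod, (ih _ (hcard q)).2, ← card_mul_numTransversals_erase q.2]
      ring
    rw [← Nat.card_congr e, Nat.card_sigma, Finset.sum_congr rfl fun q _ => hterm q,
      Finset.sum_const, Finset.card_univ, Fintype.card_coe, hn, Nat.factorial_succ, smul_eq_mul,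
      mul_assoc]

end Arrangements

section FirstMinimum

variable {X : Type*}

/-- The sequence `A ++ R` attains its minimal height for the first time at the head of `R`. -/
def IsFirstMinSplit (r : X → X → ℤ) (A R : List X) : Prop :=
  Ballot r R ∧ ∃ x ∈ R.head?, ∀ u, u <:+ A → u ≠ [] → totalRise r (u ++ [x]) < 0

variable {r : X → X → ℤ}

theorem IsFirstMinSplit.ballot_cons_append {A R : List X} {y : X} (h : IsFirstMinSplit r A R)
    (hy : ∀ x ∈ R.head?, 0 ≤ totalRise r (y :: A ++ [x])) : Ballot r (y :: A ++ R) := by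
  obtain ⟨hR, x, hx, hA⟩ := h
  obtain ⟨R, rfl⟩ := List.head?_eq_some_iff.1 hx
  have hyx := hy x hx
  intro p hp
  rcases prefix_append_cases hp with ⟨s, hs⟩ | ⟨q, hq₀, hq, rfl⟩
  · rcases p.eq_nil_or_concat with rfl | ⟨p, z, rfl⟩
    · rfl
    rcases p with _ | ⟨y', p⟩
    · rfl
    have hsuffix : z :: s <:+ A := ⟨p, by
      simp only [List.concat_eq_append, List.cons_append, List.append_assoc, List.cons.injEq,
        List.nil_append] at hs
      exact hs.2⟩
    have hz := hA _ hsuffix (List.cons_ne_nil z s)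
    have hsplit : y :: A ++ [x] = y' :: p ++ z :: (s ++ [x]) := by simp [← hs]
    rw [hsplit, totalRise_append_cons] at hyx
    rw [List.cons_append] at hz
    rw [List.concat_eq_append]
    linarith
  · obtain ⟨q, rfl, -⟩ := (List.prefix_cons_iff.1 hq).resolve_left hq₀
    rw [totalRise_append_cons]
    exact add_nonneg hyx (hR _ hq)

theorem exists_isFirstMinSplit {ws : List X} (hws : ws ≠ []) :
    ∃ A R, A ++ R = ws ∧ IsFirstMinSplit r A R := by
  induction ws with
  | nil => exact absurd rfl hws
  | cons y ws ih =>
    have hnil : ∀ {R : List X}, Ballot r (y :: R) → IsFirstMinSplit r [] (y :: R) := fun h =>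
      ⟨h, y, rfl, fun u hu hne => absurd (List.suffix_nil.1 hu) hne⟩
    rcases eq_or_ne ws [] with rfl | hne
    · exact ⟨[], [y], rfl, hnil (ballot_singleton r y)⟩
    obtain ⟨A, R, rfl, h⟩ := ih hne
    by_cases hy : ∀ x ∈ R.head?, 0 ≤ totalRise r (y :: A ++ [x])
    · exact ⟨[], _, rfl, hnil (h.ballot_cons_append hy)⟩
    · push Not at hy
      obtain ⟨x, hx, hy⟩ := hy
      obtain ⟨hR, x', hx', hA⟩ := h
      obtain rfl := Option.mem_unique hx hx'
      refine ⟨y :: A, R, rfl, hR, x, hx, fun u hu hne => ?_⟩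
      rcases List.suffix_cons_iff.1 hu with rfl | hu
      · exact hy
      · exact hA u hu hne

theorem IsFirstMinSplit.eq_nil {A B R' : List X} (h : IsFirstMinSplit r A (B ++ R'))
    (h' : IsFirstMinSplit r (A ++ B) R') : B = [] := by
  obtain ⟨-, x, hx, hB⟩ := h'
  obtain ⟨R', rfl⟩ := List.head?_eq_some_iff.1 hx
  by_contra hne
  have hlt := hB B (List.suffix_append A B) hne
  exact hlt.not_ge (h.1 _ ⟨R', by simp⟩)

theorem IsFirstMinSplit.unique {A R A' R' : List X} (h : IsFirstMinSplit r A R)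
    (h' : IsFirstMinSplit r A' R') (heq : A ++ R = A' ++ R') : A = A' ∧ R = R' := by
  rcases List.append_eq_append_iff.1 heq with ⟨B, rfl, rfl⟩ | ⟨B, rfl, rfl⟩
  · obtain rfl := h.eq_nil h'
    simp
  · obtain rfl := h'.eq_nil h
    simp

end FirstMinimum

section BallotCount

open scoped Nat

variable {X : Type*} (r : X → X → ℤ) (rev : X → X)

/-- Reversal negates the height difference of any two objects that belong to different classes
of `K`. -/
def NegatedByRev (K : Finset (Unoriented rev)) : Prop := ∀ x y, unorient rev x ∈ K →
  unorient rev y ∈ K → unorient rev x ≠ unorient rev y → r (rev y) (rev x) = -r x y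

/-- Ballot sequences. -/
abbrev BallotSeq : Type _ := {ws : List X // Ballot r ws}

/-- The ballot sequences which contain each class in `K` once. -/
abbrev BallotArrangements (K : Finset (Unoriented rev)) : Type _ :=
  StructuresOn (fun ws : BallotSeq r => classesOf (unorient rev) ws.1) K

/-- The pairs of ballot sequences which together contain each class in `K` once. -/
abbrev BallotPairs (K : Finset (Unoriented rev)) : Type _ :=
  StructuresOn (fun p : BallotSeq r × BallotSeq r =>
    classesOf (unorient rev) p.1.1 + classesOf (unorient rev) p.2.1) K

/-- There is a descent, or nothing, before `R` in the concatenation of the reversal of `L`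
and `R`. -/
def JoinsDown (L R : List X) : Prop := ∃ x ∈ R.head?, ∀ y ∈ L.head?, r (rev y) x < 0

variable {r rev}

theorem classesOf_append {Q : Type*} {cls : X → Q} (us ws : List X) :
    classesOf cls (us ++ ws) = classesOf cls us + classesOf cls ws := by
  simp [classesOf]

theorem classesOf_reverse_map (ws : List X) :
    classesOf (unorient rev) (ws.map rev).reverse = classesOf (unorient rev) ws := by
  simp [classesOf, Function.comp_def, unorient_rev]

theorem mem_classesOf {Q : Type*} {cls : X → Q} {ws : List X} {x : X} (h : x ∈ ws) :
    cls x ∈ classesOf cls ws :=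
  Multiset.mem_coe.2 (List.mem_map_of_mem h)

theorem reverse_map_reverse_map (hrev : Function.Involutive rev) (ws : List X) :
    ((ws.map rev).reverse.map rev).reverse = ws := by
  simp [hrev.comp_self]

theorem NegatedByRev.isChain {K : Finset (Unoriented rev)} (hK : NegatedByRev r rev K)
    {ws : List X} (h : classesOf (unorient rev) ws ≤ K.val) :
    ws.IsChain fun x y => r (rev y) (rev x) = -r x y := by
  have hmem : ∀ x ∈ ws, unorient rev x ∈ K := fun x hx => Multiset.mem_of_le h (mem_classesOf hx)
  have hnodup : (ws.map (unorient rev)).Nodup := Multiset.nodup_of_le h K.nodup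
  rw [List.Nodup, List.pairwise_map] at hnodup
  exact (hnodup.imp_of_mem fun hx hy => hK _ _ (hmem _ hx) (hmem _ hy)).isChain

theorem isFirstMinSplit_reverse_map_iff (hr : ∀ x y, r x y = 1 ∨ r x y = -1)
    {L R : List X} (hL : L.IsChain fun x y => r (rev y) (rev x) = -r x y) (hR : Ballot r R) :
    IsFirstMinSplit r (L.map rev).reverse R ↔ Ballot r L ∧ JoinsDown r rev L R := by
  have hrise : ∀ {y : X} {p : List X} (x : X), y :: p <+: L →
      totalRise r (((y :: p).map rev).reverse ++ [x]) =
        r (rev y) x - totalRise r (y :: p) := by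
    intro y p x hp
    rw [totalRise_append r (by simp) (by simp), totalRise_reverse_map (hL.prefix hp)]
    simp
    ring
  have hsuffix : ∀ u, u <:+ (L.map rev).reverse ↔ ∃ p, p <+: L ∧ (p.map rev).reverse = u := by
    intro u
    rw [← List.reverse_prefix, List.reverse_reverse, List.prefix_map_iff]
    exact exists_congr fun p => and_congr_right fun _ => eq_comm.trans List.reverse_eq_iff.symm
  constructor
  · rintro ⟨-, x, hx, h⟩
    have h : ∀ y p, y :: p <+: L → r (rev y) x - totalRise r (y :: p) < 0 := fun y p hp =>
      hrise x hp ▸ h _ ((hsuffix _).2 ⟨_, hp, rfl⟩) (by simp)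
    refine ⟨fun p hp => ?_, x, hx, fun y hy => ?_⟩
    · rcases p with _ | ⟨y, p⟩
      · rfl
      · have := h y p hp
        rcases hr (rev y) x with hy | hy <;> omega
    · obtain ⟨L, rfl⟩ := List.head?_eq_some_iff.1 hy
      simpa using h y [] ⟨L, rfl⟩
  · rintro ⟨hL, x, hx, hxL⟩
    refine ⟨hR, x, hx, fun u hu hne => ?_⟩
    obtain ⟨_ | ⟨y, p⟩, hp, rfl⟩ := (hsuffix u).1 hu
    · exact absurd rfl hne
    · have hy : y ∈ L.head? := by
        obtain ⟨t, rfl⟩ := hp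
        rfl
      rw [hrise x hp]
      linarith [hL _ hp, hxL y hy]

theorem bijective_joinsDown (hr : ∀ x y, r x y = 1 ∨ r x y = -1)
    (hrev : Function.Involutive rev) {K : Finset (Unoriented rev)} (hK : NegatedByRev r rev K)
    (hne : K.Nonempty) :
    Function.Bijective fun p : {p : BallotPairs r rev K // JoinsDown r rev p.1.1.1 p.1.2.1} =>
      (⟨(p.1.1.1.1.map rev).reverse ++ p.1.1.2.1, by
        rw [classesOf_append, classesOf_reverse_map]
        exact p.1.2⟩ : StructuresOn (classesOf (unorient rev)) K) := by
  have hchain : ∀ {L R : List X}, classesOf (unorient rev) L + classesOf (unorient rev) R = K.val →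
      L.IsChain fun x y => r (rev y) (rev x) = -r x y := fun h =>
    hK.isChain ((Multiset.le_add_right _ _).trans_eq h)
  constructor
  · rintro ⟨⟨⟨⟨L, hL⟩, R, hR⟩, hLR⟩, hj⟩ ⟨⟨⟨⟨L', hL'⟩, R', hR'⟩, hLR'⟩, hj'⟩ h
    obtain ⟨hLL', rfl⟩ :=
      ((isFirstMinSplit_reverse_map_iff hr (hchain hLR) hR).2 ⟨hL, hj⟩).unique
        ((isFirstMinSplit_reverse_map_iff hr (hchain hLR') hR').2 ⟨hL', hj'⟩) (Subtype.ext_iff.1 h)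
    obtain rfl : L = L' := List.map_injective_iff.2 hrev.injective (List.reverse_injective hLL')
    rfl
  · rintro ⟨ws, hws⟩
    have hws₀ : ws ≠ [] := by
      rintro rfl
      exact hne.ne_empty (Finset.val_eq_zero.1 hws.symm)
    obtain ⟨A, R, rfl, hAR⟩ := exists_isFirstMinSplit (r := r) hws₀
    have hA := reverse_map_reverse_map hrev A
    have hLR : classesOf (unorient rev) (A.map rev).reverse + classesOf (unorient rev) R =
        K.val := by
      rw [classesOf_reverse_map, ← classesOf_append, hws]
    obtain ⟨hL, hj⟩ := (isFirstMinSplit_reverse_map_iff hr (hchain hLR) hAR.1).1 (hA.symm ▸ hAR)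
    exact ⟨⟨⟨(⟨_, hL⟩, ⟨R, hAR.1⟩), hLR⟩, hj⟩, Subtype.ext (congrArg (· ++ R) hA)⟩

theorem joinsDown_swap_iff (hr : ∀ x y, r x y = 1 ∨ r x y = -1)
    (hrev : Function.Involutive rev) {K : Finset (Unoriented rev)} (hK : NegatedByRev r rev K)
    (hne : K.Nonempty) {L R : List X}
    (h : classesOf (unorient rev) L + classesOf (unorient rev) R = K.val) :
    JoinsDown r rev R L ↔ ¬JoinsDown r rev L R := by
  rcases L with _ | ⟨x, L⟩ <;> rcases R with _ | ⟨y, R⟩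
  · exact absurd (Finset.val_eq_zero.1 h.symm) hne.ne_empty
  · simp [JoinsDown]
  · simp [JoinsDown]
  · have hx : unorient rev x ∈ K.val := h ▸ Multiset.mem_add.2 (Or.inl (mem_classesOf (by simp)))
    have hy : unorient rev y ∈ K.val := h ▸ Multiset.mem_add.2 (Or.inr (mem_classesOf (by simp)))
    have hxy : unorient rev x ≠ unorient rev y := fun hxy =>
      Multiset.disjoint_left.1 (Multiset.nodup_add.1 (h ▸ K.nodup)).2.2
        (mem_classesOf (List.mem_cons_self ..)) (hxy ▸ mem_classesOf (List.mem_cons_self ..))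
    have hneg : r (rev y) x = -r (rev x) y := by
      simpa [hrev x] using hK (rev x) y (by rwa [unorient_rev]) hy (by rwa [unorient_rev])
    rcases hr (rev x) y with h | h <;> simp [JoinsDown, hneg, h]

theorem card_ballotPairs (hr : ∀ x y, r x y = 1 ∨ r x y = -1) (hrev : Function.Involutive rev)
    {K : Finset (Unoriented rev)} (hK : NegatedByRev r rev K) (hne : K.Nonempty)
    [Finite (StructuresOn (classesOf (unorient rev)) K)] :
    Nat.card (BallotPairs r rev K) =
      2 * Nat.card (StructuresOn (classesOf (unorient rev)) K) := by
  classical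
  have ejoin := Equiv.ofBijective _ (bijective_joinsDown hr hrev hK hne)
  let eswap : BallotPairs r rev K ≃ BallotPairs r rev K :=
    (Equiv.prodComm _ _).subtypeEquiv fun p => Eq.congr_left (add_comm _ _)
  have eneg : {p : BallotPairs r rev K // ¬JoinsDown r rev p.1.1.1 p.1.2.1} ≃
      {p : BallotPairs r rev K // JoinsDown r rev p.1.1.1 p.1.2.1} :=
    eswap.subtypeEquiv fun p => (joinsDown_swap_iff hr hrev hK hne p.2).symm
  rw [Nat.card_congr ((Equiv.sumCompl fun p : BallotPairs r rev K =>
    JoinsDown r rev p.1.1.1 p.1.2.1).symm.trans (ejoin.sumCongr (eneg.trans ejoin))),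
    Nat.card_sum, two_mul]

theorem eq_of_sum_powerset_mul_eq {Q : Type*} [DecidableEq Q] {F G : Finset Q → ℕ}
    (hF : F ∅ = 1) (hG : G ∅ = 1) {K : Finset Q}
    (h : ∀ J ⊆ K, J.Nonempty →
      ∑ I ∈ J.powerset, F I * F (J \ I) = ∑ I ∈ J.powerset, G I * G (J \ I)) : F K = G K := by
  induction K using Finset.strongInduction with
  | H K ih =>
    rcases K.eq_empty_or_nonempty with rfl | hne
    · rw [hF, hG]
    have heq : ∀ J ⊂ K, F J = G J := fun J hJ =>
      ih J hJ fun I hI => h I (hI.trans hJ.1)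
    have hrest : ∑ I ∈ K.ssubsets.erase ∅, F I * F (K \ I) =
        ∑ I ∈ K.ssubsets.erase ∅, G I * G (K \ I) := by
      refine Finset.sum_congr rfl fun I hI => ?_
      obtain ⟨hI₀, hI⟩ := Finset.mem_erase.1 hI
      rw [Finset.mem_ssubsets] at hI
      rw [heq I hI, heq _ (Finset.sdiff_ssubset hI.1 (Finset.nonempty_iff_ne_empty.2 hI₀))]
    have hsum := h K subset_rfl hne
    have hmem : (∅ : Finset Q) ∈ K.ssubsets := Finset.empty_mem_ssubsets hne
    rw [← Finset.add_sum_erase _ _ (Finset.mem_powerset_self K),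
      ← Finset.add_sum_erase _ _ (Finset.mem_powerset_self K)] at hsum
    change _ + ∑ I ∈ K.ssubsets, _ = _ + ∑ I ∈ K.ssubsets, _ at hsum
    rw [← Finset.add_sum_erase _ _ hmem, ← Finset.add_sum_erase _ _ hmem, hrest] at hsum
    simp only [Finset.sdiff_self, Finset.sdiff_empty, hF, hG] at hsum
    omega

theorem sum_numTransversals_mul_oddCount {Q : Type*} [DecidableEq Q] {cls : X → Q} {K : Finset Q}
    (hne : K.Nonempty) :
    ∑ J ∈ K.powerset, numTransversals cls J * oddCount J.card *
      (numTransversals cls (K \ J) * oddCount (K \ J).card) =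
        2 * (K.card ! * numTransversals cls K) := by
  have hterm : ∀ J ∈ K.powerset, numTransversals cls J * oddCount J.card *
      (numTransversals cls (K \ J) * oddCount (K \ J).card) =
        numTransversals cls K * (oddCount J.card * oddCount (K.card - J.card)) := by
    intro J hJ
    have hJ := Finset.mem_powerset.1 hJ
    rw [← numTransversals_mul_sdiff hJ, Finset.card_sdiff_of_subset hJ]
    ring
  rw [Finset.sum_congr rfl hterm, ← Finset.mul_sum,
    Finset.sum_powerset_apply_card fun j => oddCount j * oddCount (K.card - j)]
  simp only [smul_eq_mul]
  rw [sum_choose_oddCount (Finset.card_ne_zero.2 hne)]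
  ring

theorem finite_unorient_fiber (hrev : Function.Involutive rev) (q : Unoriented rev) :
    Finite {x // unorient rev x = q} := by
  induction q using Quot.inductionOn with | h y =>
  exact ((Set.finite_singleton (rev y)).insert y).subset fun x hx =>
    (unorient_eq_iff hrev).1 hx

theorem finite_ballotArrangements (hrev : Function.Involutive rev) (K : Finset (Unoriented rev)) :
    Finite (BallotArrangements r rev K) :=
  have := finite_unorient_fiber hrev
  have := (card_arrangements (cls := unorient rev) K).1
  Finite.of_injective (β := StructuresOn (classesOf (unorient rev)) K) (fun ws => ⟨ws.1.1, ws.2⟩)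
    fun _ _ h => Subtype.ext (Subtype.ext (Subtype.mk.inj h))

theorem card_ballotArrangements (hr : ∀ x y, r x y = 1 ∨ r x y = -1)
    (hrev : Function.Involutive rev) {K : Finset (Unoriented rev)} (hK : NegatedByRev r rev K) :
    Nat.card (BallotArrangements r rev K) =
      numTransversals (unorient rev) K * oddCount K.card := by
  classical
  have := finite_unorient_fiber hrev
  refine eq_of_sum_powerset_mul_eq
    (F := fun K => Nat.card (BallotArrangements r rev K))
    (G := fun K => numTransversals (unorient rev) K * oddCount K.card) ?_ ?_ fun J hJ hne => ?_
  · have : Unique (BallotArrangements r rev ∅) :=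
      ⟨⟨⟨⟨[], fun u hu => by rw [List.prefix_nil.1 hu]; rfl⟩, rfl⟩⟩, fun ws =>
        Subtype.ext (Subtype.ext (structuresOn_classesOf_empty_eq ⟨ws.1.1, ws.2⟩))⟩
    exact Nat.card_unique
  · simp [numTransversals, oddCount]
  · have hJ : NegatedByRev r rev J := fun x y hx hy => hK x y (hJ hx) (hJ hy)
    obtain ⟨_, harr⟩ := card_arrangements (cls := unorient rev) J
    have hpairs := card_ballotPairs hr hrev hJ hne
    rw [(card_structuresOn_prod _ _ J (fun I _ => finite_ballotArrangements hrev I)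
      fun I _ => finite_ballotArrangements hrev I).2, harr] at hpairs
    rw [hpairs, sum_numTransversals_mul_oddCount hne]

end BallotCount

section OddSets

open scoped Nat

variable {X Q : Type*}

/-- The sets of cycles of odd length. -/
abbrev OddCycleSet (X : Type*) : Type _ := {s : Finset (Cycle X) // ∀ C ∈ s, Odd C.length}

/-- The lists of even length: what is left of an odd cycle when one of its members is removed. -/
abbrev EvenList (X : Type*) : Type _ := {l : List X // Even l.length}

/-- The classes of the members of a family of cycles, with multiplicities. -/
def cycleClasses (cls : X → Q) (s : Multiset (Cycle X)) : Multiset Q :=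
  s.bind fun C => C.toMultiset.map cls

variable {cls : X → Q}

theorem cycleClasses_cons (C : Cycle X) (s : Multiset (Cycle X)) :
    cycleClasses cls (C ::ₘ s) = C.toMultiset.map cls + cycleClasses cls s :=
  Multiset.cons_bind _ _ _

theorem cycleClasses_cons_coe_cons (x : X) (l : List X) (s : Multiset (Cycle X)) :
    cycleClasses cls (((x :: l : List X) : Cycle X) ::ₘ s) =
      cls x ::ₘ (classesOf cls l + cycleClasses cls s) := by
  rw [cycleClasses_cons, ← Multiset.cons_add]
  rfl

theorem mem_cycleClasses {q : Q} {s : Multiset (Cycle X)} :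
    q ∈ cycleClasses cls s ↔ ∃ x l, ((x :: l : List X) : Cycle X) ∈ s ∧ cls x = q := by
  rw [cycleClasses, Multiset.mem_bind]
  constructor
  · rintro ⟨C, hC, hq⟩
    induction C using Quot.inductionOn with | _ l =>
    obtain ⟨x, hx, rfl⟩ := Multiset.mem_map.1 hq
    obtain ⟨a, b, rfl⟩ := List.append_of_mem (Multiset.mem_coe.1 hx)
    refine ⟨x, b ++ a, ?_, rfl⟩
    rwa [← List.cons_append, Cycle.coe_eq_coe.2 List.isRotated_append]
  · rintro ⟨x, l, hC, rfl⟩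
    exact ⟨_, hC, Multiset.mem_map_of_mem _ (Multiset.mem_coe.2 List.mem_cons_self)⟩

theorem eq_of_isRotated_cons {x : X} {l l' : List X} (h : (x :: l) ~r (x :: l'))
    (hx : x ∉ l) : l = l' := by
  obtain ⟨n, hn, h⟩ := List.isRotated_iff_mod.1 h
  rw [List.rotate_eq_drop_append_take hn] at h
  rcases n with _ | n
  · simpa using h
  rw [List.drop_succ_cons, List.take_succ_cons] at h
  rcases hdrop : l.drop n with _ | ⟨y, t⟩
  · rw [hdrop, List.nil_append, List.cons.injEq] at h
    rw [← h.2, List.take_of_length_le (List.drop_eq_nil_iff.1 hdrop)]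
  · rw [hdrop, List.cons_append, List.cons.injEq] at h
    refine absurd (List.mem_of_mem_drop (i := n) ?_) hx
    rw [hdrop, h.1]
    exact List.mem_cons_self

variable (cls) in
/-- The sets of odd cycles having one member of each class in `K`, and no other members. -/
abbrev OddCyclesOn (K : Finset Q) : Type _ :=
  StructuresOn (fun s : OddCycleSet X => cycleClasses cls s.1.val) K

variable (cls) in
/-- The pairs of an even list and a set of odd cycles, jointly having one member of each class in
`K`, and no other members. -/
abbrev EvenListOddCyclesOn (K : Finset Q) : Type _ :=
  StructuresOn
    (fun p : EvenList X × OddCycleSet X => classesOf cls p.1.1 + cycleClasses cls p.2.1.val) K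

theorem coe_cons_notMem {K : Finset Q} (p : EvenListOddCyclesOn cls K) {x : X} (hx : cls x ∉ K)
    (l : List X) : ((x :: l : List X) : Cycle X) ∉ p.1.2.1 := fun h =>
  hx (Finset.mem_def.2 (p.2 ▸ Multiset.mem_add.2 (.inr (mem_cycleClasses.2 ⟨x, l, h, rfl⟩))))

theorem class_mem_of_mem {K : Finset Q} (p : EvenListOddCyclesOn cls K) {x : X}
    (hx : x ∈ p.1.1.1) : cls x ∈ K :=
  Finset.mem_def.2 (p.2 ▸ Multiset.mem_add.2 (.inl (List.mem_map_of_mem hx)))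

variable [DecidableEq Q] {K : Finset Q} {v : Q}

/-- The odd cycle through the object `x`, continued by an even list, joins a set of odd cycles. -/
def consCycle (hv : v ∈ K) (p : {x // cls x = v} × EvenListOddCyclesOn cls (K.erase v)) :
    OddCyclesOn cls K :=
  ⟨⟨Finset.cons ((p.1.1 :: p.2.1.1.1 : List X) : Cycle X) p.2.1.2.1
      (coe_cons_notMem p.2 (p.1.2.symm ▸ Finset.notMem_erase v K) _),
    Finset.forall_mem_cons .. |>.2 ⟨p.2.1.1.2.add_one, p.2.1.2.2⟩⟩, by
    change cycleClasses cls (_ ::ₘ p.2.1.2.1.val) = K.val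
    have hp : classesOf cls p.2.1.1.1 + cycleClasses cls p.2.1.2.1.val = _ := p.2.2
    rw [cycleClasses_cons_coe_cons, hp, p.1.2, Finset.erase_val, Multiset.cons_erase hv]⟩

theorem injective_consCycle (hv : v ∈ K) :
    Function.Injective (consCycle (cls := cls) hv) := by
  rintro ⟨⟨x, hx⟩, p⟩ ⟨⟨x', hx'⟩, p'⟩ h
  have hnot {y : X} (hy : cls y = v) : cls y ∉ K.erase v := hy ▸ Finset.notMem_erase v K
  have heq : Finset.cons _ _ (coe_cons_notMem p (hnot hx) p.1.1.1) =
      Finset.cons _ _ (coe_cons_notMem p' (hnot hx') p'.1.1.1) :=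
    congrArg (fun s : OddCyclesOn cls K => s.1.1) h
  have hC : ((x :: p.1.1.1 : List X) : Cycle X) = (x' :: p'.1.1.1 : List X) :=
    (Finset.mem_cons.1 (heq ▸ Finset.mem_cons_self _ _)).resolve_right
      (coe_cons_notMem p' (hnot hx) _)
  have hrot := Cycle.coe_eq_coe.1 hC
  obtain rfl : x' = x := (List.mem_cons.1 (hrot.mem_iff.2 List.mem_cons_self)).resolve_right
    fun hmem => hnot hx' (class_mem_of_mem p hmem)
  have hl := eq_of_isRotated_cons hrot fun hmem => hnot hx (class_mem_of_mem p hmem)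
  have hs : p.1.2.1 = p'.1.2.1 := by
    rw [← Finset.val_inj, Finset.cons_val, Finset.cons_val, hC, Multiset.cons_inj_right] at heq
    exact Finset.val_injective heq
  exact Prod.ext rfl (Subtype.ext (Prod.ext (Subtype.ext hl) (Subtype.ext hs)))

theorem surjective_consCycle (hv : v ∈ K) :
    Function.Surjective (consCycle (cls := cls) hv) := by
  classical
  rintro ⟨⟨s, hodd⟩, hs⟩
  change cycleClasses cls s.val = K.val at hs
  obtain ⟨x, l, hC, hx⟩ := mem_cycleClasses.1 (hs.symm ▸ Finset.mem_def.1 hv)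
  have hl : Even l.length := by
    simpa [Nat.odd_add_one] using hodd _ hC
  have hrest : classesOf cls l + cycleClasses cls (s.erase ((x :: l : List X) : Cycle X)).val =
      (K.erase v).val := by
    rw [← Multiset.cons_erase hC, cycleClasses_cons_coe_cons, hx] at hs
    rw [Finset.erase_val, Finset.erase_val, ← hs, Multiset.erase_cons_head]
  refine ⟨⟨⟨x, hx⟩, ⟨⟨l, hl⟩, ⟨s.erase (x :: l : List X),
    fun C hC => hodd C (Finset.mem_of_mem_erase hC)⟩⟩, hrest⟩, Subtype.ext (Subtype.ext ?_)⟩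
  exact (Finset.cons_eq_insert _ _ (Finset.notMem_erase _ _)).trans (Finset.insert_erase hC)

omit [DecidableEq Q] in
theorem card_evenLists [∀ q, Finite {x // cls x = q}] (K : Finset Q) :
    Finite (StructuresOn (fun l : EvenList X => classesOf cls l.1) K) ∧
      Nat.card (StructuresOn (fun l : EvenList X => classesOf cls l.1) K) =
        if Even K.card then K.card ! * numTransversals cls K else 0 := by
  obtain ⟨_, hcard⟩ := card_arrangements (cls := cls) K
  have hlen {l : List X} (hl : classesOf cls l = K.val) : l.length = K.card := by
    rw [← card_classesOf (cls := cls), hl, Finset.card_val]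
  split_ifs with hK
  · let e : StructuresOn (fun l : EvenList X => classesOf cls l.1) K ≃
        StructuresOn (classesOf cls) K :=
      { toFun l := ⟨l.1.1, l.2⟩
        invFun l := ⟨⟨l.1, hlen l.2 ▸ hK⟩, l.2⟩ }
    exact ⟨Finite.of_equiv _ e.symm, (Nat.card_congr e).trans hcard⟩
  · have : IsEmpty (StructuresOn (fun l : EvenList X => classesOf cls l.1) K) :=
      ⟨fun l => hK (hlen l.2 ▸ l.1.2)⟩
    exact ⟨inferInstance, Nat.card_of_isEmpty⟩

theorem sum_powerset_even_mul_oddCount (K : Finset Q) :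
    ∑ J ∈ K.powerset, (if Even J.card then J.card ! * numTransversals cls J else 0) *
        (numTransversals cls (K \ J) * oddCount (K \ J).card) =
      numTransversals cls K * oddCount (K.card + 1) := by
  have hterm : ∀ J ∈ K.powerset,
      (if Even J.card then J.card ! * numTransversals cls J else 0) *
        (numTransversals cls (K \ J) * oddCount (K \ J).card) = numTransversals cls K *
          (if Even J.card then J.card ! * oddCount (K.card - J.card) else 0) := by
    intro J hJ
    have hJ := Finset.mem_powerset.1 hJ
    rw [← numTransversals_mul_sdiff hJ, Finset.card_sdiff_of_subset hJ]
    split_ifs <;> ring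
  rw [Finset.sum_congr rfl hterm, ← Finset.mul_sum, Finset.sum_powerset_apply_card fun j =>
    if Even j then j ! * oddCount (K.card - j) else 0, ← sum_even_choose_oddCount]
  simp only [smul_eq_mul, mul_ite, mul_zero, mul_assoc]

omit [DecidableEq Q] in
theorem oddCyclesOn_empty_eq (s : OddCyclesOn cls ∅) : s.1.1 = ∅ := by
  have hs : cycleClasses cls s.1.1.val = 0 := s.2
  refine Finset.eq_empty_of_forall_notMem fun C hC => ?_
  induction C using Quot.inductionOn with | _ l =>
  rcases l with _ | ⟨x, l⟩
  · exact Nat.not_odd_zero (s.1.2 _ hC)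
  · exact Multiset.notMem_zero (cls x) (hs ▸ mem_cycleClasses.2 ⟨x, l, hC, rfl⟩)

omit [DecidableEq Q] in
theorem card_oddCyclesOn [∀ q, Finite {x // cls x = q}] (K : Finset Q) :
    Finite (OddCyclesOn cls K) ∧
      Nat.card (OddCyclesOn cls K) = numTransversals cls K * oddCount K.card := by
  classical
  induction K using Finset.strongInduction with
  | H K ih =>
    rcases K.eq_empty_or_nonempty with rfl | ⟨v, hv⟩
    · have : Unique (OddCyclesOn cls ∅) :=
        ⟨⟨⟨⟨∅, by simp⟩, rfl⟩⟩, fun s => Subtype.ext (Subtype.ext (oddCyclesOn_empty_eq s))⟩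
      exact ⟨inferInstance, by simp [numTransversals, oddCount]⟩
    have hsub {J : Finset Q} (hJ : J ⊆ K.erase v) : J ⊂ K :=
      hJ.trans_ssubset (Finset.erase_ssubset hv)
    obtain ⟨_, hcard⟩ := card_structuresOn_prod
      (fun l : EvenList X => classesOf cls l.1) (fun s : OddCycleSet X => cycleClasses cls s.1.val)
      (K.erase v) (fun J _ => (card_evenLists J).1) fun J hJ => (ih J (hsub hJ)).1
    have e := Equiv.ofBijective _ ⟨injective_consCycle (cls := cls) hv, surjective_consCycle hv⟩
    refine ⟨Finite.of_equiv _ e, ?_⟩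
    rw [← Nat.card_congr e, Nat.card_prod, hcard, Finset.sum_congr rfl fun J _ => by
      rw [(card_evenLists J).2, (ih _ (hsub Finset.sdiff_subset)).2],
      sum_powerset_even_mul_oddCount, Finset.card_erase_add_one hv, ← mul_assoc,
      card_mul_numTransversals_erase hv]

end OddSets

section CutWord

variable {α : Type*}

theorem flatten_cutWord (w : List α) (p : List Step) : (cutWord w p).flatten = w := by
  fun_induction cutWord w p <;> simp_all

theorem nil_notMem_cutWord (w : List α) (p : List Step) : [] ∉ cutWord w p := by
  fun_induction cutWord w p <;> simp_all

theorem exists_cutWord_cons (b : α) (w : List α) (p : List Step) :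
    ∃ c cs, cutWord (b :: w) p = (b :: c) :: cs := by
  rcases hcut : cutWord (b :: w) p with _ | ⟨_ | ⟨b', c⟩, cs⟩
  · simpa [hcut] using flatten_cutWord (b :: w) p
  · simpa [hcut] using nil_notMem_cutWord (b :: w) p
  · have := flatten_cutWord (b :: w) p
    rw [hcut, List.flatten_cons, List.cons_append, List.cons.injEq] at this
    exact ⟨c, cs, by rw [this.1]⟩

theorem cutWord_cons_flat {b : α} {w c : List α} {p : List Step} {cs : List (List α)}
    (h : cutWord (b :: w) p = (b :: c) :: cs) (a : α) :
    cutWord (a :: b :: w) (.flat :: p) = (a :: b :: c) :: cs := by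
  rw [cutWord, h]

theorem cutWord_cons_of_ne_flat {s : Step} (hs : s ≠ .flat) (a : α) (w : List α) (p : List Step) :
    cutWord (a :: w) (s :: p) = [a] :: cutWord w p := by
  cases s <;> simp_all [cutWord]

theorem clusters_induction {motive : ∀ cs : List (List α), [] ∉ cs → Prop}
    (nil : ∀ h, motive [] h) (singleton : ∀ a h, motive [[a]] h)
    (extend : ∀ a b c cs h h', motive ((b :: c) :: cs) h → motive ((a :: b :: c) :: cs) h')
    (cut : ∀ a b c cs h h', motive ((b :: c) :: cs) h → motive ([a] :: (b :: c) :: cs) h') :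
    ∀ cs h, motive cs h
  | [], h => nil h
  | [] :: _, h => absurd List.mem_cons_self h
  | [[a]], h => singleton a h
  | [_] :: [] :: _, h => absurd (List.mem_cons_of_mem _ List.mem_cons_self) h
  | [a] :: (b :: c) :: cs, h => cut a b c cs (fun h' => h (List.mem_cons_of_mem _ h')) h <|
    clusters_induction nil singleton extend cut _ _
  | (a :: b :: c) :: cs, h => extend a b c cs (by simpa using h) h <|
    clusters_induction nil singleton extend cut _ _

variable [LinearOrder α]

/-- The step between the letters `a` and `b` if they are not in the same cluster. -/
def stepBetween (a b : α) : Step := if a < b then .up else .down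

theorem stepBetween_ne_flat (a b : α) : stepBetween a b ≠ .flat := by
  unfold stepBetween
  split <;> simp

/-- The path of a sequence of clusters; the lists which contain an empty word get a junk value. -/
def clusterPath : List (List α) → List Step
  | (_ :: b :: c) :: cs => .flat :: clusterPath ((b :: c) :: cs)
  | [a] :: (b :: c) :: cs => stepBetween a b :: clusterPath ((b :: c) :: cs)
  | _ => []

/-- The height difference between two successive clusters; the value at an empty word is junk. -/
def clusterRise (u v : List α) : ℤ :=
  match u.getLast?, v.head? with
  | some a, some b => (stepBetween a b).dy
  | _, _ => -1

theorem clusterRise_eq_or (u v : List α) : clusterRise u v = 1 ∨ clusterRise u v = -1 := by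
  unfold clusterRise stepBetween
  split
  · split <;> simp [Step.dy]
  · exact .inr rfl

theorem clusterRise_singleton_cons (a b : α) (c : List α) :
    clusterRise [a] (b :: c) = (stepBetween a b).dy := rfl

theorem clusterRise_extend (a b : α) (c v : List α) :
    clusterRise (a :: b :: c) v = clusterRise (b :: c) v := by
  rw [clusterRise, clusterRise, List.getLast?_cons_cons]

theorem clusterRise_reverse_reverse {u v : List α} (hu : u ≠ []) (hv : v ≠ [])
    (h : u.getLast? ≠ v.head?) :
    clusterRise v.reverse u.reverse = -clusterRise u v := by
  obtain ⟨a, ha⟩ := Option.ne_none_iff_exists'.1 (mt List.getLast?_eq_none_iff.1 hu)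
  obtain ⟨b, hb⟩ := Option.ne_none_iff_exists'.1 (mt List.head?_eq_none_iff.1 hv)
  have hne : a ≠ b := by simpa [ha, hb] using h
  simp only [clusterRise, List.getLast?_reverse, List.head?_reverse, ha, hb, stepBetween]
  rcases hne.lt_or_gt with hlt | hlt <;> simp [hlt, hlt.not_gt, Step.dy]

/-- The letters ascend along the up steps and descend along the down steps. -/
def Labels : List α → List Step → Prop
  | a :: b :: w, s :: p => (s = .up → a < b) ∧ (s = .down → b < a) ∧ Labels (b :: w) p
  | _, _ => True

theorem labels_iff {w : List α} {p : List Step} :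
    Labels w p ↔ ∀ (i : ℕ) (h : i + 1 < w.length), (p[i]? = some .up → w[i] < w[i + 1]) ∧
      (p[i]? = some .down → w[i + 1] < w[i]) := by
  fun_induction Labels w p with
  | case1 a b w s p ih =>
    rw [ih, ← and_assoc]
    refine ⟨fun h i hi => ?_, fun h => ⟨by simpa using h 0 (by simp), fun i hi => ?_⟩⟩
    · cases i with
      | zero => simpa using h.1
      | succ i => exact h.2 i (by simpa using hi)
    · exact h (i + 1) (by simpa using hi)
  | case2 w p h =>
    rcases w with _ | ⟨a, _ | ⟨b, w⟩⟩
    · simp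
    · simp
    · rcases p with _ | ⟨s, p⟩
      · simp
      · exact absurd rfl (h a b w s p rfl)

theorem Labels.eq_stepBetween {a b : α} {w : List α} {s : Step} {p : List Step}
    (h : Labels (a :: b :: w) (s :: p)) (hs : s ≠ .flat) : s = stepBetween a b := by
  cases s with
  | up => exact (if_pos (h.1 rfl)).symm
  | flat => exact absurd rfl hs
  | down => exact (if_neg (h.2.1 rfl).not_gt).symm

theorem clusterPath_cutWord {w : List α} {p : List Step} (hl : p.length = w.length - 1)
    (h : Labels w p) : clusterPath (cutWord w p) = p := by
  induction w generalizing p with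
  | nil => simpa [cutWord, clusterPath, eq_comm] using hl
  | cons a w ih =>
    rcases w with _ | ⟨b, w⟩
    · obtain rfl := List.length_eq_zero_iff.1 hl
      simp [cutWord, clusterPath]
    rcases p with _ | ⟨s, p⟩
    · simp at hl
    have ih := ih (by simpa using hl) h.2.2
    obtain ⟨c, cs, hcut⟩ := exists_cutWord_cons b w p
    rw [hcut] at ih
    by_cases hs : s = .flat
    · rw [hs, cutWord_cons_flat hcut, clusterPath, ih]
    · rw [cutWord_cons_of_ne_flat hs, hcut, clusterPath, ih, ← h.eq_stepBetween hs]

theorem cutWord_clusterPath {cs : List (List α)} (hcs : [] ∉ cs) :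
    cutWord cs.flatten (clusterPath cs) = cs := by
  induction cs, hcs using clusters_induction with
  | nil => rfl
  | singleton a => simp [clusterPath, cutWord]
  | extend a b c cs _ _ ih =>
    rw [clusterPath]
    exact cutWord_cons_flat ih a
  | cut a b c cs _ _ ih =>
    rw [clusterPath]
    exact (cutWord_cons_of_ne_flat (stepBetween_ne_flat a b) ..).trans (congrArg _ ih)

theorem length_clusterPath {cs : List (List α)} (hcs : [] ∉ cs) :
    (clusterPath cs).length = cs.flatten.length - 1 := by
  induction cs, hcs using clusters_induction with
  | nil => simp [clusterPath]
  | singleton a => simp [clusterPath]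
  | extend a b c cs _ _ ih => simp_all [clusterPath]
  | cut a b c cs _ _ ih => simp_all [clusterPath]

theorem labels_clusterPath {cs : List (List α)} (hcs : [] ∉ cs) (hn : cs.flatten.Nodup) :
    Labels cs.flatten (clusterPath cs) := by
  induction cs, hcs using clusters_induction with
  | nil => exact labels_iff.2 (by simp)
  | singleton a => exact labels_iff.2 (by simp)
  | extend a b c cs _ _ ih =>
    rw [clusterPath]
    exact ⟨nofun, nofun, ih hn.of_cons⟩
  | cut a b c cs _ _ ih =>
    have hne : a ≠ b := fun h => (List.nodup_cons.1 hn).1 (h ▸ List.mem_cons_self)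
    rw [clusterPath]
    refine ⟨fun h => ?_, fun h => ?_, ih hn.of_cons⟩
    · by_contra hab
      simp [stepBetween, hab] at h
    · by_contra hba
      simp [stepBetween, hne.lt_of_le (not_lt.1 hba)] at h

theorem forall_height_take_cons {h : ℤ} {s : Step} {p : List Step} :
    (∀ k, 0 ≤ h + height ((s :: p).take k)) ↔
      0 ≤ h ∧ ∀ k, 0 ≤ h + s.dy + height (p.take k) := by
  have hcons (q : List Step) : height (s :: q) = s.dy + height q := rfl
  rw [← Nat.and_forall_add_one]
  simp only [List.take_zero, List.take_succ_cons, hcons, add_assoc]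
  simp [height]

theorem forall_prefix_totalRise_singleton {X : Type*} {r : X → X → ℤ} {h : ℤ} {x : X} :
    (∀ u, u <+: [x] → 0 ≤ h + totalRise r u) ↔ 0 ≤ h := by
  refine ⟨fun H => by simpa using H [] List.nil_prefix, fun H u hu => ?_⟩
  rcases u with _ | ⟨y, u⟩
  · simpa using H
  · obtain ⟨rfl, hu'⟩ := List.cons_prefix_cons.1 hu
    obtain rfl := List.prefix_nil.1 hu'
    simpa using H

theorem forall_prefix_totalRise_cons_cons {X : Type*} {r : X → X → ℤ} {h : ℤ} {x y : X}
    {ws : List X} :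
    (∀ u, u <+: x :: y :: ws → 0 ≤ h + totalRise r u) ↔
      0 ≤ h ∧ ∀ u, u <+: y :: ws → 0 ≤ h + r x y + totalRise r u := by
  constructor
  · refine fun H => ⟨by simpa using H [] List.nil_prefix, fun u hu => ?_⟩
    rcases u with _ | ⟨y', u⟩
    · simpa [totalRise_cons_cons] using H [x, y] (by simp)
    · obtain ⟨rfl, -⟩ := List.cons_prefix_cons.1 hu
      simpa [totalRise_cons_cons, add_assoc] using H _ (List.cons_prefix_cons.2 ⟨rfl, hu⟩)
  · rintro ⟨h₀, H⟩ (_ | ⟨x', _ | ⟨y', u⟩⟩) hu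
    · simpa using h₀
    · simpa using h₀
    · obtain ⟨rfl, hu₁⟩ := List.cons_prefix_cons.1 hu
      obtain ⟨rfl, -⟩ := List.cons_prefix_cons.1 hu₁
      simpa [totalRise_cons_cons, add_assoc] using H _ hu₁

theorem forall_height_clusterPath {cs : List (List α)} (hcs : [] ∉ cs) (h : ℤ) :
    (∀ k, 0 ≤ h + height ((clusterPath cs).take k)) ↔
      ∀ u, u <+: cs → 0 ≤ h + totalRise clusterRise u := by
  induction cs, hcs using clusters_induction generalizing h with
  | nil => simp [clusterPath, height]
  | singleton a =>
    rw [forall_prefix_totalRise_singleton]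
    simp [clusterPath, height]
  | extend a b c cs _ _ ih =>
    rw [clusterPath, forall_height_take_cons, Step.dy, add_zero, ih]
    rcases cs with _ | ⟨d, cs⟩
    · simp only [forall_prefix_totalRise_singleton, and_self]
    · simp only [forall_prefix_totalRise_cons_cons, clusterRise_extend, and_self_left]
  | cut a b c cs _ _ ih =>
    rw [clusterPath, forall_height_take_cons, ih, ← clusterRise_singleton_cons a b c,
      forall_prefix_totalRise_cons_cons]

theorem ballot_clusterRise_iff {cs : List (List α)} (hcs : [] ∉ cs) :
    Ballot clusterRise cs ↔ ∀ k, 0 ≤ height ((clusterPath cs).take k) := by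
  simpa [Ballot] using (forall_height_clusterPath hcs 0).symm

end CutWord

section Clusters

variable {n : ℕ}

namespace WellLabelledPath

theorem flatten_clusters (x : WellLabelledPath n) : x.clusters.flatten = List.ofFn x.label :=
  flatten_cutWord _ _

theorem nil_notMem_clusters (x : WellLabelledPath n) : [] ∉ x.clusters := nil_notMem_cutWord _ _

theorem clusterPath_clusters (x : WellLabelledPath n) : clusterPath x.clusters = x.path := by
  refine clusterPath_cutWord (by rw [x.length_path, List.length_ofFn]) (labels_iff.2 fun i hi => ?_)
  have hi : i + 1 < n := by simpa using hi
  simp only [List.getElem_ofFn]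
  exact ⟨x.label_up i hi, x.label_down i hi⟩

theorem ballot_clusters (x : WellLabelledPath n) : Ballot clusterRise x.clusters := by
  rw [ballot_clusterRise_iff x.nil_notMem_clusters, x.clusterPath_clusters]
  exact x.nonneg

theorem clusters_injective : Function.Injective (clusters (n := n)) := by
  intro x y h
  apply WellLabelledPath.ext
  · rw [← x.clusterPath_clusters, h, y.clusterPath_clusters]
  · refine Equiv.coe_fn_injective (List.ofFn_injective ?_)
    rw [← x.flatten_clusters, h, y.flatten_clusters]

theorem exists_clusters_eq {cs : List (List (Fin n))} (hnil : [] ∉ cs)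
    (hperm : cs.flatten.Perm (List.finRange n)) (hballot : Ballot clusterRise cs) :
    ∃ x : WellLabelledPath n, x.clusters = cs := by
  obtain ⟨π, hπ⟩ := exists_perm_ofFn_eq hperm
  have hlabels := labels_clusterPath hnil (hperm.nodup_iff.2 (List.nodup_finRange n))
  rw [← hπ, labels_iff] at hlabels
  simp only [List.length_ofFn, List.getElem_ofFn] at hlabels
  refine ⟨⟨clusterPath cs, ?_, (ballot_clusterRise_iff hnil).1 hballot, π,
    fun i h => (hlabels i h).1, fun i h => (hlabels i h).2⟩, ?_⟩
  · rw [length_clusterPath hnil, ← hπ, List.length_ofFn]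
  · change cutWord (List.ofFn π) (clusterPath cs) = cs
    rw [hπ, cutWord_clusterPath hnil]

end WellLabelledPath

end Clusters

section WordClass

variable {α : Type*}

/-- The words up to reversal. -/
abbrev WordClass (α : Type*) : Type _ := Unoriented (List.reverse : List α → List α)

/-- The class of a word up to reversal. -/
abbrev wordClass : List α → WordClass α := unorient List.reverse

theorem wordClass_eq_iff {c d : List α} : wordClass c = wordClass d ↔ c = d ∨ c = d.reverse :=
  unorient_eq_iff List.reverse_involutive

theorem wordClass_mem_map {S : Multiset (List α)} {c : List α} :
    wordClass c ∈ S.map wordClass ↔ c ∈ S ∨ c.reverse ∈ S := by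
  simp only [Multiset.mem_map, wordClass_eq_iff, and_or_left, exists_or, exists_eq_right]

/-- The multiset of the letters of a word, which depends on the class of the word only. -/
def classLetters : WordClass α → Multiset α :=
  Unoriented.lift (fun c : List α => (c : Multiset α)) Multiset.coe_reverse

theorem bind_map_wordClass (S : Multiset (List α)) :
    (S.map wordClass).bind classLetters = S.bind fun c => (c : Multiset α) :=
  Multiset.bind_map _ _ _

variable [Fintype α]

/-- The classes of the members of some set of nonempty words in which each letter occurs once. -/
def IsClusterClasses (K : Multiset (WordClass α)) : Prop :=
  K.bind classLetters = Finset.univ.val ∧ wordClass [] ∉ K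

theorem isClusterClasses_map {S : Multiset (List α)} :
    IsClusterClasses (S.map wordClass) ↔
      (S.bind fun c => (c : Multiset α)) = Finset.univ.val ∧ [] ∉ S := by
  rw [IsClusterClasses, bind_map_wordClass, wordClass_mem_map, List.reverse_nil, or_self]

theorem IsClusterClasses.disjoint {a b : WordClass α} {K : Multiset (WordClass α)}
    (hK : IsClusterClasses (a ::ₘ b ::ₘ K)) : Disjoint (classLetters a) (classLetters b) := by
  have h := hK.1.symm ▸ (Finset.univ : Finset α).nodup
  rw [Multiset.cons_bind, Multiset.cons_bind, ← add_assoc] at h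
  exact (Multiset.nodup_add.1 (Multiset.nodup_add.1 h).1).2.2

theorem IsClusterClasses.nodup {S : Multiset (List α)}
    (hS : IsClusterClasses (S.map wordClass)) : (S.map wordClass).Nodup := by
  rw [Multiset.nodup_iff_ne_cons_cons]
  intro a K h
  obtain ⟨c, hc, rfl⟩ := Multiset.mem_map.1 (h ▸ Multiset.mem_cons_self a _)
  have hdisj : Disjoint (c : Multiset α) c := (h ▸ hS).disjoint
  obtain rfl : c = [] := by simpa using hdisj
  exact (isClusterClasses_map.1 hS).2 hc

theorem IsClusterClasses.negatedByRev [LinearOrder α] {K : Finset (WordClass α)}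
    (hK : IsClusterClasses K.val) : NegatedByRev clusterRise List.reverse K := by
  intro x y hx hy hxy
  obtain ⟨K', hK'⟩ := Multiset.exists_cons_of_mem (s := K.val) hx
  have hy' : wordClass y ∈ K' :=
    (Multiset.mem_cons.1 (hK' ▸ (hy : wordClass y ∈ K.val))).resolve_left hxy.symm
  obtain ⟨K', rfl⟩ := Multiset.exists_cons_of_mem hy'
  have hdisj : List.Disjoint x y := (Multiset.coe_disjoint _ _).1 (hK' ▸ hK).disjoint
  have hx₀ : x ≠ [] := fun h => hK.2 (h ▸ hx)
  refine clusterRise_reverse_reverse hx₀ (fun h => hK.2 (h ▸ hy)) fun h => ?_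
  rw [List.getLast?_eq_some_getLast hx₀] at h
  exact hdisj (List.getLast_mem hx₀) (List.mem_of_mem_head? h.symm)

end WordClass

section Fibers

variable {n : ℕ}

theorem mem_toMultiset {α : Type*} {C : Cycle α} {a : α} : a ∈ C.toMultiset ↔ a ∈ C := by
  induction C using Quotient.inductionOn'
  rfl

theorem coe_flatten {α : Type*} (cs : List (List α)) :
    (cs.flatten : Multiset α) = (cs : Multiset (List α)).bind fun c => (c : Multiset α) := by
  rw [← List.flatMap_id, Multiset.coe_bind]
  rfl

theorem coe_ofFn_perm (π : Equiv.Perm (Fin n)) :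
    (List.ofFn π : Multiset (Fin n)) = Finset.univ.val := by
  rw [List.ofFn_eq_map]
  exact Multiset.coe_eq_coe.2 (Equiv.Perm.map_finRange_perm π)

namespace WellLabelledPath

theorem isClusterClasses (x : WellLabelledPath n) :
    IsClusterClasses ((x.clusters : Multiset (List (Fin n))).map wordClass) := by
  rw [isClusterClasses_map, ← coe_flatten, x.flatten_clusters]
  exact ⟨coe_ofFn_perm _, x.nil_notMem_clusters⟩

/-- The classes up to reversal of the clusters. -/
def classes (x : WellLabelledPath n) : Finset (WordClass (Fin n)) := ⟨_, x.isClusterClasses.nodup⟩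

theorem wordClass_mem_classes (x : WellLabelledPath n) (c : List (Fin n)) :
    wordClass c ∈ x.classes ↔ x.HasCluster c ∨ x.HasCluster c.reverse :=
  wordClass_mem_map (S := (x.clusters : Multiset (List (Fin n))))

end WellLabelledPath

namespace OddClusterPerm

/-- The clusters, as a multiset. -/
def clusters (y : OddClusterPerm n) : Multiset (List (Fin n)) :=
  y.cycles.val.bind Cycle.toMultiset

theorem mem_clusters {y : OddClusterPerm n} {c : List (Fin n)} :
    c ∈ y.clusters ↔ y.HasCluster c := by
  simp only [clusters, Multiset.mem_bind, mem_toMultiset, Finset.mem_val, HasCluster]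

theorem isClusterClasses (y : OddClusterPerm n) : IsClusterClasses (y.clusters.map wordClass) := by
  rw [isClusterClasses_map, clusters, Multiset.bind_assoc]
  refine ⟨y.letters, fun h => ?_⟩
  obtain ⟨C, hC, h⟩ := mem_clusters.1 h
  exact y.ne_nil C hC [] h rfl

/-- The classes up to reversal of the clusters. -/
def classes (y : OddClusterPerm n) : Finset (WordClass (Fin n)) := ⟨_, y.isClusterClasses.nodup⟩

theorem wordClass_mem_classes (y : OddClusterPerm n) (c : List (Fin n)) :
    wordClass c ∈ y.classes ↔ y.HasCluster c ∨ y.HasCluster c.reverse := by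
  simp only [← mem_clusters]
  exact wordClass_mem_map

end OddClusterPerm

variable {K : Finset (WordClass (Fin n))}

/-- The well-labelled positive paths with given classes of clusters are the ballot arrangements
of these classes. -/
noncomputable def pathFiberEquiv (hK : IsClusterClasses K.val) :
    {x : WellLabelledPath n // x.classes = K} ≃
      BallotArrangements clusterRise List.reverse K := by
  refine Equiv.ofBijective
    (fun x => ⟨⟨x.1.clusters, x.1.ballot_clusters⟩, congrArg Finset.val x.2⟩) ⟨?_, ?_⟩
  · intro x y h
    exact Subtype.ext (WellLabelledPath.clusters_injective (congrArg (·.1.1) h))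
  · rintro ⟨⟨cs, hballot⟩, hcs⟩
    change classesOf wordClass cs = K.val at hcs
    have hclasses := hcs ▸ hK
    rw [classesOf, ← Multiset.map_coe, isClusterClasses_map, ← coe_flatten] at hclasses
    obtain ⟨x, rfl⟩ := WellLabelledPath.exists_clusters_eq hclasses.2
      (Multiset.coe_eq_coe.1 hclasses.1) hballot
    exact ⟨⟨x, Finset.val_injective hcs⟩, rfl⟩

/-- The odd order cluster-permutations with given classes of clusters are the sets of odd cycles
on these classes. -/
noncomputable def cycleFiberEquiv (hK : IsClusterClasses K.val) :
    {y : OddClusterPerm n // y.classes = K} ≃ OddCyclesOn wordClass K := by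
  have map_clusters (s : Multiset (Cycle (List (Fin n)))) :
      (s.bind Cycle.toMultiset).map wordClass = cycleClasses wordClass s := Multiset.map_bind ..
  refine Equiv.ofBijective (fun y => ⟨⟨y.1.cycles, y.1.odd_length⟩,
    (map_clusters _).symm.trans (congrArg Finset.val y.2)⟩) ⟨?_, ?_⟩
  · intro x y h
    exact Subtype.ext (OddClusterPerm.ext (congrArg (·.1.1) h))
  · rintro ⟨⟨s, hodd⟩, hs⟩
    have hclasses := (map_clusters s.val).trans hs ▸ hK
    rw [isClusterClasses_map, Multiset.bind_assoc] at hclasses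
    have hne : ∀ C ∈ s, ∀ c ∈ C, c ≠ [] := fun C hC c hc h => hclasses.2 <|
      Multiset.mem_bind.2 ⟨C, hC, mem_toMultiset.2 (h ▸ hc)⟩
    exact ⟨⟨⟨s, hodd, hne, hclasses.1⟩, Finset.val_injective ((map_clusters s.val).trans hs)⟩, rfl⟩

theorem card_fibers (K : Finset (WordClass (Fin n))) :
    Finite {x : WellLabelledPath n // x.classes = K} ∧
    Finite {y : OddClusterPerm n // y.classes = K} ∧
    Nat.card {x : WellLabelledPath n // x.classes = K} =
      Nat.card {y : OddClusterPerm n // y.classes = K} := by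
  by_cases hK : IsClusterClasses K.val
  · have hrev : Function.Involutive (List.reverse : List (Fin n) → _) := List.reverse_involutive
    have := finite_unorient_fiber hrev
    have := finite_ballotArrangements (r := clusterRise) hrev K
    obtain ⟨_, hcard⟩ := card_oddCyclesOn (cls := wordClass) K
    refine ⟨.of_equiv _ (pathFiberEquiv hK).symm, .of_equiv _ (cycleFiberEquiv hK).symm, ?_⟩
    rw [Nat.card_congr (pathFiberEquiv hK), Nat.card_congr (cycleFiberEquiv hK), hcard,
      card_ballotArrangements clusterRise_eq_or hrev hK.negatedByRev]
  · have : IsEmpty {x : WellLabelledPath n // x.classes = K} :=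
      ⟨fun x => hK (x.2 ▸ x.1.isClusterClasses)⟩
    have : IsEmpty {y : OddClusterPerm n // y.classes = K} :=
      ⟨fun y => hK (y.2 ▸ y.1.isClusterClasses)⟩
    exact ⟨inferInstance, inferInstance, by simp⟩

end Fibers

section Singletons

variable {n : ℕ}

/-- The classes of the words with one letter. -/
def singletonClasses (n : ℕ) : Finset (WordClass (Fin n)) :=
  Finset.univ.map ⟨fun a => wordClass [a], fun a b h => by simpa [wordClass_eq_iff] using h⟩

theorem wordClass_mem_singletonClasses {c : List (Fin n)} :
    wordClass c ∈ singletonClasses n ↔ ∃ a, c = [a] := by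
  simp only [singletonClasses, Finset.mem_map, Finset.mem_univ, true_and]
  exact exists_congr fun a => eq_comm.trans (wordClass_eq_iff.trans or_self_iff)

theorem cutWord_wordPath {α : Type*} [LinearOrder α] (w : List α) :
    cutWord w (wordPath w) = w.map fun a => [a] := by
  induction w with
  | nil => rfl
  | cons a w ih =>
    rcases w with _ | ⟨b, w⟩
    · rfl
    · rw [wordPath, cutWord_cons_of_ne_flat (by split <;> simp), ih, List.map_cons (a := a)]

theorem BallotPerm.classes_toPath (π : BallotPerm n) : π.toPath.classes = singletonClasses n := by
  apply Finset.val_injective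
  have hclusters : π.toPath.clusters = (List.ofFn π.1).map fun a => [a] := cutWord_wordPath _
  change (π.toPath.clusters : Multiset (List (Fin n))).map wordClass = _
  rw [hclusters, ← Multiset.map_coe, Multiset.map_map, coe_ofFn_perm]
  rfl

theorem BallotPerm.toPath_injective : Function.Injective (BallotPerm.toPath (n := n)) :=
  fun _ _ h => Subtype.ext (congrArg WellLabelledPath.label h)

theorem OddClusterPerm.length_eq_one {y : OddClusterPerm n} (hy : y.classes = singletonClasses n) :
    ∀ C ∈ y.cycles, ∀ c ∈ C, c.length = 1 := by
  intro C hC c hc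
  have hmem : wordClass c ∈ y.classes := (y.wordClass_mem_classes c).2 (.inl ⟨C, hC, hc⟩)
  rw [hy, wordClass_mem_singletonClasses] at hmem
  obtain ⟨a, rfl⟩ := hmem
  rfl

theorem exists_singletonFiberEquiv (n : ℕ) :
    ∃ e : {x : WellLabelledPath n // x.classes = singletonClasses n} ≃
      {y : OddClusterPerm n // y.classes = singletonClasses n},
      ∀ π : BallotPerm n, (e ⟨π.toPath, π.classes_toPath⟩).1.cycles = Psi π := by
  obtain ⟨_, _, hcard⟩ := card_fibers (singletonClasses n)
  choose g hg using fun y : {y : OddClusterPerm n // y.classes = singletonClasses n} =>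
    exists_Psi_eq y.1 (OddClusterPerm.length_eq_one y.2)
  let f (y : {y : OddClusterPerm n // y.classes = singletonClasses n}) :
      {x : WellLabelledPath n // x.classes = singletonClasses n} :=
    ⟨(g y).toPath, (g y).classes_toPath⟩
  have hf {y : {y : OddClusterPerm n // y.classes = singletonClasses n}} {π : BallotPerm n}
      (h : f y = ⟨π.toPath, π.classes_toPath⟩) : g y = π :=
    BallotPerm.toPath_injective (congrArg Subtype.val h)
  have hinj : Function.Injective f := fun y z h =>
    Subtype.ext (OddClusterPerm.ext (by rw [← hg, ← hg, hf h]))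
  have hbij : Function.Bijective f := hinj.bijective_of_nat_card_le hcard.le
  refine ⟨(Equiv.ofBijective f hbij).symm, fun π => ?_⟩
  rw [← hg]
  exact congrArg Psi (hf (Equiv.ofBijective_apply_symm_apply f hbij _))

theorem exists_fiberEquiv (K : Finset (WordClass (Fin n))) :
    ∃ e : {x : WellLabelledPath n // x.classes = K} ≃ {y : OddClusterPerm n // y.classes = K},
      ∀ (π : BallotPerm n) (h : π.toPath.classes = K), (e ⟨π.toPath, h⟩).1.cycles = Psi π := by
  by_cases hK : K = singletonClasses n
  · subst hK
    obtain ⟨e, he⟩ := exists_singletonFiberEquiv n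
    exact ⟨e, fun π _ => he π⟩
  · obtain ⟨_, _, hcard⟩ := card_fibers K
    obtain ⟨e⟩ := Finite.card_eq.1 hcard
    exact ⟨e, fun π h => absurd (h.symm.trans π.classes_toPath) hK⟩

end Singletons

end BallotCluster

theorem theorem3p1 (n : ℕ) :
    ∃ Φ : BallotCluster.WellLabelledPath n → BallotCluster.OddClusterPerm n,
      Function.Bijective Φ ∧
      (∀ (x : BallotCluster.WellLabelledPath n) (c : List (Fin n)),
        (x.HasCluster c ∨ x.HasCluster c.reverse) ↔
          ((Φ x).HasCluster c ∨ (Φ x).HasCluster c.reverse)) ∧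
      ∀ π : BallotCluster.BallotPerm n, (Φ π.toPath).cycles = BallotCluster.Psi π := by
  choose e he using BallotCluster.exists_fiberEquiv (n := n)
  let Φ : BallotCluster.WellLabelledPath n ≃ BallotCluster.OddClusterPerm n :=
    (Equiv.sigmaFiberEquiv BallotCluster.WellLabelledPath.classes).symm.trans
      ((Equiv.sigmaCongrRight e).trans (Equiv.sigmaFiberEquiv BallotCluster.OddClusterPerm.classes))
  have hclasses (x) : (Φ x).classes = x.classes := (e x.classes ⟨x, rfl⟩).2
  refine ⟨Φ, Φ.bijective, fun x c => ?_, fun π => he _ π rfl⟩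
  rw [← x.wordClass_mem_classes, ← BallotCluster.OddClusterPerm.wordClass_mem_classes, hclasses]
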